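/- Fans $\Sigma$ live in $N=\mathbb Z^3$; $X_\Sigma$ is the associated toric threefold over $\mathbb C$, glued from the affine charts $\operatorname{Spec}\mathbb C[\sigma^\vee\cap M]$, $M=\operatorname{Hom}(N,\mathbb Z)$. For a ray $\rho\in\Sigma(1)$ let $D_\rho$ be the corresponding torus-invariant prime divisor, and for $\sigma\in\Sigma$ let $x_\sigma$ be the generic point of the torus orbit $O_\sigma$ (the torus-fixed point of the chart if $\dim\sigma=3$). A cone $\sigma\in\Sigma$ is called a quadrangle $ABCD$ if it has exactly four rays $A,B,C,D$, in this cyclic order, i.e. $AB$, $BC$, $CD$, $DA$ span two-dimensional faces of $\sigma$. A point $x$ of a scheme is an ordinary double point (node) if the completed local ring at $x$ is isomorphic to $\mathbb C[[z_1,\dots,z_4]]/(z_1^2+z_2^2+z_3^2+z_4^2)$; a threefold is nodal if each of its local rings is either regular or that of a node. (1) Let $X=X_\Sigma$ be any toric threefold and $\sigma\in\Sigma$ a cone such that $x_\sigma$ is an ordinary double point. Then $\sigma$ is a quadrangle, and for every labelling $ABCD$ of this quadrangle in cyclic order a torus-invariant Weil divisor $\sum_\rho a_\rho D_\rho$ is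 principal in a neighbourhood of $x_\sigma$ if and only if $$a_A+a_C=a_B+a_D .$$ (2) Let $X=X_\Sigma$ be a nodal toric Fano threefold, where $\Sigma$ is the fan of cones over the proper faces of a polytope in $N_{\mathbb R}$ that contains $0$ in its interior and whose vertices are primitive lattice vectors. Let $\pi:\widetilde X\to X$ be a toric small (hence crepant) resolution, i.e. $\widetilde X=X_{\widetilde\Sigma}$ is nonsingular, where $\widetilde\Sigma$ is a refinement of $\Sigma$ with the same support and the same rays, and $\pi$ is the toric morphism. Choose a cyclic labelling $ABCD$ of each quadrangle of $\Sigma$. Then every $\sum_\rho a_\rho D_\rho$ on $\widetilde X$ is Cartier, every element of $\operatorname{Pic}(\widetilde X)$ is the class of such a divisor, and there is a homomorphism $\phi=\bigoplus_{ABCD}\phi_{ABCD}$ with $$\phi_{ABCD}\Bigl(\Bigl[\sum_\rho a_\rho D_\rho\Bigr]\Bigr)=a_A-a_B+a_C-a_D$$ such that the sequence $$0\longrightarrow\operatorname{Pic}(X)\overset{\pi^*}{\longrightarrow}\operatorname{Pic}(\widetilde X)\overset{\phi}{\longrightarrow}\bigoplus_{ABCD}\mathbb Z$$ is exact, the sum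 being over all quadrangles $ABCD$ of $\Sigma$. -/

import Mathlib

namespace Toric

/-- The inclusion of the lattice `ℤⁿ` in `ℝⁿ`. -/
def toReal {n : ℕ} (u : Fin n → ℤ) : Fin n → ℝ := fun i => (u i : ℝ)

/-- The cone in `ℝⁿ` generated by a set of lattice vectors. -/
def coneHull {n : ℕ} (V : Set (Fin n → ℤ)) : PointedCone ℝ (Fin n → ℝ) :=
  PointedCone.hull ℝ (toReal '' V)

/-- `τ` is a face of `σ`: it is cut out of `σ` by a lattice vector `m` of the dual cone. -/
def IsFace {n : ℕ} (τ σ : PointedCone ℝ (Fin n → ℝ)) : Prop :=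
  ∃ m : Fin n → ℤ, (∀ x ∈ σ, 0 ≤ toReal m ⬝ᵥ x) ∧ ∀ x, x ∈ τ ↔ x ∈ σ ∧ toReal m ⬝ᵥ x = 0

/-- A fan: a finite collection of strongly convex rational polyhedral cones, closed under taking
faces, any two of which meet in a common face. -/
structure Fan (n : ℕ) where
  cones : Set (PointedCone ℝ (Fin n → ℝ))
  finite : cones.Finite
  rational : ∀ σ ∈ cones, ∃ V : Finset (Fin n → ℤ), σ = coneHull (V : Set (Fin n → ℤ))
  salient : ∀ σ ∈ cones, ∀ x ∈ σ, -x ∈ σ → x = 0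
  bot_mem : ⊥ ∈ cones
  face_mem : ∀ σ ∈ cones, ∀ τ, IsFace τ σ → τ ∈ cones
  inter_face : ∀ σ ∈ cones, ∀ τ ∈ cones, IsFace (σ ⊓ τ) σ

/-- The semigroup `σ^∨ ∩ M`. -/
def dualMonoid {n : ℕ} (σ : PointedCone ℝ (Fin n → ℝ)) : AddSubmonoid (Fin n → ℤ) where
  carrier := {m | ∀ x ∈ σ, 0 ≤ toReal m ⬝ᵥ x}
  zero_mem' := fun x _ => by simp [toReal, dotProduct]
  add_mem' := fun {a b} ha hb x hx => by
    have h : toReal (a + b) = toReal a + toReal b := by ext i; simp [toReal]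
    rw [h, add_dotProduct]
    exact add_nonneg (ha x hx) (hb x hx)

/-- The coordinate ring `ℂ[σ^∨ ∩ M]` of the affine toric variety of a cone. -/
abbrev coordRing {n : ℕ} (σ : PointedCone ℝ (Fin n → ℝ)) : Type :=
  AddMonoidAlgebra ℂ (dualMonoid σ)

theorem dualMonoid_anti {n : ℕ} {τ σ : PointedCone ℝ (Fin n → ℝ)} (h : τ ≤ σ) :
    dualMonoid σ ≤ dualMonoid τ := fun _ hm x hx => hm x (h hx)

/-- The inclusion `ℂ[σ^∨ ∩ M] ⊆ ℂ[τ^∨ ∩ M]` for `τ ⊆ σ`. -/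
noncomputable def coordMap {n : ℕ} {τ σ : PointedCone ℝ (Fin n → ℝ)} (h : τ ≤ σ) :
    coordRing σ →+* coordRing τ :=
  AddMonoidAlgebra.mapDomainRingHom ℂ (AddSubmonoid.inclusion (dualMonoid_anti h))

theorem toReal_add {n : ℕ} (a b : Fin n → ℤ) : toReal (a + b) = toReal a + toReal b := by
  ext i; simp [toReal]

theorem toReal_neg {n : ℕ} (a : Fin n → ℤ) : toReal (-a) = -toReal a := by
  ext i; simp [toReal]

theorem toReal_dot {n : ℕ} (a b : Fin n → ℤ) : toReal a ⬝ᵥ toReal b = ((a ⬝ᵥ b : ℤ) : ℝ) := by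
  simp [toReal, dotProduct]

theorem mem_dualMonoid_coneHull {n : ℕ} {V : Set (Fin n → ℤ)} {m : Fin n → ℤ} :
    m ∈ dualMonoid (coneHull V) ↔ ∀ v ∈ V, 0 ≤ m ⬝ᵥ v := by
  constructor
  · intro h v hv
    have := h (toReal v) (Submodule.subset_span ⟨v, hv, rfl⟩)
    rw [toReal_dot] at this
    exact_mod_cast this
  · intro h x hx
    induction hx using Submodule.span_induction with
    | mem x hx =>
      obtain ⟨v, hv, rfl⟩ := hx
      rw [toReal_dot]
      exact_mod_cast h v hv
    | zero => simp
    | add x y _ _ hx hy => rw [dotProduct_add]; exact add_nonneg hx hy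
    | smul c x _ hx =>
      have : c • x = (c : ℝ) • x := rfl
      rw [this, dotProduct_smul]
      exact mul_nonneg c.2 hx

/-- The semigroup of a rational polyhedral cone is finitely generated. -/
theorem dualMonoid_fg {n : ℕ} (V : Finset (Fin n → ℤ)) :
    (dualMonoid (coneHull (V : Set (Fin n → ℤ)))).FG := by
  let d : (Fin n → ℕ) × (Fin n → ℕ) × (V → ℕ) →+ (Fin n → ℤ) :=
    { toFun := fun p i => (p.1 i : ℤ) - p.2.1 i
      map_zero' := by ext; simp
      map_add' := fun p q => by ext; simp; ring }
  let f : (Fin n → ℕ) × (Fin n → ℕ) × (V → ℕ) →+ (V → ℤ) :=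
    { toFun := fun p v => d p ⬝ᵥ v.1
      map_zero' := by ext; simp
      map_add' := fun p q => by ext; simp [add_dotProduct] }
  let g : (Fin n → ℕ) × (Fin n → ℕ) × (V → ℕ) →+ (V → ℤ) :=
    { toFun := fun p v => (p.2.2 v : ℤ)
      map_zero' := by ext; simp
      map_add' := fun p q => by ext; simp }
  have h : (f.eqLocusM g).FG := AddSubmonoid.fg_eqLocusM f g
  have h2 := h.map d
  convert h2 using 1
  ext m
  rw [mem_dualMonoid_coneHull]
  constructor
  · intro hm
    have hd : d (fun i => (m i).toNat, fun i => (-m i).toNat, fun v => (m ⬝ᵥ v.1).toNat) = m := by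
      ext i; simp only [d, AddMonoidHom.coe_mk, ZeroHom.coe_mk]; omega
    refine ⟨_, ?_, hd⟩
    change f _ = g _
    ext v
    change d _ ⬝ᵥ v.1 = _
    rw [hd]
    simp [g, hm v.1 v.2]
  · rintro ⟨p, hp, rfl⟩ v hv
    have := congrFun (show f p = g p from hp) ⟨v, hv⟩
    change d p ⬝ᵥ v = (p.2.2 ⟨v, hv⟩ : ℤ) at this
    rw [this]; positivity

instance {n : ℕ} (σ : PointedCone ℝ (Fin n → ℝ)) : IsDomain (coordRing σ) := by
  have hinj : Function.Injective
      (AddMonoidAlgebra.mapDomainRingHom ℂ (dualMonoid σ).subtype) :=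
    AddMonoidAlgebra.mapDomain_injective Subtype.val_injective
  have : IsDomain (AddMonoidAlgebra ℂ (Fin n → ℤ)) := inferInstance
  exact hinj.isDomain _

theorem isNoetherianRing_coordRing {n : ℕ} (V : Finset (Fin n → ℤ)) :
    IsNoetherianRing (coordRing (coneHull (V : Set (Fin n → ℤ)))) := by
  have : AddMonoid.FG (dualMonoid (coneHull (V : Set (Fin n → ℤ)))) :=
    (AddMonoid.fg_iff_addSubmonoid_fg _).2 (dualMonoid_fg V)
  exact Algebra.FiniteType.isNoetherianRing ℂ _

/-- If `τ` is the face of `σ` cut out by `m`, then `ℂ[τ^∨ ∩ M]` is the localization of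
`ℂ[σ^∨ ∩ M]` at the character of `m`. -/
theorem isLocalization_coordMap {n : ℕ} {τ : PointedCone ℝ (Fin n → ℝ)} (V : Finset (Fin n → ℤ))
    {m : Fin n → ℤ} (hτ : τ ≤ coneHull (V : Set (Fin n → ℤ)))
    (hm : m ∈ dualMonoid (coneHull (V : Set (Fin n → ℤ))))
    (h : ∀ x, x ∈ τ ↔ x ∈ coneHull (V : Set (Fin n → ℤ)) ∧ toReal m ⬝ᵥ x = 0) :
    let _ := (coordMap hτ).toAlgebra
    IsLocalization.Away (AddMonoidAlgebra.single (⟨m, hm⟩ : dualMonoid _) (1 : ℂ))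
      (coordRing τ) := by
  let _ := (coordMap hτ).toAlgebra
  have hnm : -m ∈ dualMonoid τ := fun x hx => by
    rw [toReal_neg, neg_dotProduct, ((h x).1 hx).2, neg_zero]
  have key : ∀ w ∈ dualMonoid τ,
      ∃ k : ℕ, w + k • m ∈ dualMonoid (coneHull (V : Set (Fin n → ℤ))) := by
    intro w hw
    refine ⟨∑ v ∈ V, (w ⬝ᵥ v).natAbs, ?_⟩
    rw [mem_dualMonoid_coneHull]
    intro v hv
    have h0 : 0 ≤ m ⬝ᵥ v := mem_dualMonoid_coneHull.1 hm v hv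
    rw [add_dotProduct, smul_dotProduct, nsmul_eq_mul]
    rcases h0.eq_or_lt with h0 | h0
    · have : toReal v ∈ τ := (h _).2 ⟨Submodule.subset_span ⟨v, hv, rfl⟩, by
        rw [toReal_dot, ← h0, Int.cast_zero]⟩
      have := hw _ this
      rw [toReal_dot] at this
      have : 0 ≤ w ⬝ᵥ v := by exact_mod_cast this
      rw [← h0]; simpa
    · have h1 : (w ⬝ᵥ v).natAbs ≤ ∑ v ∈ V, (w ⬝ᵥ v).natAbs :=
        Finset.single_le_sum (f := fun v => (w ⬝ᵥ v).natAbs) (fun _ _ => Nat.zero_le _) hv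
      have h2 : -(w ⬝ᵥ v) ≤ ((∑ v ∈ V, (w ⬝ᵥ v).natAbs : ℕ) : ℤ) := by
        have : -(w ⬝ᵥ v) ≤ ((w ⬝ᵥ v).natAbs : ℤ) := by omega
        exact this.trans (by exact_mod_cast h1)
      nlinarith [Nat.cast_nonneg (α := ℤ) (∑ v ∈ V, (w ⬝ᵥ v).natAbs)]
  have hsingle : ∀ (w : dualMonoid (coneHull (V : Set (Fin n → ℤ)))) (c : ℂ),
      coordMap hτ (AddMonoidAlgebra.single w c) =
        AddMonoidAlgebra.single (AddSubmonoid.inclusion (dualMonoid_anti hτ) w) c := fun w c => by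
    simp [coordMap]
  have hinj : Function.Injective (coordMap hτ) :=
    AddMonoidAlgebra.mapDomain_injective (AddSubmonoid.inclusion_injective (dualMonoid_anti hτ))
  refine IsLocalization.Away.mk _ ?_ ?_ ?_
  · refine IsUnit.of_mul_eq_one (AddMonoidAlgebra.single ⟨-m, hnm⟩ 1) ?_
    rw [RingHom.algebraMap_toAlgebra, hsingle, AddMonoidAlgebra.single_mul_single,
      AddMonoidAlgebra.one_def]
    congr 1
    · ext; simp
    · simp
  · intro z
    induction z using AddMonoidAlgebra.induction_linear with
    | zero => exact ⟨0, 0, by simp⟩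
    | add x y hx hy =>
      obtain ⟨k, a, ha⟩ := hx
      obtain ⟨l, b, hb⟩ := hy
      refine ⟨k + l, a * (AddMonoidAlgebra.single ⟨m, hm⟩ 1) ^ l +
        b * (AddMonoidAlgebra.single ⟨m, hm⟩ 1) ^ k, ?_⟩
      simp only [map_add, map_mul, map_pow, ← ha, ← hb]
      ring
    | single w c =>
      obtain ⟨k, hk⟩ := key w w.2
      refine ⟨k, AddMonoidAlgebra.single ⟨_, hk⟩ c, ?_⟩
      rw [RingHom.algebraMap_toAlgebra, hsingle, hsingle, AddMonoidAlgebra.single_pow,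
        AddMonoidAlgebra.single_mul_single]
      congr 1
      simp
  · intro a b hab
    exact ⟨0, by rw [hinj hab]⟩


theorem coordMap_single {n : ℕ} {τ σ : PointedCone ℝ (Fin n → ℝ)} (h : τ ≤ σ)
    (w : dualMonoid σ) (c : ℂ) : coordMap h (AddMonoidAlgebra.single w c) =
      AddMonoidAlgebra.single (AddSubmonoid.inclusion (dualMonoid_anti h) w) c := by
  simp [coordMap]

theorem coordMap_refl {n : ℕ} {σ : PointedCone ℝ (Fin n → ℝ)} (h : σ ≤ σ) :
    coordMap h = RingHom.id _ := by
  refine AddMonoidAlgebra.ringHom_ext ?_ ?_ <;> intro _ <;> rw [coordMap_single] <;> rfl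

theorem coordMap_trans {n : ℕ} {ρ τ σ : PointedCone ℝ (Fin n → ℝ)} (h : ρ ≤ τ) (k : τ ≤ σ) :
    coordMap (h.trans k) = (coordMap h).comp (coordMap k) := by
  refine AddMonoidAlgebra.ringHom_ext ?_ ?_ <;> intro _ <;>
    rw [RingHom.comp_apply, coordMap_single, coordMap_single, coordMap_single] <;> rfl

open AlgebraicGeometry CategoryTheory CategoryTheory.Limits

namespace Fan

variable {n : ℕ} (F : Fan n)

theorem isFace_of_le {τ σ : F.cones} (h : τ ≤ σ) : IsFace τ.1 σ.1 := by
  have := F.inter_face σ.1 σ.2 τ.1 τ.2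
  rwa [inf_eq_right.2 (show τ.1 ≤ σ.1 from h)] at this

/-- The diagram of affine toric varieties `Spec ℂ[σ^∨ ∩ M]`, for `σ` in the fan. -/
noncomputable def diagram : F.cones ⥤ Scheme.{0} where
  obj σ := Spec (CommRingCat.of (coordRing σ.1))
  map {τ σ} h := Spec.map (CommRingCat.ofHom (coordMap (show τ.1 ≤ σ.1 from leOfHom h)))
  map_id σ := by
    rw [coordMap_refl]
    exact Spec.map_id _
  map_comp {ρ τ σ} h k := by
    rw [← Spec.map_comp, ← CommRingCat.ofHom_comp, ← coordMap_trans]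

/-- Inclusions of cones are localizations. -/
theorem exists_away {τ σ : F.cones} (h : τ ≤ σ) : ∃ (m : Fin n → ℤ) (hm : m ∈ dualMonoid σ.1),
    (∀ x, x ∈ τ.1 ↔ x ∈ σ.1 ∧ toReal m ⬝ᵥ x = 0) ∧
    let _ := (coordMap (show τ.1 ≤ σ.1 from h)).toAlgebra
    IsLocalization.Away (AddMonoidAlgebra.single (⟨m, hm⟩ : dualMonoid σ.1) (1 : ℂ))
      (coordRing τ.1) := by
  obtain ⟨m, hm, hτ⟩ := F.isFace_of_le h
  refine ⟨m, hm, hτ, ?_⟩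
  obtain ⟨σ, hσ⟩ := σ
  obtain ⟨V, rfl⟩ := F.rational σ hσ
  exact isLocalization_coordMap V h hm hτ

instance {τ σ : F.cones} (h : τ ⟶ σ) : IsOpenImmersion (F.diagram.map h) := by
  obtain ⟨m, hm, -, hl⟩ := F.exists_away (leOfHom h)
  let _ := (coordMap (show τ.1 ≤ σ.1 from leOfHom h)).toAlgebra
  exact IsOpenImmersion.of_isLocalization (AddMonoidAlgebra.single (⟨m, hm⟩ : dualMonoid σ.1) (1 : ℂ))

theorem range_diagram_map {τ σ : F.cones} (h : τ ⟶ σ) {m : Fin n → ℤ} (hm : m ∈ dualMonoid σ.1)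
    (hτ : ∀ x, x ∈ τ.1 ↔ x ∈ σ.1 ∧ toReal m ⬝ᵥ x = 0) :
    Set.range (F.diagram.map h) =
      (PrimeSpectrum.basicOpen (AddMonoidAlgebra.single (⟨m, hm⟩ : dualMonoid σ.1) (1 : ℂ)) :
        Set (PrimeSpectrum (coordRing σ.1))) := by
  let _ := (coordMap (show τ.1 ≤ σ.1 from leOfHom h)).toAlgebra
  have hl : IsLocalization.Away (AddMonoidAlgebra.single (⟨m, hm⟩ : dualMonoid σ.1) (1 : ℂ))
      (coordRing τ.1) := by
    obtain ⟨V, hV⟩ := F.rational σ.1 σ.2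
    obtain ⟨σ, hσ⟩ := σ
    obtain rfl : σ = _ := hV
    exact isLocalization_coordMap V (leOfHom h) hm hτ
  exact PrimeSpectrum.localization_away_comap_range (coordRing τ.1)
    (AddMonoidAlgebra.single (⟨m, hm⟩ : dualMonoid σ.1) (1 : ℂ))

instance : (F.diagram ⋙ Scheme.forget).IsLocallyDirected where
  cond {τ ρ σ} fτ fρ x y hxy := by
    obtain ⟨m, hm, hτ⟩ := F.isFace_of_le (leOfHom fτ)
    obtain ⟨l, hl, hρ⟩ := F.isFace_of_le (leOfHom fρ)
    have hface : IsFace (τ.1 ⊓ ρ.1) τ.1 := F.inter_face _ τ.2 _ ρ.2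
    let κ : F.cones := ⟨τ.1 ⊓ ρ.1, F.face_mem _ τ.2 _ hface⟩
    have hκτ : κ ≤ τ := (inf_le_left : τ.1 ⊓ ρ.1 ≤ τ.1)
    have hκρ : κ ≤ ρ := (inf_le_right : τ.1 ⊓ ρ.1 ≤ ρ.1)
    have hml : m + l ∈ dualMonoid σ.1 := add_mem hm hl
    have hκ : ∀ x, x ∈ κ.1 ↔ x ∈ σ.1 ∧ toReal (m + l) ⬝ᵥ x = 0 := by
      intro x
      change (x ∈ τ.1 ∧ x ∈ ρ.1) ↔ _
      rw [hτ, hρ, toReal_add, add_dotProduct]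
      constructor
      · rintro ⟨⟨h1, h2⟩, -, h3⟩
        exact ⟨h1, by rw [h2, h3, add_zero]⟩
      · rintro ⟨h1, h2⟩
        have h3 := hm x h1
        have h4 := hl x h1
        exact ⟨⟨h1, by linarith⟩, h1, by linarith⟩
    let gτ : κ ⟶ τ := homOfLE hκτ
    let gρ : κ ⟶ ρ := homOfLE hκρ
    let x' : F.diagram.obj τ := x
    let y' : F.diagram.obj ρ := y
    have hxy' : F.diagram.map fτ x' = F.diagram.map fρ y' := hxy
    have hx : F.diagram.map fτ x' ∈ Set.range (F.diagram.map fτ) := ⟨x', rfl⟩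
    have hy : F.diagram.map fτ x' ∈ Set.range (F.diagram.map fρ) := ⟨y', hxy'.symm⟩
    rw [F.range_diagram_map fτ hm hτ] at hx
    rw [F.range_diagram_map fρ hl hρ] at hy
    have hz : F.diagram.map fτ x' ∈ Set.range (F.diagram.map (gτ ≫ fτ)) := by
      rw [F.range_diagram_map (gτ ≫ fτ) hml hκ]
      have : (AddMonoidAlgebra.single (⟨m + l, hml⟩ : dualMonoid σ.1) (1 : ℂ)) =
          AddMonoidAlgebra.single ⟨m, hm⟩ 1 * AddMonoidAlgebra.single ⟨l, hl⟩ 1 := by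
        rw [AddMonoidAlgebra.single_mul_single]
        congr 1
        simp
      rw [this, PrimeSpectrum.basicOpen_mul]
      exact ⟨hx, hy⟩
    obtain ⟨z, hz⟩ := hz
    refine ⟨κ, gτ, gρ, z, ?_, ?_⟩
    · apply (F.diagram.map fτ).isOpenEmbedding.injective
      rw [← hz, F.diagram.map_comp]
      rfl
    · apply (F.diagram.map fρ).isOpenEmbedding.injective
      have h1 : gρ ≫ fρ = gτ ≫ fτ := Subsingleton.elim _ _
      have h2 : F.diagram.map (gρ ≫ fρ) z = F.diagram.map fρ y' := by rw [h1, hz, hxy']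
      rw [F.diagram.map_comp] at h2
      exact h2

/-- The toric variety of a fan, glued from the affine toric varieties of its cones. -/
noncomputable def toricVariety : Scheme.{0} := colimit F.diagram

/-- The affine chart of a cone. -/
noncomputable def chart (σ : F.cones) : Spec (CommRingCat.of (coordRing σ.1)) ⟶ F.toricVariety :=
  colimit.ι F.diagram σ

instance (σ : F.cones) : IsOpenImmersion (F.chart σ) :=
  inferInstanceAs (IsOpenImmersion (colimit.ι F.diagram σ))

theorem exists_chart (x : F.toricVariety) : ∃ σ y, F.chart σ y = x :=
  Scheme.IsLocallyDirected.ι_jointly_surjective F.diagram x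

theorem map_comp_chart {τ σ : F.cones} (h : τ ≤ σ) :
    Spec.map (CommRingCat.ofHom (coordMap (show τ.1 ≤ σ.1 from h))) ≫ F.chart σ = F.chart τ :=
  colimit.w F.diagram (homOfLE h)

instance : IsLocallyNoetherian F.toricVariety := by
  have : ∀ σ : F.cones, IsNoetherianRing (coordRing σ.1) := by
    rintro ⟨σ, hσ⟩
    obtain ⟨V, rfl⟩ := F.rational σ hσ
    exact isNoetherianRing_coordRing V
  have h : ∀ σ : F.cones, IsLocallyNoetherian (F.diagram.obj σ) := fun σ => by
    have : IsNoetherianRing (CommRingCat.of (coordRing σ.1)) := this σ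
    exact isLocallyNoetherian_Spec.2 this
  exact (isLocallyNoetherian_iff_openCover
    (Scheme.IsLocallyDirected.openCover F.diagram)).2 fun i => h _

/-- The generic point of the torus. -/
noncomputable def torusPoint : F.toricVariety :=
  F.chart ⟨⊥, F.bot_mem⟩ (genericPoint (Spec (CommRingCat.of (coordRing ⊥))))

theorem chart_genericPoint (σ : F.cones) :
    F.chart σ (genericPoint (Spec (CommRingCat.of (coordRing σ.1)))) = F.torusPoint := by
  have h : (⟨⊥, F.bot_mem⟩ : F.cones) ≤ σ := (bot_le : ⊥ ≤ σ.1)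
  have : IsOpenImmersion (Spec.map (CommRingCat.ofHom
      (coordMap (show (⊥ : PointedCone ℝ (Fin n → ℝ)) ≤ σ.1 from h)))) :=
    inferInstanceAs (IsOpenImmersion (F.diagram.map (homOfLE h)))
  rw [torusPoint, ← F.map_comp_chart h, Scheme.Hom.comp_apply]
  exact congrArg (F.chart σ) (genericPoint_eq_of_isOpenImmersion _).symm

theorem torusPoint_specializes (x : F.toricVariety) : F.torusPoint ⤳ x := by
  obtain ⟨σ, y, rfl⟩ := F.exists_chart x
  rw [← F.chart_genericPoint σ]
  exact ((genericPoint_spec _).specializes trivial).map (F.chart σ).continuous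

instance : IsIntegral F.toricVariety := by
  have : IsReduced F.toricVariety :=
    @IsReduced.of_openCover _ (Scheme.IsLocallyDirected.openCover F.diagram) fun i =>
      inferInstanceAs (IsReduced (Spec (CommRingCat.of (coordRing _))))
  have h : IsIrreducible (Set.univ : Set F.toricVariety) := by
    have : closure {F.torusPoint} = Set.univ :=
      Set.eq_univ_of_forall fun x => (F.torusPoint_specializes x).mem_closure
    rw [← this]
    exact isIrreducible_singleton.closure
  have : IrreducibleSpace F.toricVariety := (irreducibleSpace_def _).2 h
  exact isIntegral_of_irreducibleSpace_of_isReduced _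



/-- The ring map `ℂ[σ^∨ ∩ M] → ℂ[M]` that fixes the characters in `σ^⊥` and kills the other
ones. -/
noncomputable def orbitHom {n : ℕ} (σ : PointedCone ℝ (Fin n → ℝ)) :
    coordRing σ →ₐ[ℂ] AddMonoidAlgebra ℂ (Fin n → ℤ) :=
  open scoped Classical in
  AddMonoidAlgebra.lift ℂ _ _
    { toFun := fun m => if ∀ x ∈ σ, toReal m.toAdd.1 ⬝ᵥ x = 0 then
        AddMonoidAlgebra.single m.toAdd.1 1 else 0
      map_one' := by
        rw [if_pos]
        · rfl
        · intro x _
          simp [toReal, dotProduct]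
      map_mul' := fun a b => by
        have h : (∀ x ∈ σ, toReal (a * b).toAdd.1 ⬝ᵥ x = 0) ↔
            (∀ x ∈ σ, toReal a.toAdd.1 ⬝ᵥ x = 0) ∧ ∀ x ∈ σ, toReal b.toAdd.1 ⬝ᵥ x = 0 := by
          rw [← forall₂_and]
          refine forall₂_congr fun x hx => ?_
          have h1 := a.toAdd.2 x hx
          have h2 := b.toAdd.2 x hx
          have h3 : toReal (a * b).toAdd.1 = toReal a.toAdd.1 + toReal b.toAdd.1 :=
            toReal_add _ _
          rw [h3, add_dotProduct]
          constructor
          · intro h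
            constructor <;> linarith
          · rintro ⟨h, k⟩
            rw [h, k, add_zero]
        by_cases ha : ∀ x ∈ σ, toReal a.toAdd.1 ⬝ᵥ x = 0
        · by_cases hb : ∀ x ∈ σ, toReal b.toAdd.1 ⬝ᵥ x = 0
          · rw [if_pos (h.2 ⟨ha, hb⟩), if_pos ha, if_pos hb, AddMonoidAlgebra.single_mul_single,
              mul_one]
            rfl
          · rw [if_neg fun k => hb (h.1 k).2, if_neg hb, mul_zero]
        · rw [if_neg fun k => ha (h.1 k).1, if_neg ha, zero_mul] }

/-- The generic point of the torus orbit of a cone. For a cone of full dimension it is the fixed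
point of the torus in the chart of the cone. -/
noncomputable def orbitPoint (σ : F.cones) : F.toricVariety :=
  F.chart σ (⟨RingHom.ker (orbitHom σ.1), RingHom.ker_isPrime _⟩ : PrimeSpectrum (coordRing σ.1))

/-- The primitive generators of the rays of the fan. -/
def rays : Set (Fin n → ℤ) :=
  {u | (∀ (k : ℤ) (w : Fin n → ℤ), u = k • w → IsUnit k) ∧ coneHull {u} ∈ F.cones}

/-- The torus-invariant Weil divisor `∑ a_ρ D_ρ`, as a formal sum of generic points of prime
divisors. -/
noncomputable def divisor (a : F.rays →₀ ℤ) : F.toricVariety →₀ ℤ :=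
  a.mapDomain fun ρ => F.orbitPoint ⟨coneHull {ρ.1}, ρ.2.2⟩

/-- The cone `σ` is a quadrangle: its rays are `A`, `B`, `C`, `D` in this cyclic order. -/
def IsQuadrangle {F : Fan n} (σ : F.cones) (A B C D : F.rays) : Prop :=
  [A, B, C, D].Nodup ∧ σ.1 = coneHull {A.1, B.1, C.1, D.1} ∧
    IsFace (coneHull {A.1, B.1}) σ.1 ∧ IsFace (coneHull {B.1, C.1}) σ.1 ∧
    IsFace (coneHull {C.1, D.1}) σ.1 ∧ IsFace (coneHull {D.1, A.1}) σ.1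

/-- The cones of the fan that are quadrangles. -/
def quadrangles : Set F.cones := {σ | ∃ A B C D : F.rays, IsQuadrangle σ A B C D}

/-- The fan consists of the cones over the proper faces (the empty one included) of a polytope
with `0` in its interior whose vertices are primitive lattice vectors; its toric variety is
Fano. -/
def IsFano : Prop :=
  ∃ V : Finset (Fin n → ℤ),
    (∀ v ∈ V, ∀ (k : ℤ) (w : Fin n → ℤ), v = k • w → IsUnit k) ∧
    (∀ v ∈ V, toReal v ∉ convexHull ℝ (toReal '' ((V : Set (Fin n → ℤ)) \ {v}))) ∧
    0 ∈ interior (convexHull ℝ (toReal '' (V : Set (Fin n → ℤ)))) ∧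
    F.cones = {σ | ∃ m : Fin n → ℝ, (∀ v ∈ V, m ⬝ᵥ toReal v ≤ 1) ∧
      σ = coneHull {v | v ∈ V ∧ m ⬝ᵥ toReal v = 1}}

/-- The fan `G` refines the fan `F`. -/
def Refines (G F : Fan n) : Prop := ∀ τ ∈ G.cones, ∃ σ ∈ F.cones, τ ≤ σ

theorem chart_map_eq {G F : Fan n} {τ τ' : G.cones} (h : τ' ≤ τ) {σ σ' : F.cones}
    (hσ : τ.1 ≤ σ.1) (hσ' : τ'.1 ≤ σ'.1) :
    Spec.map (CommRingCat.ofHom (coordMap (show τ'.1 ≤ τ.1 from h))) ≫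
      Spec.map (CommRingCat.ofHom (coordMap hσ)) ≫ F.chart σ =
    Spec.map (CommRingCat.ofHom (coordMap hσ')) ≫ F.chart σ' := by
  let κ : F.cones := ⟨σ.1 ⊓ σ'.1, F.face_mem _ σ.2 _ (F.inter_face _ σ.2 _ σ'.2)⟩
  have h1 : κ ≤ σ := (inf_le_left : σ.1 ⊓ σ'.1 ≤ σ.1)
  have h2 : κ ≤ σ' := (inf_le_right : σ.1 ⊓ σ'.1 ≤ σ'.1)
  have h3 : τ'.1 ≤ κ.1 := le_inf ((show τ'.1 ≤ τ.1 from h).trans hσ) hσ'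
  have e1 : coordMap hσ' = (coordMap h3).comp (coordMap (show κ.1 ≤ σ'.1 from h2)) :=
    coordMap_trans h3 h2
  have e2 : (coordMap (show τ'.1 ≤ τ.1 from h)).comp (coordMap hσ) =
      (coordMap h3).comp (coordMap (show κ.1 ≤ σ.1 from h1)) := by
    rw [← coordMap_trans, ← coordMap_trans]
  rw [← Category.assoc, ← Spec.map_comp, ← CommRingCat.ofHom_comp, e2, e1, CommRingCat.ofHom_comp,
    Spec.map_comp, CommRingCat.ofHom_comp, Spec.map_comp, Category.assoc, Category.assoc,
    F.map_comp_chart h1, F.map_comp_chart h2]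

/-- A cone of `F` that contains the given cone of `G`. -/
noncomputable def Refines.cone {G F : Fan n} (h : Refines G F) (τ : G.cones) : F.cones :=
  ⟨(h τ.1 τ.2).choose, (h τ.1 τ.2).choose_spec.1⟩

theorem Refines.le_cone {G F : Fan n} (h : Refines G F) (τ : G.cones) : τ.1 ≤ (h.cone τ).1 :=
  (h τ.1 τ.2).choose_spec.2

/-- The toric morphism of a refinement on the chart of a cone `τ`: the map
`Spec ℂ[τ^∨ ∩ M] → Spec ℂ[σ^∨ ∩ M]` for any cone `σ ⊇ τ`. -/
noncomputable def toricLeg {G F : Fan n} (h : Refines G F) (τ : G.cones) :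
    G.diagram.obj τ ⟶ F.toricVariety :=
  Spec.map (CommRingCat.ofHom (coordMap (h.le_cone τ))) ≫ F.chart (h.cone τ)

theorem map_comp_toricLeg {G F : Fan n} (h : Refines G F) {τ' τ : G.cones} (f : τ' ⟶ τ) :
    G.diagram.map f ≫ toricLeg h τ = toricLeg h τ' :=
  chart_map_eq (σ := h.cone τ) (σ' := h.cone τ') (leOfHom f) (h.le_cone τ) (h.le_cone τ')

/-- The toric morphism of a refinement of fans. -/
noncomputable def toricMap {G F : Fan n} (h : Refines G F) : G.toricVariety ⟶ F.toricVariety :=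
  colimit.desc G.diagram (Cocone.mk F.toricVariety
    { app := fun τ => toricLeg h τ
      naturality := fun _ _ f => (map_comp_toricLeg h f).trans (Category.comp_id _).symm })

theorem chart_toricMap {G F : Fan n} (h : Refines G F) (τ : G.cones) (σ : F.cones)
    (hσ : τ.1 ≤ σ.1) : G.chart τ ≫ toricMap h =
      Spec.map (CommRingCat.ofHom (coordMap hσ)) ≫ F.chart σ := by
  have h1 : G.chart τ ≫ toricMap h = toricLeg h τ := colimit.ι_desc _ _
  have h2 := chart_map_eq (G := G) (le_refl τ) hσ (h.le_cone τ)
  have h3 : Spec.map (CommRingCat.ofHom (coordMap (le_refl τ.1))) = 𝟙 _ := by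
    rw [coordMap_refl]
    exact Spec.map_id _
  rw [h3] at h2
  exact h1.trans (h2.symm.trans (Category.id_comp _))

instance {G F : Fan n} (h : Refines G F) : IsDominant (toricMap h) := by
  refine ⟨?_⟩
  have h1 : toricMap h G.torusPoint = F.torusPoint := by
    have := chart_toricMap h ⟨⊥, G.bot_mem⟩ ⟨⊥, F.bot_mem⟩ le_rfl
    rw [torusPoint, torusPoint, ← Scheme.Hom.comp_apply, this, F.map_comp_chart le_rfl]
  intro x
  exact closure_mono (Set.singleton_subset_iff.2 (Set.mem_range.2 ⟨_, h1⟩))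
    (F.torusPoint_specializes x).mem_closure

/-- `G` defines a toric small resolution of the toric variety of `F`: a refinement with the same support and no new rays, whose
toric variety is nonsingular. -/
structure IsSmallResolution (G F : Fan n) : Prop where
  refines : Refines G F
  support : ∀ σ ∈ F.cones, ∀ x ∈ σ, ∃ τ ∈ G.cones, x ∈ τ
  rays_eq : G.rays = F.rays
  regular : ∀ x : G.toricVariety, IsRegularLocalRing (G.toricVariety.presheaf.stalk x)

/-- The identification of the rays of a fan and of its small resolution. -/
def IsSmallResolution.rayEquiv {G F : Fan n} (h : IsSmallResolution G F) : F.rays ≃ G.rays :=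
  Equiv.setCongr h.rays_eq.symm

end Fan

/-- A local ring of an ordinary double point of a complex threefold: its completion is
`ℂ[[z₁, z₂, z₃, z₄]] / (z₁² + z₂² + z₃² + z₄²)`. -/
def IsOrdinaryDoublePoint (R : Type*) [CommRing R] [IsLocalRing R] : Prop :=
  Nonempty (AdicCompletion (IsLocalRing.maximalIdeal R) R ≃+*
    MvPowerSeries (Fin 4) ℂ ⧸
      Ideal.span {∑ i, (MvPowerSeries.X i : MvPowerSeries (Fin 4) ℂ) ^ 2})

/-- The only singularities of `X` are ordinary double points. -/
def IsNodal (X : Scheme.{0}) : Prop :=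
  ∀ x : X, IsRegularLocalRing (X.presheaf.stalk x) ∨ IsOrdinaryDoublePoint (X.presheaf.stalk x)

section Divisors

variable (X : Scheme.{0}) [IsIntegral X]

/-- The subgroup `O_{X,x}^*` of `K(X)^*`. -/
noncomputable def stalkUnits (x : X) : Subgroup (X.functionField)ˣ :=
  (Units.map (algebraMap (X.presheaf.stalk x) X.functionField).toMonoidHom).range

/-- The stalk `K(X)^* / O_{X,x}^*` of the sheaf of Cartier divisors. -/
def CartierGerm (x : X) : Type := (X.functionField)ˣ ⧸ stalkUnits X x

noncomputable instance (x : X) : CommGroup (CartierGerm X x) :=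
  inferInstanceAs (CommGroup ((X.functionField)ˣ ⧸ stalkUnits X x))

/-- The germ at `x` of the Cartier divisor of a rational function. -/
noncomputable def cartierGerm (x : X) : (X.functionField)ˣ →* CartierGerm X x :=
  QuotientGroup.mk' (stalkUnits X x)

/-- The group of Cartier divisors of an integral scheme, that is of global sections of the sheaf
`K^*/O^*`, as families of germs which are locally given by one rational function. -/
def CartierDivisor : Subgroup (∀ x : X, CartierGerm X x) where
  carrier := {s | ∀ x : X, ∃ U : X.Opens, x ∈ U ∧ ∃ f : (X.functionField)ˣ,
    ∀ y ∈ U, s y = cartierGerm X y f}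
  one_mem' := fun x => ⟨⊤, trivial, 1, fun y _ => (map_one (cartierGerm X y)).symm⟩
  mul_mem' := fun {s t} hs ht x => by
    obtain ⟨U, hU, f, hf⟩ := hs x
    obtain ⟨V, hV, g, hg⟩ := ht x
    exact ⟨U ⊓ V, ⟨hU, hV⟩, f * g, fun y hy => by
      rw [Pi.mul_apply, hf y hy.1, hg y hy.2, map_mul]⟩
  inv_mem' := fun {s} hs x => by
    obtain ⟨U, hU, f, hf⟩ := hs x
    exact ⟨U, hU, f⁻¹, fun y hy => by rw [Pi.inv_apply, hf y hy, map_inv]⟩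

/-- The principal Cartier divisor of a rational function. -/
noncomputable def principal : (X.functionField)ˣ →* CartierDivisor X where
  toFun f := ⟨fun x => cartierGerm X x f, fun _ => ⟨⊤, trivial, f, fun _ _ => rfl⟩⟩
  map_one' := Subtype.ext (funext fun x => map_one (cartierGerm X x))
  map_mul' f g := Subtype.ext (funext fun x => map_mul (cartierGerm X x) f g)

/-- The Picard group of an integral scheme, as the group of Cartier divisors modulo principal
ones. -/
def Pic : Type := CartierDivisor X ⧸ (principal X).range

noncomputable instance : CommGroup (Pic X) :=
  inferInstanceAs (CommGroup (CartierDivisor X ⧸ (principal X).range))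

/-- The class of a Cartier divisor. -/
noncomputable def divisorClass : CartierDivisor X →* Pic X :=
  QuotientGroup.mk' (principal X).range

variable {X}

/-- The Weil divisor `W` is principal in a neighbourhood of the point `x`. -/
def IsPrincipalAt [IsLocallyNoetherian X] (W : X →₀ ℤ) (x : X) : Prop :=
  ∃ U : X.Opens, x ∈ U ∧ ∃ f : X.functionField, f ≠ 0 ∧
    ∀ z ∈ U, Order.coheight z = 1 → X.ord f z = W z

/-- The Weil divisor of the Cartier divisor `s` is `W`. -/
def HasWeilDivisor [IsLocallyNoetherian X] (s : CartierDivisor X) (W : X →₀ ℤ) : Prop :=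
  ∀ z : X, Order.coheight z = 1 → ∀ f : (X.functionField)ˣ,
    s.1 z = cartierGerm X z f → X.ord (f : X.functionField) z = W z

variable {Y : Scheme.{0}} [IsIntegral Y] (π : Y ⟶ X) [IsDominant π]

theorem genericPoint_eq_of_isDominant : π (genericPoint Y) = genericPoint X := by
  have h := (genericPoint_spec Y).image π.continuous
  rw [Set.image_univ, π.denseRange.closure_range] at h
  exact h.eq (genericPoint_spec X)

/-- The pullback of rational functions by a dominant morphism. -/
noncomputable def pullbackFunction : X.functionField →+* Y.functionField :=
  (X.presheaf.stalkSpecializes (specializes_of_eq (genericPoint_eq_of_isDominant π)) ≫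
    π.stalkMap (genericPoint Y)).hom

theorem pullbackFunction_algebraMap (y : Y) (a : X.presheaf.stalk (π y)) :
    pullbackFunction π (algebraMap _ _ a) = algebraMap _ _ ((π.stalkMap y).hom a) := by
  have h : genericPoint Y ⤳ y := (genericPoint_spec Y).specializes trivial
  have e := Scheme.Hom.stalkSpecializes_stalkMap_apply π _ _ h a
  refine Eq.trans ?_ e
  change (π.stalkMap (genericPoint Y)).hom ((X.presheaf.stalkSpecializes _).hom
    ((X.presheaf.stalkSpecializes _).hom a)) = _
  refine congrArg (π.stalkMap (genericPoint Y)).hom ?_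
  exact DFunLike.congr_fun (congrArg CommRingCat.Hom.hom
    (TopCat.Presheaf.stalkSpecializes_comp X.presheaf _ _)) a

theorem stalkUnits_le_comap (y : Y) : stalkUnits X (π y) ≤
    (stalkUnits Y y).comap (Units.map (pullbackFunction π).toMonoidHom) := by
  rintro _ ⟨u, rfl⟩
  exact ⟨Units.map (π.stalkMap y).hom.toMonoidHom u,
    Units.ext (pullbackFunction_algebraMap π y u).symm⟩

/-- The pullback of germs of Cartier divisors by a dominant morphism. -/
noncomputable def CartierGerm.pullback (y : Y) : CartierGerm X (π y) →* CartierGerm Y y :=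
  QuotientGroup.map (stalkUnits X (π y)) (stalkUnits Y y)
    (Units.map (pullbackFunction π).toMonoidHom) (stalkUnits_le_comap π y)

theorem CartierGerm.pullback_germ (y : Y) (f : (X.functionField)ˣ) :
    CartierGerm.pullback π y (cartierGerm X (π y) f) =
      cartierGerm Y y (Units.map (pullbackFunction π).toMonoidHom f) := rfl

/-- The pullback of Cartier divisors by a dominant morphism. -/
noncomputable def CartierDivisor.pullback : CartierDivisor X →* CartierDivisor Y where
  toFun s := ⟨fun y => CartierGerm.pullback π y (s.1 (π y)), fun y => by
    obtain ⟨U, hU, f, hf⟩ := s.2 (π y)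
    exact ⟨π ⁻¹ᵁ U, hU, Units.map (pullbackFunction π).toMonoidHom f, fun z hz => by
      exact congrArg (CartierGerm.pullback π z) (hf (π z) hz)⟩⟩
  map_one' := Subtype.ext (funext fun y => map_one (CartierGerm.pullback π y))
  map_mul' s t := Subtype.ext (funext fun y =>
    map_mul (CartierGerm.pullback π y) (s.1 (π y)) (t.1 (π y)))

theorem principal_range_le : (principal X).range ≤
    (principal Y).range.comap (CartierDivisor.pullback π) := by
  rintro _ ⟨f, rfl⟩
  exact ⟨Units.map (pullbackFunction π).toMonoidHom f, rfl⟩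

/-- The pullback of divisor classes by a dominant morphism. -/
noncomputable def Pic.pullback : Pic X →* Pic Y :=
  QuotientGroup.map (principal X).range (principal Y).range (CartierDivisor.pullback π)
    (principal_range_le π)

end Divisors

end Toric

/-! The proof expresses everything in terms of Laurent polynomials. The charts of a toric variety all
contain the torus, so that rational functions are quotients of Laurent polynomials
(`Toric.Fan.exists_ratFun`), the order along the divisor of a ray `ρ` is the least value of `ρ` on the
exponents (`Toric.Fan.ord_orbitPoint`), and the pullback along a toric morphism is the identity on
Laurent polynomials (`Toric.Fan.pullbackFunction_toricMap`).

Four facts about divisors follow. The coordinate ring of the torus is factorial, so that Cartier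
divisors on the torus are principal (`Toric.exists_eq_cartierGerm_of_factorial`); hence each class
is represented by a Cartier divisor that is trivial on the torus, and its Weil divisor is supported
on the divisors of the rays (`Toric.Fan.mem_torus_or_eq_orbitPoint`). A Cartier divisor is
determined by its Weil divisor (`Toric.Fan.eq_one_of_hasWeilDivisor_zero`): a Laurent polynomial is
regular on the chart of a cone if its orders along the rays of the cone are nonnegative. Linear forms
on the cones that agree on the rays glue to a Cartier divisor
(`Toric.Fan.exists_cartierDivisor_of_character`). Finally, the order of a Laurent polynomial is a
superadditive function of the vector `ρ`. If `f` and its inverse are both Laurent polynomials up to a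
function that has order zero along `A`, `B`, `C`, `D` and `A + C = B + D`, then the order of `f` is
additive on both sides of this relation, so that the orders satisfy it as well
(`Toric.HasOrder.quadrangle`, `Toric.Fan.ord_quadrangle`). This yields the necessity of
`a A + a C = a B + a D` without a description of the equation of the divisor.

At an ordinary double point the maximal ideal `m` of the local ring satisfies: `m / m ^ 2` has
dimension four, and a quadratic form in elements of `m` is in `m ^ 3` if and only if it is a
multiple of a fixed nondegenerate form (`Toric.IsOrdinaryDoublePoint.exists_differential`).
The powers of `m` are generated by characters. It follows that the cone has full dimension, that
its dual semigroup has exactly four irreducible elements, which form a basis of `m / m ^ 2`. As there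
is a quadratic relation between these characters modulo `m ^ 3` and a single product is not one, two
different products agree: `a + b = c + d`, and all four elements occur in this equality because all
relations are nondegenerate
(`Toric.exists_generators_of_isOrdinaryDoublePoint`). Dualizing, the cone is the cone over a unit
square (`Toric.exists_isSquare`). On the vertices of a unit square an integral linear form takes
arbitrary values subject to the relation of the diagonals, and this is the sufficiency of
`a A + a C = a B + a D` (`Toric.Fan.IsQuadrangle.isPrincipalAt_iff`).

At a regular point one can choose a regular system of parameters consisting of characters. Its
elements satisfy no monomial relation (`Toric.eq_of_monomial_relation`), so that the exponents of a
character in it are well defined integral linear forms. These are the rays of the cone; they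
generate it and are part of a basis of the lattice (`Toric.Fan.exists_dual_basis_of_regular`). On such a cone
the values of a linear form on the rays can be prescribed, so that every torus-invariant divisor on a
small resolution is Cartier.

For the exact sequence, `a A - a B + a C - a D` vanishes on the divisors of rational functions, whose
orders satisfy all relations of the rays, and therefore is defined on classes
(`Toric.Fan.exists_quadrangleHom`). The pullback is injective because the rational functions, the
torus and the rays are the same on both sides (`Toric.Fan.pullback_toricMap_injective`). By the local
condition, a torus-invariant divisor is in the kernel of `φ` if and only if it is given by a linear
form on each cone of the nodal threefold, and then it is a pullback
(`Toric.Fan.exact_pullback_toricMap`). -/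

open AlgebraicGeometry CategoryTheory CategoryTheory.Limits

namespace Toric

/-! ### Affine charts and rational functions -/

section Stalks

variable {X : Scheme.{0}} {A : CommRingCat.{0}}

instance (p : Spec A) : (p.asIdeal : Ideal A).IsPrime := PrimeSpectrum.isPrime (R := A) p

/-- The stalk of an open affine chart of a scheme receives the coordinate ring of the chart. -/
noncomputable def chartToStalk (j : Spec A ⟶ X) [IsOpenImmersion j]
    (p : Spec A) : A →+* X.presheaf.stalk (j p) :=
  (inv (j.stalkMap p)).hom.comp (StructureSheaf.toStalk A p).hom

theorem stalkMap_chartToStalk (j : Spec A ⟶ X) [IsOpenImmersion j]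
    (p : Spec A) (a : A) :
    (j.stalkMap p).hom (chartToStalk j p a) = (StructureSheaf.toStalk A p).hom a := by
  change (inv (j.stalkMap p) ≫ j.stalkMap p).hom _ = _
  rw [IsIso.inv_hom_id]
  rfl

theorem isLocalization_chartToStalk (j : Spec A ⟶ X) [IsOpenImmersion j]
    (p : Spec A) :
    let _ := (chartToStalk j p).toAlgebra
    IsLocalization.AtPrime (X.presheaf.stalk (j p)) p.asIdeal := by
  let _ := (chartToStalk j p).toAlgebra
  let _ : Algebra A ((Spec A).presheaf.stalk p) :=
    StructureSheaf.stalkAlgebra A p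
  have h1 : IsLocalization.AtPrime ((Spec A).presheaf.stalk p) p.asIdeal :=
    StructureSheaf.IsLocalization.to_stalk A p
  let e := (asIso (j.stalkMap p)).commRingCatIsoToRingEquiv.symm
  have := IsLocalization.isLocalization_of_algEquiv (M := p.asIdeal.primeCompl)
    (S := (Spec A).presheaf.stalk p) (P := X.presheaf.stalk (j p))
    { e with commutes' := fun a => rfl }
  exact this

end Stalks

section Charts

variable {X Y Z : Scheme.{0}} [IsIntegral X] [IsIntegral Y] [IsIntegral Z]

theorem pullbackFunction_comp (f : Z ⟶ Y) (g : Y ⟶ X) [IsDominant f] [IsDominant g]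
    (a : X.functionField) :
    pullbackFunction (f ≫ g) a = pullbackFunction f (pullbackFunction g a) := by
  let z := genericPoint Z
  have h : pullbackFunction (f ≫ g) = (pullbackFunction f).comp (pullbackFunction g) := by
    refine IsLocalization.ringHom_ext (R := X.presheaf.stalk (g (f z)))
      (nonZeroDivisors (X.presheaf.stalk (g (f z)))) (RingHom.ext fun a => ?_)
    have h1 := pullbackFunction_algebraMap (f ≫ g) z a
    have h2 := pullbackFunction_algebraMap g (f z) a
    have h3 := pullbackFunction_algebraMap f z ((g.stalkMap (f z)).hom a)
    rw [RingHom.comp_apply, RingHom.comp_apply, RingHom.comp_apply, h2, h3]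
    refine h1.trans ?_
    rw [Scheme.Hom.stalkMap_comp]
    rfl
  rw [h]
  rfl

theorem pullbackFunction_congr {f g : Y ⟶ X} [IsDominant f] [IsDominant g] (h : f = g)
    (a : X.functionField) : pullbackFunction f a = pullbackFunction g a := by
  subst h
  rfl

theorem isDominant_of_isOpenImmersion (j : Y ⟶ X) [IsOpenImmersion j] : IsDominant j := by
  refine ⟨fun x => ?_⟩
  have h : j (genericPoint Y) = genericPoint X := genericPoint_eq_of_isOpenImmersion j
  exact closure_mono (Set.singleton_subset_iff.2 (Set.mem_range.2 ⟨_, h⟩))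
    ((genericPoint_spec X).specializes trivial).mem_closure

theorem isDominant_specMap {A B : CommRingCat.{0}} [IsDomain A] [IsDomain B]
    (φ : A ⟶ B) (hφ : Function.Injective φ.hom) : IsDominant (Spec.map φ) := by
  refine ⟨?_⟩
  change DenseRange (PrimeSpectrum.comap φ.hom)
  rw [PrimeSpectrum.denseRange_comap_iff_ker_le_nilRadical, (RingHom.injective_iff_ker_eq_bot φ.hom).1 hφ]
  exact bot_le

variable {A B : CommRingCat.{0}} [IsDomain A] [IsDomain B]

variable (A) in
/-- The elements of a domain, as rational functions on its spectrum. -/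
noncomputable def specFunction : A →+* (Spec A).functionField :=
  (StructureSheaf.toStalk A (genericPoint (Spec A))).hom

variable (A) in
theorem specFunction_injective : Function.Injective (specFunction A) := by
  exact IsFractionRing.injective A (Spec A).functionField

theorem algebraMap_toStalk (p : Spec A) (a : A) :
    algebraMap ((Spec A).presheaf.stalk p)
      (Spec A).functionField ((StructureSheaf.toStalk A p).hom a) =
      specFunction A a :=
  DFunLike.congr_fun (congrArg CommRingCat.Hom.hom
    (StructureSheaf.toStalk_stalkSpecializes (R := A) _)) a

/-- The regular functions on an open affine chart, as rational functions. -/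
noncomputable def chartFunction (j : Spec A ⟶ X) [IsOpenImmersion j] :
    A →+* X.functionField :=
  (algebraMap _ _).comp (chartToStalk j (genericPoint (Spec A)))

theorem pullbackFunction_algebraMap_chartToStalk (j : Spec A ⟶ X)
    [IsOpenImmersion j] [IsDominant j] (p : Spec A) (a : A) :
    pullbackFunction j (algebraMap _ _ (chartToStalk j p a)) =
      specFunction A a := by
  rw [pullbackFunction_algebraMap, stalkMap_chartToStalk, algebraMap_toStalk]

theorem pullbackFunction_chartFunction (j : Spec A ⟶ X) [IsOpenImmersion j]
    [IsDominant j] (a : A) : pullbackFunction j (chartFunction j a) =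
      specFunction A a :=
  pullbackFunction_algebraMap_chartToStalk j _ a

theorem algebraMap_chartToStalk (j : Spec A ⟶ X) [IsOpenImmersion j]
    (p : Spec A) (a : A) :
    algebraMap (X.presheaf.stalk (j p)) X.functionField (chartToStalk j p a) =
      chartFunction j a := by
  have := isDominant_of_isOpenImmersion j
  apply (pullbackFunction j).injective
  rw [pullbackFunction_algebraMap_chartToStalk, pullbackFunction_chartFunction]

theorem chartFunction_injective (j : Spec A ⟶ X) [IsOpenImmersion j] :
    Function.Injective (chartFunction j) := by
  have := isDominant_of_isOpenImmersion j
  intro a b h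
  apply specFunction_injective A
  have h2 := congrArg (pullbackFunction j) h
  rw [pullbackFunction_chartFunction, pullbackFunction_chartFunction] at h2
  exact h2

/-- The rational functions that are regular at a point of a chart are the fractions of regular
functions whose denominator does not vanish there. -/
theorem mem_range_stalk_iff (j : Spec A ⟶ X) [IsOpenImmersion j]
    (p : Spec A) (f : X.functionField) :
    f ∈ (algebraMap (X.presheaf.stalk (j p)) X.functionField).range ↔
      ∃ a b : A, b ∉ p.asIdeal ∧ f * chartFunction j b = chartFunction j a := by
  let _ := (chartToStalk j p).toAlgebra
  have hl : IsLocalization.AtPrime (X.presheaf.stalk (j p)) p.asIdeal :=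
    isLocalization_chartToStalk j p
  constructor
  · rintro ⟨r, rfl⟩
    obtain ⟨⟨a, b⟩, h⟩ := IsLocalization.surj p.asIdeal.primeCompl r
    refine ⟨a, b, b.2, ?_⟩
    rw [← algebraMap_chartToStalk j p, ← algebraMap_chartToStalk j p, ← map_mul]
    exact congrArg _ h
  · rintro ⟨a, b, hb, h⟩
    refine ⟨IsLocalization.mk' _ a (⟨b, hb⟩ : p.asIdeal.primeCompl), ?_⟩
    have hb0 : chartFunction j b ≠ 0 := by
      rw [Ne, map_eq_zero_iff _ (chartFunction_injective j)]
      rintro rfl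
      exact hb p.asIdeal.zero_mem
    apply mul_right_cancel₀ hb0
    rw [h, ← algebraMap_chartToStalk j p, ← algebraMap_chartToStalk j p, ← map_mul]
    exact congrArg _ (IsLocalization.mk'_spec _ a (⟨b, hb⟩ : p.asIdeal.primeCompl))

theorem mem_stalkUnits_iff_range (x : X) (f : (X.functionField)ˣ) : f ∈ stalkUnits X x ↔
    (f : X.functionField) ∈ (algebraMap (X.presheaf.stalk x) X.functionField).range ∧
    ((f⁻¹ : (X.functionField)ˣ) : X.functionField) ∈
      (algebraMap (X.presheaf.stalk x) X.functionField).range := by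
  constructor
  · rintro ⟨u, rfl⟩
    exact ⟨⟨u, rfl⟩, ⟨(u⁻¹ : (X.presheaf.stalk x)ˣ), by rw [← map_inv]; rfl⟩⟩
  · rintro ⟨⟨a, ha⟩, ⟨b, hb⟩⟩
    have inj := IsFractionRing.injective (X.presheaf.stalk x) X.functionField
    have hab : a * b = 1 := inj (by rw [map_mul, ha, hb, map_one, Units.mul_inv])
    exact ⟨Units.mk a b hab (by rw [mul_comm, hab]), Units.ext ha⟩

theorem mem_stalkUnits_iff (j : Spec A ⟶ X) [IsOpenImmersion j]
    (p : Spec A) (f : (X.functionField)ˣ) : f ∈ stalkUnits X (j p) ↔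
      ∃ a b : A, a ∉ p.asIdeal ∧ b ∉ p.asIdeal ∧
        (f : X.functionField) * chartFunction j b = chartFunction j a := by
  have inj := chartFunction_injective j
  rw [mem_stalkUnits_iff_range, mem_range_stalk_iff, mem_range_stalk_iff]
  constructor
  · rintro ⟨⟨a, b, hb, h⟩, ⟨c, d, hd, h'⟩⟩
    refine ⟨a, b, fun ha => ?_, hb, h⟩
    have : a * c = b * d := by
      apply inj
      rw [map_mul, map_mul, ← h, ← h']
      calc (f : X.functionField) * chartFunction j b * (((f⁻¹ : (X.functionField)ˣ) :
            X.functionField) * chartFunction j d)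
          = ((f : X.functionField) * ((f⁻¹ : (X.functionField)ˣ) : X.functionField)) *
            (chartFunction j b * chartFunction j d) := by ring
        _ = _ := by rw [Units.mul_inv, one_mul]
    have h3 : b * d ∈ p.asIdeal := this ▸ p.asIdeal.mul_mem_right _ ha
    exact (p.2.mem_or_mem h3).elim hb hd
  · rintro ⟨a, b, ha, hb, h⟩
    refine ⟨⟨a, b, hb, h⟩, ⟨b, a, ha, ?_⟩⟩
    rw [← h, ← mul_assoc, Units.inv_mul, one_mul]

/-- The pullback of rational functions along a morphism which is given on charts by an injective
homomorphism `φ` is `φ` itself on the regular functions of the chart. -/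
theorem pullbackFunction_chartFunction_of_comm
    (j : Spec A ⟶ X) [IsOpenImmersion j]
    (i : Spec B ⟶ Y) [IsOpenImmersion i] (π : Y ⟶ X) [IsDominant π]
    (φ : A ⟶ B) (hφ : Function.Injective φ.hom)
    (h : i ≫ π = Spec.map φ ≫ j) (a : A) :
    pullbackFunction π (chartFunction j a) = chartFunction i (φ.hom a) := by
  have := isDominant_of_isOpenImmersion j
  have := isDominant_of_isOpenImmersion i
  have := isDominant_specMap φ hφ
  apply (pullbackFunction i).injective
  rw [pullbackFunction_chartFunction, ← pullbackFunction_comp, pullbackFunction_congr h,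
    pullbackFunction_comp, pullbackFunction_chartFunction]
  let p : Spec B := genericPoint _
  have h1 := pullbackFunction_algebraMap (Spec.map φ) p
    ((StructureSheaf.toStalk A (PrimeSpectrum.comap φ.hom p)).hom a)
  have h2 : ((Spec.map φ).stalkMap p).hom
      ((StructureSheaf.toStalk A (PrimeSpectrum.comap φ.hom p)).hom a) =
      (StructureSheaf.toStalk B p).hom (φ.hom a) :=
    DFunLike.congr_fun (congrArg CommRingCat.Hom.hom
      (AlgebraicGeometry.stalkMap_toStalk φ p)) a
  rw [h2, algebraMap_toStalk] at h1
  rw [← h1]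
  congr 1
  exact (algebraMap_toStalk (A := A) _ a).symm

end Charts
/-! ### Laurent polynomials as rational functions on a toric variety -/

section Laurent

variable {n : ℕ}

/-- The coordinate ring `ℂ[M]` of the torus. -/
abbrev Laurent (n : ℕ) : Type := AddMonoidAlgebra ℂ (Fin n → ℤ)

/-- The inclusion `ℂ[σ^∨ ∩ M] ⊆ ℂ[M]`. -/
noncomputable def toLaurent (σ : PointedCone ℝ (Fin n → ℝ)) : coordRing σ →+* Laurent n :=
  AddMonoidAlgebra.mapDomainRingHom ℂ (dualMonoid σ).subtype

theorem toLaurent_injective (σ : PointedCone ℝ (Fin n → ℝ)) :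
    Function.Injective (toLaurent σ) :=
  AddMonoidAlgebra.mapDomain_injective Subtype.val_injective

theorem toLaurent_single (σ : PointedCone ℝ (Fin n → ℝ)) (m : dualMonoid σ) (c : ℂ) :
    toLaurent σ (AddMonoidAlgebra.single m c) = AddMonoidAlgebra.single m.1 c := by
  simp [toLaurent]

theorem coeff_toLaurent (σ : PointedCone ℝ (Fin n → ℝ)) (a : coordRing σ) (m : dualMonoid σ) :
    (toLaurent σ a).coeff m.1 = a.coeff m := by
  simp only [toLaurent, AddMonoidAlgebra.mapDomainRingHom_apply,
    AddMonoidAlgebra.coeff_mapDomain]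
  exact Finsupp.mapDomain_apply Subtype.val_injective _ m

theorem mem_support_toLaurent {σ : PointedCone ℝ (Fin n → ℝ)} {a : coordRing σ}
    {m : Fin n → ℤ} (h : m ∈ (toLaurent σ a).coeff.support) :
    ∃ hm : m ∈ dualMonoid σ, (⟨m, hm⟩ : dualMonoid σ) ∈ a.coeff.support := by
  classical
  have h1 : m ∈ (Finsupp.mapDomain (dualMonoid σ).subtype a.coeff).support := h
  obtain ⟨s, hs, rfl⟩ := Finset.mem_image.1 (Finsupp.mapDomain_support h1)
  exact ⟨s.2, hs⟩

/-- The coordinate ring of a chart consists of the Laurent polynomials whose exponents are in the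
dual semigroup. -/
theorem mem_range_toLaurent_iff {σ : PointedCone ℝ (Fin n → ℝ)} {h : Laurent n} :
    h ∈ (toLaurent σ).range ↔ ∀ m ∈ h.coeff.support, m ∈ dualMonoid σ := by
  constructor
  · rintro ⟨a, rfl⟩ m hm
    exact (mem_support_toLaurent hm).1
  · intro hm
    rw [← h.sum_coeff_single]
    refine Subring.sum_mem _ fun m hs => ⟨AddMonoidAlgebra.single ⟨m, hm m hs⟩ (h.coeff m), ?_⟩
    rw [toLaurent_single]

theorem toLaurent_coordMap {τ σ : PointedCone ℝ (Fin n → ℝ)} (h : τ ≤ σ) (a : coordRing σ) :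
    toLaurent τ (coordMap h a) = toLaurent σ a := by
  have : (toLaurent τ).comp (coordMap h) = toLaurent σ := by
    refine AddMonoidAlgebra.ringHom_ext ?_ ?_ <;> intro _ <;>
      rw [RingHom.comp_apply, coordMap_single, toLaurent_single, toLaurent_single] <;> rfl
  exact DFunLike.congr_fun this a

theorem coordMap_injective {τ σ : PointedCone ℝ (Fin n → ℝ)} (h : τ ≤ σ) :
    Function.Injective (coordMap h) :=
  AddMonoidAlgebra.mapDomain_injective (AddSubmonoid.inclusion_injective (dualMonoid_anti h))

theorem toLaurent_bot_surjective : Function.Surjective (toLaurent (⊥ : PointedCone ℝ (Fin n → ℝ))) := by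
  intro h
  refine mem_range_toLaurent_iff.2 fun m _ x hx => ?_
  rw [(Submodule.mem_bot _).1 hx, dotProduct_zero]

/-- The coordinate ring of the chart of the zero cone is the ring of Laurent polynomials. -/
noncomputable def laurentEquiv (n : ℕ) : coordRing (⊥ : PointedCone ℝ (Fin n → ℝ)) ≃+* Laurent n :=
  RingEquiv.ofBijective (toLaurent ⊥) ⟨toLaurent_injective _, toLaurent_bot_surjective⟩

namespace Fan

variable (F : Fan n)

instance (σ : F.cones) : IsDomain (CommRingCat.of (coordRing σ.1)) :=
  inferInstanceAs (IsDomain (coordRing σ.1))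

/-- The open torus, as a cone of the fan. -/
def torusCone : F.cones := ⟨⊥, F.bot_mem⟩

/-- A Laurent polynomial, as a rational function on the toric variety. -/
noncomputable def ratFun : Laurent n →+* F.toricVariety.functionField :=
  (chartFunction (F.chart F.torusCone)).comp (laurentEquiv n).symm.toRingHom

theorem ratFun_injective : Function.Injective F.ratFun :=
  (chartFunction_injective (F.chart F.torusCone)).comp (laurentEquiv n).symm.injective

theorem ratFun_toLaurent_bot (a : coordRing (⊥ : PointedCone ℝ (Fin n → ℝ))) :
    F.ratFun (toLaurent _ a) = chartFunction (F.chart F.torusCone) a := by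
  have : (laurentEquiv n).symm (toLaurent _ a) = a := (laurentEquiv n).symm_apply_apply a
  exact congrArg (chartFunction (F.chart F.torusCone)) this

/-- The embeddings of all charts into the function field are compatible with the inclusions into the
ring of Laurent polynomials. -/
theorem chartFunction_chart (σ : F.cones) (a : coordRing σ.1) :
    chartFunction (F.chart σ) a = F.ratFun (toLaurent σ.1 a) := by
  have hle : F.torusCone ≤ σ := (bot_le : (⊥ : PointedCone ℝ (Fin n → ℝ)) ≤ σ.1)
  have := isDominant_of_isOpenImmersion (F.chart σ)
  rw [← toLaurent_coordMap (show (⊥ : PointedCone ℝ (Fin n → ℝ)) ≤ σ.1 from hle),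
    ratFun_toLaurent_bot]
  have hd : IsDominant (𝟙 F.toricVariety) := inferInstance
  have h := pullbackFunction_chartFunction_of_comm (F.chart σ) (F.chart F.torusCone)
    (𝟙 F.toricVariety) (CommRingCat.ofHom (coordMap (show F.torusCone.1 ≤ σ.1 from hle)))
    (coordMap_injective (show F.torusCone.1 ≤ σ.1 from hle)) ((Category.comp_id _).trans (F.map_comp_chart hle).symm) a
  refine Eq.trans ?_ h
  have h2 := pullbackFunction_comp (𝟙 F.toricVariety) (𝟙 F.toricVariety)
    (chartFunction (F.chart σ) a)
  rw [pullbackFunction_congr (Category.comp_id (𝟙 F.toricVariety))] at h2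
  exact (pullbackFunction (𝟙 F.toricVariety)).injective h2

theorem mem_range_stalk_chart_iff (σ : F.cones) (p : PrimeSpectrum (coordRing σ.1))
    (f : F.toricVariety.functionField) :
    f ∈ (algebraMap (F.toricVariety.presheaf.stalk (F.chart σ p))
        F.toricVariety.functionField).range ↔
      ∃ a b : coordRing σ.1, b ∉ p.asIdeal ∧
        f * F.ratFun (toLaurent σ.1 b) = F.ratFun (toLaurent σ.1 a) := by
  refine (mem_range_stalk_iff (F.chart σ) p f).trans (exists_congr fun a => exists_congr fun b =>
    and_congr_right fun _ => ?_)
  rw [← chartFunction_chart, ← chartFunction_chart]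

theorem mem_stalkUnits_chart_iff (σ : F.cones) (p : PrimeSpectrum (coordRing σ.1))
    (f : (F.toricVariety.functionField)ˣ) : f ∈ stalkUnits F.toricVariety (F.chart σ p) ↔
      ∃ a b : coordRing σ.1, a ∉ p.asIdeal ∧ b ∉ p.asIdeal ∧
        (f : F.toricVariety.functionField) * F.ratFun (toLaurent σ.1 b) =
          F.ratFun (toLaurent σ.1 a) := by
  refine (mem_stalkUnits_iff (F.chart σ) p f).trans (exists_congr fun a => exists_congr fun b =>
    and_congr_right fun _ => and_congr_right fun _ => ?_)
  rw [← chartFunction_chart, ← chartFunction_chart]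

/-- Every rational function is a quotient of Laurent polynomials. -/
theorem exists_ratFun (f : F.toricVariety.functionField) :
    ∃ a b : Laurent n, b ≠ 0 ∧ f * F.ratFun b = F.ratFun a := by
  let p : PrimeSpectrum (coordRing F.torusCone.1) := ⊥
  obtain ⟨r, s, hs, rfl⟩ := IsFractionRing.div_surjective
    (A := F.toricVariety.presheaf.stalk (F.chart F.torusCone p)) f
  obtain ⟨a, b, hb, h⟩ := (F.mem_range_stalk_chart_iff F.torusCone p _).1 ⟨r, rfl⟩
  obtain ⟨c, d, hd, h'⟩ := (F.mem_range_stalk_chart_iff F.torusCone p _).1 ⟨s, rfl⟩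
  have hs0 : algebraMap _ F.toricVariety.functionField s ≠ 0 :=
    IsFractionRing.to_map_ne_zero_of_mem_nonZeroDivisors hs
  have hne : ∀ x : coordRing F.torusCone.1, x ∉ p.asIdeal → toLaurent F.torusCone.1 x ≠ 0 :=
    fun x hx h0 => hx ((map_eq_zero_iff _ (toLaurent_injective _)).1 h0)
  have hc : toLaurent F.torusCone.1 c ≠ 0 := fun h0 => by
    rw [h0, map_zero] at h'
    exact mul_ne_zero hs0 ((map_ne_zero_iff _ F.ratFun_injective).2 (hne d hd)) h'
  refine ⟨toLaurent _ a * toLaurent _ d, toLaurent _ b * toLaurent _ c,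
    mul_ne_zero (hne b hb) hc, ?_⟩
  rw [map_mul, map_mul, ← h, ← h']
  field_simp

theorem pullbackFunction_toricMap {G F : Fan n} (h : Refines G F) (a : Laurent n) :
    pullbackFunction (toricMap h) (F.ratFun a) = G.ratFun a := by
  obtain ⟨b, rfl⟩ := toLaurent_bot_surjective a
  have hle : (⊥ : PointedCone ℝ (Fin n → ℝ)) ≤ ⊥ := le_rfl
  have h1 := pullbackFunction_chartFunction_of_comm (F.chart F.torusCone) (G.chart G.torusCone)
    (toricMap h) (CommRingCat.ofHom (coordMap hle)) (coordMap_injective hle)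
    (chart_toricMap h G.torusCone F.torusCone hle) b
  rw [ratFun_toLaurent_bot, ratFun_toLaurent_bot, h1]
  congr 1
  exact DFunLike.congr_fun (coordMap_refl hle) b

theorem toricMap_chart {G F : Fan n} (h : Refines G F) (τ : G.cones) (σ : F.cones)
    (hσ : τ.1 ≤ σ.1) (p : PrimeSpectrum (coordRing τ.1)) :
    toricMap h (G.chart τ p) = F.chart σ (PrimeSpectrum.comap (coordMap hσ) p) := by
  have h1 := chart_toricMap h τ σ hσ
  have h2 : (G.chart τ ≫ toricMap h) p =
      (Spec.map (CommRingCat.ofHom (coordMap hσ)) ≫ F.chart σ) p := by rw [h1]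
  exact h2

end Fan

end Laurent


/-! ### Orders of Laurent polynomials along lattice vectors -/

section Order

variable {n : ℕ}

/-- The order of the Laurent polynomial `h` along `u` is `k`: this is the least value of the linear
form `u` on the exponents of `h`. -/
def HasOrder (u : Fin n → ℤ) (h : Laurent n) (k : ℤ) : Prop :=
  (∀ m ∈ h.coeff.support, k ≤ m ⬝ᵥ u) ∧ ∃ m ∈ h.coeff.support, m ⬝ᵥ u = k

theorem HasOrder.unique {u : Fin n → ℤ} {h : Laurent n} {k l : ℤ} (hk : HasOrder u h k)
    (hl : HasOrder u h l) : k = l := by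
  obtain ⟨m, hm, rfl⟩ := hk.2
  obtain ⟨w, hw, rfl⟩ := hl.2
  exact le_antisymm (hk.1 w hw) (hl.1 m hm)

theorem exists_hasOrder (u : Fin n → ℤ) {h : Laurent n} (hh : h ≠ 0) : ∃ k, HasOrder u h k := by
  have hne : h.coeff.support.Nonempty := by
    rw [Finsupp.support_nonempty_iff]
    exact fun h0 => hh (AddMonoidAlgebra.coeff_eq_zero.1 h0)
  obtain ⟨m, hm, hmin⟩ := h.coeff.support.exists_min_image (fun m => m ⬝ᵥ u) hne
  exact ⟨m ⬝ᵥ u, hmin, m, hm, rfl⟩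

theorem HasOrder.ne_zero {u : Fin n → ℤ} {h : Laurent n} {k : ℤ} (hk : HasOrder u h k) :
    h ≠ 0 := by
  rintro rfl
  obtain ⟨m, hm, -⟩ := hk.2
  simp at hm

theorem hasOrder_single (u m : Fin n → ℤ) {c : ℂ} (hc : c ≠ 0) :
    HasOrder u (AddMonoidAlgebra.single m c) (m ⬝ᵥ u) := by
  have : (AddMonoidAlgebra.single m c : Laurent n).coeff.support = {m} := by
    classical
    ext w
    simp [hc, eq_comm]
  refine ⟨?_, m, ?_, rfl⟩ <;> rw [this] <;> simp

theorem le_dot_of_mem_support_mul {u : Fin n → ℤ} {f g : Laurent n} {k l : ℤ}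
    (hf : ∀ m ∈ f.coeff.support, k ≤ m ⬝ᵥ u) (hg : ∀ m ∈ g.coeff.support, l ≤ m ⬝ᵥ u) :
    ∀ m ∈ (f * g).coeff.support, k + l ≤ m ⬝ᵥ u := by
  classical
  intro m hm
  obtain ⟨a, ha, b, hb, rfl⟩ := Finset.mem_add.1 (AddMonoidAlgebra.support_coeff_mul_subset f g hm)
  rw [add_dotProduct]
  exact add_le_add (hf a ha) (hg b hb)

/-- The order along a lattice vector is additive, because the product of the initial forms is not
zero. -/
theorem HasOrder.mul {u : Fin n → ℤ} {f g : Laurent n} {k l : ℤ} (hf : HasOrder u f k)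
    (hg : HasOrder u g l) : HasOrder u (f * g) (k + l) := by
  classical
  have split : ∀ {f : Laurent n} {k : ℤ}, HasOrder u f k → ∃ f₀ f₁ : Laurent n, f = f₀ + f₁ ∧
      f₀ ≠ 0 ∧ (∀ m ∈ f₀.coeff.support, k ≤ m ⬝ᵥ u ∧ m ⬝ᵥ u ≤ k) ∧
      ∀ m ∈ f₁.coeff.support, k + 1 ≤ m ⬝ᵥ u := by
    intro f k hf
    refine ⟨.ofCoeff (f.coeff.filter fun m => m ⬝ᵥ u = k),
      .ofCoeff (f.coeff.filter fun m => ¬ m ⬝ᵥ u = k), ?_, ?_, ?_, ?_⟩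
    · rw [← AddMonoidAlgebra.ofCoeff_add, Finsupp.filter_add_filter_not]
    · obtain ⟨m, hm, hmk⟩ := hf.2
      intro h0
      rw [AddMonoidAlgebra.ofCoeff_eq_zero] at h0
      have := DFunLike.congr_fun h0 m
      rw [Finsupp.filter_apply_pos (fun m : Fin n → ℤ => m ⬝ᵥ u = k) _ hmk] at this
      exact Finsupp.mem_support_iff.1 hm this
    · intro m hm
      rw [AddMonoidAlgebra.coeff_ofCoeff, Finsupp.support_filter, Finset.mem_filter] at hm
      exact ⟨hm.2.ge, hm.2.le⟩
    · intro m hm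
      rw [AddMonoidAlgebra.coeff_ofCoeff, Finsupp.support_filter, Finset.mem_filter] at hm
      have := hf.1 m hm.1
      have := hm.2
      omega
  refine ⟨le_dot_of_mem_support_mul hf.1 hg.1, ?_⟩
  obtain ⟨f₀, f₁, rfl, hf0, hf1, hf2⟩ := split hf
  obtain ⟨g₀, g₁, rfl, hg0, hg1, hg2⟩ := split hg
  have hne : (f₀ * g₀).coeff ≠ 0 := fun h =>
    mul_ne_zero hf0 hg0 (AddMonoidAlgebra.coeff_eq_zero.1 h)
  obtain ⟨m, hm⟩ := Finsupp.support_nonempty_iff.2 hne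
  have hmk : m ⬝ᵥ u = k + l := by
    obtain ⟨a, ha, b, hb, rfl⟩ :=
      Finset.mem_add.1 (AddMonoidAlgebra.support_coeff_mul_subset f₀ g₀ hm)
    rw [add_dotProduct]
    have := hf1 a ha
    have := hg1 b hb
    omega
  refine ⟨m, ?_, hmk⟩
  have h1 := le_dot_of_mem_support_mul (fun m hm => (hf1 m hm).1) hg2
  have h2 := le_dot_of_mem_support_mul hf2 (fun m hm => (hg1 m hm).1)
  have h3 := le_dot_of_mem_support_mul hf2 hg2
  have z1 : (f₀ * g₁).coeff m = 0 := Finsupp.notMem_support_iff.1 fun h => by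
    have := h1 m h; omega
  have z2 : (f₁ * g₀).coeff m = 0 := Finsupp.notMem_support_iff.1 fun h => by
    have := h2 m h; omega
  have z3 : (f₁ * g₁).coeff m = 0 := Finsupp.notMem_support_iff.1 fun h => by
    have := h3 m h; omega
  have e : (f₀ + f₁) * (g₀ + g₁) = f₀ * g₀ + f₀ * g₁ + (f₁ * g₀ + f₁ * g₁) := by ring
  rw [Finsupp.mem_support_iff, e, AddMonoidAlgebra.coeff_add, AddMonoidAlgebra.coeff_add,
    AddMonoidAlgebra.coeff_add, Finsupp.add_apply, Finsupp.add_apply, Finsupp.add_apply, z1, z2, z3]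
  simpa using Finsupp.mem_support_iff.1 hm

theorem HasOrder.pow {u : Fin n → ℤ} {f : Laurent n} {k : ℤ} (hf : HasOrder u f k) (r : ℕ) :
    HasOrder u (f ^ r) (r * k) := by
  induction r with
  | zero =>
    have := hasOrder_single u (0 : Fin n → ℤ) (one_ne_zero (α := ℂ))
    rw [zero_dotProduct] at this
    simpa [AddMonoidAlgebra.one_def] using this
  | succ r ih =>
    rw [pow_succ]
    convert ih.mul hf using 1
    push_cast
    ring

/-- If `f * g` has order `0` along `A`, `C` and `A + C`, then the order of `f` along `A + C` is the
sum of the orders along `A` and `C`: the order is superadditive in the vector, both for `f` and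
for `g`. -/
theorem HasOrder.add_of_mul {A C : Fin n → ℤ} {f g : Laurent n} {a c k : ℤ}
    (h1 : HasOrder A (f * g) 0) (h2 : HasOrder C (f * g) 0) (h3 : HasOrder (A + C) (f * g) 0)
    (ha : HasOrder A f a) (hc : HasOrder C f c) (hk : HasOrder (A + C) f k) : k = a + c := by
  have hg : g ≠ 0 := fun h => h1.ne_zero (by rw [h, mul_zero])
  obtain ⟨a', ha'⟩ := exists_hasOrder A hg
  obtain ⟨c', hc'⟩ := exists_hasOrder C hg
  obtain ⟨k', hk'⟩ := exists_hasOrder (A + C) hg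
  have e1 := (ha.mul ha').unique h1
  have e2 := (hc.mul hc').unique h2
  have e3 := (hk.mul hk').unique h3
  have le1 : a + c ≤ k := by
    obtain ⟨m, hm, rfl⟩ := hk.2
    rw [dotProduct_add]
    exact add_le_add (ha.1 m hm) (hc.1 m hm)
  have le2 : a' + c' ≤ k' := by
    obtain ⟨m, hm, rfl⟩ := hk'.2
    rw [dotProduct_add]
    exact add_le_add (ha'.1 m hm) (hc'.1 m hm)
  omega

/-- If `f * g` has order `0` along the vectors of a relation `A + C = B + D` and along `A + C`,
then the orders of `f` satisfy the same relation: both sides are the order of `f` along `A + C`. -/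
theorem HasOrder.quadrangle {A B C D : Fin n → ℤ} (hABCD : A + C = B + D) {f g : Laurent n}
    {a b c d : ℤ} (h : ∀ u ∈ ({A, B, C, D, A + C} : Set (Fin n → ℤ)), HasOrder u (f * g) 0)
    (ha : HasOrder A f a) (hb : HasOrder B f b) (hc : HasOrder C f c) (hd : HasOrder D f d) :
    a + c = b + d := by
  have hf : f ≠ 0 := ha.ne_zero
  obtain ⟨k, hk⟩ := exists_hasOrder (A + C) hf
  rw [← HasOrder.add_of_mul (h A (by simp)) (h C (by simp)) (h _ (by simp)) ha hc hk]
  rw [hABCD] at hk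
  refine HasOrder.add_of_mul (h B (by simp)) (h D (by simp)) ?_ hb hd hk
  rw [← hABCD]
  exact h _ (by simp)

end Order

/-! ### Unique factorization of Laurent polynomials -/

section UFD

variable {n : ℕ}

/-- The semigroup of the positive orthant consists of the vectors with nonnegative entries. -/
theorem mem_dualMonoid_orthant {m : Fin n → ℤ} :
    m ∈ dualMonoid (coneHull ((Finset.univ.image fun i : Fin n => (Pi.single i 1 : Fin n → ℤ) :
      Finset (Fin n → ℤ)) : Set (Fin n → ℤ))) ↔ ∀ i, 0 ≤ m i := by
  rw [mem_dualMonoid_coneHull]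
  simp

/-- The ring of Laurent polynomials is a localization of the coordinate ring of the positive
orthant, which is a polynomial ring. -/
instance : UniqueFactorizationMonoid (Laurent n) := by
  let V : Finset (Fin n → ℤ) := Finset.univ.image fun i : Fin n => (Pi.single i 1 : Fin n → ℤ)
  let σ : PointedCone ℝ (Fin n → ℝ) := coneHull (V : Set (Fin n → ℤ))
  let e : (Fin n →₀ ℕ) ≃+ dualMonoid σ :=
    { toFun := fun f => ⟨fun i => (f i : ℤ), mem_dualMonoid_orthant.2 fun i => by positivity⟩
      invFun := fun m => Finsupp.equivFunOnFinite.symm fun i => (m.1 i).toNat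
      left_inv := fun f => by ext i; simp
      right_inv := fun m => by
        ext i
        have := mem_dualMonoid_orthant.1 m.2 i
        simpa using this
      map_add' := fun f g => by ext i; simp }
  have h1 : UniqueFactorizationMonoid (coordRing σ) :=
    MulEquiv.uniqueFactorizationMonoid
      (AddMonoidAlgebra.mapDomainRingEquiv ℂ e : MvPolynomial (Fin n) ℂ ≃+* coordRing σ).toMulEquiv
      inferInstance
  have hm : (fun _ => 1 : Fin n → ℤ) ∈ dualMonoid σ :=
    mem_dualMonoid_orthant.2 fun i => by simp
  have hface : ∀ x, x ∈ (⊥ : PointedCone ℝ (Fin n → ℝ)) ↔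
      x ∈ σ ∧ toReal (fun _ => 1 : Fin n → ℤ) ⬝ᵥ x = 0 := by
    intro x
    rw [Submodule.mem_bot]
    constructor
    · rintro rfl
      exact ⟨zero_mem _, dotProduct_zero _⟩
    · rintro ⟨hx, h0⟩
      have hpos : ∀ i, 0 ≤ x i := fun i => by
        have hi : (Pi.single i 1 : Fin n → ℤ) ∈ dualMonoid σ :=
          mem_dualMonoid_orthant.2 fun j => by
            by_cases h : j = i
            · subst h; simp
            · simp [h]
        have := hi x hx
        rwa [show toReal (Pi.single i 1 : Fin n → ℤ) = Pi.single i 1 from by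
          ext j; by_cases h : j = i
          · subst h; simp [toReal]
          · simp [toReal, h], single_dotProduct, one_mul] at this
      have hs : ∑ i, x i = 0 := by simpa [toReal, dotProduct] using h0
      ext i
      exact (Finset.sum_eq_zero_iff_of_nonneg fun i _ => hpos i).1 hs i (Finset.mem_univ i)
  have hl := isLocalization_coordMap (τ := ⊥) V bot_le hm hface
  let _ := (coordMap (show (⊥ : PointedCone ℝ (Fin n → ℝ)) ≤ σ from bot_le)).toAlgebra
  have h2 : UniqueFactorizationMonoid (coordRing (⊥ : PointedCone ℝ (Fin n → ℝ))) :=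
    have := hl
    UniqueFactorizationMonoid.of_isLocalization (M := coordRing σ)
      (Submonoid.powers (AddMonoidAlgebra.single (⟨_, hm⟩ : dualMonoid σ) (1 : ℂ))) _
  exact MulEquiv.uniqueFactorizationMonoid (laurentEquiv n).toMulEquiv h2

end UFD

/-! ### Orders of vanishing in affine charts -/

section OrderOfVanishing

theorem ord_eq_one_of_maximalIdeal_eq_span {R : Type*} [CommRing R] [IsLocalRing R] {t : R}
    (ht : IsLocalRing.maximalIdeal R = Ideal.span {t}) : Ring.ord R t = 1 := by
  rw [Ring.ord, Module.length_eq_one_iff, ← ht,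
    isSimpleModule_iff_isSimpleModule_of_algebraMap_surjective
      (S := R ⧸ IsLocalRing.maximalIdeal R) Ideal.Quotient.mk_surjective]
  let := Ideal.Quotient.field (IsLocalRing.maximalIdeal R)
  exact instIsSimpleModule _

variable {X : Scheme.{0}} [IsIntegral X] {A : CommRingCat.{0}} [IsDomain A]
  (j : Spec A ⟶ X) [IsOpenImmersion j] (p : Spec A)

omit [IsIntegral X] [IsDomain A] in
theorem coheight_chart : Order.coheight (j p) = (p.asIdeal : Ideal A).height :=
  (coheight_eq_of_isOpenImmersion j).trans (idealHeight_eq_coheight A p).symm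

omit [IsIntegral X] [IsDomain A] in
theorem isUnit_chartToStalk {b : A} (hb : b ∉ (p.asIdeal : Ideal A)) :
    IsUnit (chartToStalk j p b) := by
  let _ := (chartToStalk j p).toAlgebra
  have hl : IsLocalization.AtPrime (X.presheaf.stalk (j p)) p.asIdeal :=
    isLocalization_chartToStalk j p
  exact IsLocalization.map_units (M := (p.asIdeal : Ideal A).primeCompl)
    (X.presheaf.stalk (j p)) ⟨b, hb⟩

omit [IsIntegral X] in
theorem coheight_eq_one_of_principal [IsNoetherianRing A] {t : A} (ht : t ≠ 0)
    (hp : (p.asIdeal : Ideal A) = Ideal.span {t}) : Order.coheight (j p) = 1 := by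
  rw [coheight_chart]
  refine le_antisymm ?_ ?_
  · have : (p.asIdeal : Ideal A).IsPrincipal := ⟨t, hp⟩
    exact Ideal.height_le_one_of_isPrincipal_of_mem_minimalPrimes (p.asIdeal : Ideal A) p.asIdeal
      ⟨⟨inferInstance, le_rfl⟩, fun q hq _ => hq.2⟩
  · rw [Order.one_le_iff_ne_zero, Ne, Ideal.height_eq_zero_iff_eq_bot, hp,
      Ideal.span_singleton_eq_bot]
    exact ht

variable [IsLocallyNoetherian X]

theorem ordHom_of_notMem (hz : Order.coheight (j p) = 1) {b : A}
    (hb : b ∉ (p.asIdeal : Ideal A)) : X.ordHom (j p) hz (chartFunction j b) = 1 := by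
  have : Ring.KrullDimLE 1 (X.presheaf.stalk (j p)) := krullDimLE_of_coheight_le hz.le
  rw [← algebraMap_chartToStalk j p]
  exact Ring.ordFrac_of_isUnit (isUnit_chartToStalk j p hb)

theorem ordHom_of_principal (hz : Order.coheight (j p) = 1) {t : A} (ht : t ≠ 0)
    (hp : (p.asIdeal : Ideal A) = Ideal.span {t}) :
    X.ordHom (j p) hz (chartFunction j t) = WithZero.coe (Multiplicative.ofAdd 1) := by
  have : Ring.KrullDimLE 1 (X.presheaf.stalk (j p)) := krullDimLE_of_coheight_le hz.le
  let _ := (chartToStalk j p).toAlgebra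
  have hl : IsLocalization.AtPrime (X.presheaf.stalk (j p)) p.asIdeal :=
    isLocalization_chartToStalk j p
  have hm : IsLocalRing.maximalIdeal (X.presheaf.stalk (j p)) =
      Ideal.span {chartToStalk j p t} := by
    rw [← IsLocalization.AtPrime.map_eq_maximalIdeal (p.asIdeal : Ideal A)
      (X.presheaf.stalk (j p)), hp, Ideal.map_span, Set.image_singleton]
    rfl
  have h0 : chartToStalk j p t ≠ 0 := fun h => by
    have h2 := algebraMap_chartToStalk j p t
    rw [h, map_zero] at h2
    exact ht ((map_eq_zero_iff _ (chartFunction_injective j)).1 h2.symm)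
  rw [← algebraMap_chartToStalk j p]
  refine (Ring.ordFrac_eq_ord _ h0).trans ?_
  rw [Ring.ordMonoidWithZeroHom_eq_coe (n := 1) _ (mem_nonZeroDivisors_of_ne_zero h0)
    (by rw [ord_eq_one_of_maximalIdeal_eq_span hm]; rfl)]
  rfl

end OrderOfVanishing

/-! ### Primitive vectors and the rays of a fan -/

section Rays

variable {n : ℕ}

/-- The entries of a primitive vector generate the unit ideal. -/
theorem exists_dot_eq_one {u : Fin n → ℤ}
    (hu : ∀ (k : ℤ) (w : Fin n → ℤ), u = k • w → IsUnit k) : ∃ m : Fin n → ℤ, m ⬝ᵥ u = 1 := by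
  obtain ⟨g, hg⟩ : ∃ g, Ideal.span (Set.range u) = Ideal.span {g} :=
    (IsPrincipalIdealRing.principal (Ideal.span (Set.range u))).1
  have hd : ∀ i, ∃ w, u i = g * w := fun i =>
    Ideal.mem_span_singleton.1 (hg ▸ Ideal.subset_span (Set.mem_range_self i))
  choose w hw using hd
  have h1 : (1 : ℤ) ∈ Ideal.span (Set.range u) := by
    rw [hg, Ideal.span_singleton_eq_top.2 (hu g w (funext hw))]
    trivial
  obtain ⟨c, hc⟩ := Ideal.mem_span_range_iff_exists_fun.1 h1
  exact ⟨c, hc⟩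

theorem mem_coneHull_singleton {u : Fin n → ℤ} {x : Fin n → ℝ} (hx : x ∈ coneHull {u}) :
    ∃ c : ℝ, 0 ≤ c ∧ x = c • toReal u := by
  rw [coneHull, Set.image_singleton] at hx
  obtain ⟨c, rfl⟩ := Submodule.mem_span_singleton.1 hx
  exact ⟨c, c.2, rfl⟩

theorem eq_of_mem_coneHull_singleton {u w : Fin n → ℤ}
    (hu : ∀ (k : ℤ) (w : Fin n → ℤ), u = k • w → IsUnit k)
    (hw : ∀ (k : ℤ) (v : Fin n → ℤ), w = k • v → IsUnit k)
    (h : toReal w ∈ coneHull {u}) : w = u := by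
  obtain ⟨c, hc, hwu⟩ := mem_coneHull_singleton h
  obtain ⟨m, hm⟩ := exists_dot_eq_one hu
  have hk : c = ((m ⬝ᵥ w : ℤ) : ℝ) := by
    rw [← toReal_dot, hwu, dotProduct_smul, toReal_dot, hm]
    simp
  have hwk : w = (m ⬝ᵥ w) • u := by
    ext i
    have := congrFun hwu i
    rw [hk] at this
    simp only [toReal, Pi.smul_apply, smul_eq_mul] at this ⊢
    exact_mod_cast this
  have hpos : 0 ≤ m ⬝ᵥ w := by
    have : (0 : ℝ) ≤ ((m ⬝ᵥ w : ℤ) : ℝ) := hk ▸ hc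
    exact_mod_cast this
  rcases Int.isUnit_iff.1 (hw _ _ hwk) with h1 | h1
  · rwa [h1, one_smul] at hwk
  · omega

theorem toReal_mem_coneHull {V : Set (Fin n → ℤ)} {v : Fin n → ℤ} (hv : v ∈ V) :
    toReal v ∈ coneHull V := Submodule.subset_span ⟨v, hv, rfl⟩

theorem coneHull_le {V : Set (Fin n → ℤ)} {σ : PointedCone ℝ (Fin n → ℝ)}
    (h : ∀ v ∈ V, toReal v ∈ σ) : coneHull V ≤ σ := by
  refine Submodule.span_le.2 ?_
  rintro _ ⟨v, hv, rfl⟩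
  exact h v hv

theorem mem_dualMonoid_singleton {u m : Fin n → ℤ} :
    m ∈ dualMonoid (coneHull {u}) ↔ 0 ≤ m ⬝ᵥ u := by
  rw [mem_dualMonoid_coneHull]
  simp

theorem dot_nonneg_of_mem {σ : PointedCone ℝ (Fin n → ℝ)} {m u : Fin n → ℤ}
    (hm : m ∈ dualMonoid σ) (hu : toReal u ∈ σ) : 0 ≤ m ⬝ᵥ u := by
  have := hm _ hu
  rw [toReal_dot] at this
  exact_mod_cast this

/-- The exponent `m` vanishes on the cone `σ`. -/
def IsPerp (σ : PointedCone ℝ (Fin n → ℝ)) (m : Fin n → ℤ) : Prop :=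
  ∀ x ∈ σ, toReal m ⬝ᵥ x = 0

theorem isPerp_coneHull {V : Set (Fin n → ℤ)} {m : Fin n → ℤ} :
    IsPerp (coneHull V) m ↔ ∀ v ∈ V, m ⬝ᵥ v = 0 := by
  constructor
  · intro h v hv
    have := h _ (toReal_mem_coneHull hv)
    rw [toReal_dot] at this
    exact_mod_cast this
  · intro h
    have h1 : m ∈ dualMonoid (coneHull V) := mem_dualMonoid_coneHull.2 fun v hv => (h v hv).ge
    have h2 : -m ∈ dualMonoid (coneHull V) := mem_dualMonoid_coneHull.2 fun v hv => by
      rw [neg_dotProduct, h v hv, neg_zero]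
    intro x hx
    have h3 := h2 x hx
    rw [toReal_neg, neg_dotProduct] at h3
    exact le_antisymm (by linarith) (h1 x hx)

theorem coeff_orbitHom_of_isPerp (σ : PointedCone ℝ (Fin n → ℝ)) (a : coordRing σ)
    {m : dualMonoid σ} (hm : IsPerp σ m.1) : (Fan.orbitHom σ a).coeff m.1 = a.coeff m := by
  classical
  have hs : ∀ (w : dualMonoid σ) (c : ℂ), Fan.orbitHom σ (AddMonoidAlgebra.single w c) =
      if IsPerp σ w.1 then AddMonoidAlgebra.single w.1 c else 0 := by
    intro w c
    rw [Fan.orbitHom, AddMonoidAlgebra.lift_single]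
    change c • (if IsPerp σ w.1 then AddMonoidAlgebra.single w.1 (1 : ℂ) else 0) = _
    split_ifs <;> simp
  induction a using AddMonoidAlgebra.induction_linear with
  | zero => simp
  | add x y hx hy => simp [hx, hy]
  | single w c =>
    rw [hs]
    split_ifs with hw
    · by_cases h : w = m
      · subst h
        simp
      · rw [AddMonoidAlgebra.coeff_single, AddMonoidAlgebra.coeff_single,
          Finsupp.single_eq_of_ne (Ne.symm h),
          Finsupp.single_eq_of_ne fun h' => h (Subtype.ext h').symm]
    · have : w ≠ m := fun h => hw (h ▸ hm)
      simp [this]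

theorem orbitHom_single_of_not_isPerp (σ : PointedCone ℝ (Fin n → ℝ)) {w : dualMonoid σ}
    (hw : ¬ IsPerp σ w.1) (c : ℂ) : Fan.orbitHom σ (AddMonoidAlgebra.single w c) = 0 := by
  classical
  rw [Fan.orbitHom, AddMonoidAlgebra.lift_single]
  change c • (if IsPerp σ w.1 then AddMonoidAlgebra.single w.1 (1 : ℂ) else 0) = _
  rw [if_neg hw, smul_zero]

/-- The ideal of the closure of the orbit of `σ` is spanned by the characters that do not vanish on
`σ`. -/
theorem mem_ker_orbitHom_iff {σ : PointedCone ℝ (Fin n → ℝ)} {a : coordRing σ} :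
    a ∈ RingHom.ker (Fan.orbitHom σ) ↔ ∀ m ∈ a.coeff.support, ¬ IsPerp σ m.1 := by
  constructor
  · intro ha m hm hp
    rw [RingHom.mem_ker] at ha
    have := coeff_orbitHom_of_isPerp σ a hp
    rw [ha] at this
    exact Finsupp.mem_support_iff.1 hm this.symm
  · intro h
    rw [← a.sum_coeff_single]
    exact Ideal.sum_mem _ fun m hm => orbitHom_single_of_not_isPerp σ (h m hm) _

namespace Fan

variable (F : Fan n)

theorem rays_finite : F.rays.Finite := by
  refine Set.Finite.of_finite_image (f := fun u => coneHull {u})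
    (F.finite.subset (Set.image_subset_iff.2 fun u hu => hu.2)) ?_
  intro u hu w hw h
  refine eq_of_mem_coneHull_singleton hw.1 hu.1 ?_
  rw [← show coneHull {u} = coneHull {w} from h]
  exact toReal_mem_coneHull (Set.mem_singleton u)

instance : Finite F.rays := F.rays_finite

/-- The cone of a ray. -/
def rayCone (ρ : F.rays) : F.cones := ⟨coneHull {ρ.1}, ρ.2.2⟩

theorem rayCone_le {ρ : F.rays} {σ : F.cones} (h : toReal ρ.1 ∈ σ.1) : F.rayCone ρ ≤ σ :=
  coneHull_le (σ := σ.1) (by simpa using h)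

instance isNoetherianRing_coordRing_cone (σ : F.cones) :
    IsNoetherianRing (CommRingCat.of (coordRing σ.1)) := by
  obtain ⟨σ, hσ⟩ := σ
  obtain ⟨V, rfl⟩ := F.rational σ hσ
  exact isNoetherianRing_coordRing V

/-- The ideal of the orbit closure of `σ` in the chart of `σ`. -/
noncomputable def orbitPrime (σ : F.cones) : PrimeSpectrum (coordRing σ.1) :=
  ⟨RingHom.ker (orbitHom σ.1), RingHom.ker_isPrime _⟩

theorem chart_orbitPrime (σ : F.cones) : F.chart σ (F.orbitPrime σ) = F.orbitPoint σ := rfl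

theorem mem_orbitPrime_rayCone {ρ : F.rays} {a : coordRing (F.rayCone ρ).1} :
    a ∈ (F.orbitPrime (F.rayCone ρ)).asIdeal ↔ ∀ m ∈ a.coeff.support, 0 < m.1 ⬝ᵥ ρ.1 := by
  refine mem_ker_orbitHom_iff.trans (forall₂_congr fun m _ => ?_)
  have h1 : IsPerp (F.rayCone ρ).1 m.1 ↔ m.1 ⬝ᵥ ρ.1 = 0 := by
    refine isPerp_coneHull.trans ?_
    simp
  have h2 : 0 ≤ m.1 ⬝ᵥ ρ.1 := mem_dualMonoid_singleton.1 m.2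
  rw [h1]
  omega

/-- A character `m` with value `1` on the ray generates the ideal of the divisor of the ray in the
chart of the ray. -/
theorem exists_uniformizer (ρ : F.rays) : ∃ (m : Fin n → ℤ)
    (hm : m ∈ dualMonoid (F.rayCone ρ).1), m ⬝ᵥ ρ.1 = 1 ∧
    (F.orbitPrime (F.rayCone ρ)).asIdeal =
      Ideal.span {AddMonoidAlgebra.single (⟨m, hm⟩ : dualMonoid (F.rayCone ρ).1) (1 : ℂ)} := by
  obtain ⟨m, hm⟩ := exists_dot_eq_one ρ.2.1
  have hmem : m ∈ dualMonoid (F.rayCone ρ).1 := mem_dualMonoid_singleton.2 (by omega)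
  refine ⟨m, hmem, hm, le_antisymm ?_ ?_⟩
  · intro a ha
    rw [F.mem_orbitPrime_rayCone] at ha
    rw [← a.sum_coeff_single]
    refine Ideal.sum_mem _ fun w hw => Ideal.mem_span_singleton.2 ?_
    have h1 : w.1 - m ∈ dualMonoid (F.rayCone ρ).1 := mem_dualMonoid_singleton.2 (by
      rw [sub_dotProduct]
      have := ha w hw
      omega)
    refine ⟨AddMonoidAlgebra.single ⟨_, h1⟩ (a.coeff w), ?_⟩
    rw [AddMonoidAlgebra.single_mul_single, one_mul]
    congr 1
    ext i
    simp
  · rw [Ideal.span_singleton_le_iff_mem, F.mem_orbitPrime_rayCone]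
    intro w hw
    rw [AddMonoidAlgebra.coeff_single] at hw
    have := Finsupp.support_single_subset hw
    rw [Finset.mem_singleton] at this
    subst this
    show 0 < m ⬝ᵥ ρ.1
    omega

theorem coheight_orbitPoint_rayCone (ρ : F.rays) :
    Order.coheight (F.orbitPoint (F.rayCone ρ)) = 1 := by
  obtain ⟨m, hm, -, hp⟩ := F.exists_uniformizer ρ
  exact coheight_eq_one_of_principal (F.chart (F.rayCone ρ)) (F.orbitPrime (F.rayCone ρ))
    (t := AddMonoidAlgebra.single (⟨m, hm⟩ : dualMonoid (F.rayCone ρ).1) (1 : ℂ))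
    (by simp) hp

/-- In the chart of the ray `ρ` a Laurent polynomial of order `k` is the `k`-th power of the uniformizer
times a function that does not vanish identically on the divisor. -/
theorem ordHom_ratFun {ρ : F.rays} {h : Laurent n} {k : ℤ} (hk : HasOrder ρ.1 h k) :
    F.toricVariety.ordHom _ (F.coheight_orbitPoint_rayCone ρ) (F.ratFun h) =
      WithZero.coe (Multiplicative.ofAdd k) := by
  obtain ⟨m, hm, hm1, hp⟩ := F.exists_uniformizer ρ
  let χ : ℤ → Laurent n := fun r => AddMonoidAlgebra.single (r • m) 1
  have hχ : ∀ r, HasOrder ρ.1 (χ r) r := fun r => by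
    have := hasOrder_single ρ.1 (r • m) (one_ne_zero (α := ℂ))
    rwa [smul_dotProduct, hm1, smul_eq_mul, mul_one] at this
  have hmul : ∀ r s, χ r * χ s = χ (r + s) := fun r s => by
    simp only [χ, AddMonoidAlgebra.single_mul_single, add_smul, mul_one]
  have hχ0 : χ 0 = 1 := by simp [χ, AddMonoidAlgebra.one_def]
  -- the order of the characters `χ r`
  have h1 : F.toricVariety.ordHom _ (F.coheight_orbitPoint_rayCone ρ) (F.ratFun (χ 1)) =
      WithZero.coe (Multiplicative.ofAdd 1) := by
    have e := ordHom_of_principal (F.chart (F.rayCone ρ)) (F.orbitPrime (F.rayCone ρ))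
      (F.coheight_orbitPoint_rayCone ρ)
      (t := AddMonoidAlgebra.single (⟨m, hm⟩ : dualMonoid (F.rayCone ρ).1) (1 : ℂ)) (by simp) hp
    have e2 := F.chartFunction_chart (F.rayCone ρ)
      (AddMonoidAlgebra.single (⟨m, hm⟩ : dualMonoid (F.rayCone ρ).1) (1 : ℂ))
    rw [toLaurent_single] at e2
    have e3 : χ 1 = AddMonoidAlgebra.single m 1 := by simp [χ]
    rw [e3, ← e2]
    exact e
  have h2 : F.ratFun (χ k) = F.ratFun (χ 1) ^ k := by
    have hne : F.ratFun (χ 1) ≠ 0 := (map_ne_zero_iff _ F.ratFun_injective).2 (hχ 1).ne_zero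
    have nat : ∀ r : ℕ, F.ratFun (χ r) = F.ratFun (χ 1) ^ r := fun r => by
      induction r with
      | zero => simp [hχ0]
      | succ r ih => rw [pow_succ, ← ih, ← map_mul, hmul]; push_cast; rfl
    obtain ⟨r, rfl | rfl⟩ := k.eq_nat_or_neg
    · rw [nat, zpow_natCast]
    · rw [zpow_neg, zpow_natCast, ← nat]
      refine eq_inv_of_mul_eq_one_left ?_
      rw [← map_mul, hmul, neg_add_cancel, hχ0, map_one]
  -- the quotient of `h` by `χ k` is a unit at the generic point of the divisor
  have h3 := (hχ (-k)).mul hk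
  rw [neg_add_cancel] at h3
  obtain ⟨b, hb⟩ := (mem_range_toLaurent_iff (σ := (F.rayCone ρ).1)).2 fun w hw =>
    mem_dualMonoid_singleton.2 (h3.1 w hw)
  have hbp : b ∉ (F.orbitPrime (F.rayCone ρ)).asIdeal := fun hbp => by
    obtain ⟨w, hw, hw0⟩ := h3.2
    rw [← hb] at hw
    obtain ⟨hw1, hw2⟩ := mem_support_toLaurent hw
    have := F.mem_orbitPrime_rayCone.1 hbp _ hw2
    simp only at this
    omega
  have h4 := ordHom_of_notMem (F.chart (F.rayCone ρ)) (F.orbitPrime (F.rayCone ρ))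
      (F.coheight_orbitPoint_rayCone ρ) hbp
  have h5 : h = χ k * toLaurent (F.rayCone ρ).1 b := by
    rw [hb, ← mul_assoc, hmul, add_neg_cancel, hχ0, one_mul]
  have h6 : F.toricVariety.ordHom _ (F.coheight_orbitPoint_rayCone ρ)
      (F.ratFun (toLaurent (F.rayCone ρ).1 b)) = 1 := by
    rw [← F.chartFunction_chart (F.rayCone ρ) b]
    exact h4
  rw [h5, map_mul, map_mul, h6, mul_one, h2, map_zpow₀, h1, ← WithZero.coe_zpow, ← ofAdd_zsmul,
    smul_eq_mul, mul_one]

/-- The order of a rational function along the divisor of a ray `ρ` is the order of the Laurent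
polynomials in the direction of `ρ`. -/
theorem ord_orbitPoint {ρ : F.rays} {f : F.toricVariety.functionField} {a b : Laurent n} {k l : ℤ}
    (h : f * F.ratFun b = F.ratFun a) (ha : HasOrder ρ.1 a k) (hb : HasOrder ρ.1 b l) :
    F.toricVariety.ord f (F.orbitPoint (F.rayCone ρ)) = k - l := by
  have hz := F.coheight_orbitPoint_rayCone ρ
  have hb0 : F.ratFun b ≠ 0 := (map_ne_zero_iff _ F.ratFun_injective).2 hb.ne_zero
  have ha0 : F.ratFun a ≠ 0 := (map_ne_zero_iff _ F.ratFun_injective).2 ha.ne_zero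
  have hf0 : f ≠ 0 := left_ne_zero_of_mul (h ▸ ha0)
  have h1 := (Scheme.ord_eq_iff hz ha0).2 (F.ordHom_ratFun ha)
  have h2 := (Scheme.ord_eq_iff hz hb0).2 (F.ordHom_ratFun hb)
  rw [← h, Scheme.ord_mul hf0 hb0] at h1
  omega

end Fan

end Rays

/-! ### Charts with unique factorization -/

section Factorial

variable {X : Scheme.{0}}

/-- A specialization between points of codimension one is an equality. -/
theorem eq_of_specializes_of_coheight_eq_one {y z : X} (h : y ⤳ z)
    (hy : Order.coheight y = 1) (hz : Order.coheight z = 1) : y = z := by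
  have hle : z ≤ y := Scheme.le_iff_specializes.2 h
  have hle' : y ≤ z := by
    by_contra hn
    have := Order.coheight_strictAnti (lt_of_le_not_ge hle hn) (by rw [hy]; exact ENat.one_lt_top)
    rw [hy, hz] at this
    exact lt_irrefl _ this
  exact (h.antisymm (Scheme.le_iff_specializes.1 hle')).eq

variable [IsIntegral X]

theorem cartierGerm_eq_iff {x : X} {f g : (X.functionField)ˣ} :
    cartierGerm X x f = cartierGerm X x g ↔ f⁻¹ * g ∈ stalkUnits X x :=
  QuotientGroup.eq

theorem cartierGerm_eq_one_iff {x : X} {f : (X.functionField)ˣ} :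
    cartierGerm X x f = 1 ↔ f ∈ stalkUnits X x :=
  QuotientGroup.eq_one_iff f

theorem cartierGerm_surjective (x : X) : Function.Surjective (cartierGerm X x) :=
  QuotientGroup.mk'_surjective _

omit [IsIntegral X] in
theorem specializes_chart {A : CommRingCat.{0}} (j : Spec A ⟶ X) {p q : Spec A}
    (h : (p.asIdeal : Ideal A) ≤ q.asIdeal) : j p ⤳ j q :=
  ((PrimeSpectrum.le_iff_specializes (R := A) p q).1 h).map j.continuous

variable [IsLocallyNoetherian X]

theorem ord_one (z : X) : X.ord (1 : X.functionField) z = 0 := by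
  have h := Scheme.ord_mul (x := z) (one_ne_zero (α := X.functionField))
    (one_ne_zero (α := X.functionField))
  rw [one_mul] at h
  omega

theorem ord_units_inv (f : (X.functionField)ˣ) (z : X) :
    X.ord ((f⁻¹ : (X.functionField)ˣ) : X.functionField) z = -X.ord (f : X.functionField) z := by
  have h := Scheme.ord_mul (x := z) f.ne_zero (f⁻¹).ne_zero
  rw [Units.mul_inv, ord_one] at h
  omega

theorem ord_units_mul (f g : (X.functionField)ˣ) (z : X) :
    X.ord ((f * g : (X.functionField)ˣ) : X.functionField) z =
      X.ord (f : X.functionField) z + X.ord (g : X.functionField) z :=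
  Scheme.ord_mul f.ne_zero g.ne_zero

theorem ord_eq_zero_of_mem_stalkUnits {z : X} {f : (X.functionField)ˣ}
    (hf : f ∈ stalkUnits X z) : X.ord (f : X.functionField) z = 0 := by
  by_cases hz : Order.coheight z = 1
  · obtain ⟨u, rfl⟩ := hf
    have : Ring.KrullDimLE 1 (X.presheaf.stalk z) := krullDimLE_of_coheight_le hz.le
    exact (Scheme.ord_eq_iff hz (Units.ne_zero _)).2 (Ring.ordFrac_of_isUnit u.isUnit)
  · exact Scheme.ord_eq_zero_of_coheight_neq_one hz _

theorem ord_eq_of_cartierGerm_eq {z : X} {f g : (X.functionField)ˣ}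
    (h : cartierGerm X z f = cartierGerm X z g) :
    X.ord (f : X.functionField) z = X.ord (g : X.functionField) z := by
  have h2 := ord_eq_zero_of_mem_stalkUnits (cartierGerm_eq_iff.1 h)
  rw [ord_units_mul, ord_units_inv] at h2
  omega

/-- The Weil divisor of a Cartier divisor can be computed with any choice of local equations. -/
theorem hasWeilDivisor_iff_of_eq {s : CartierDivisor X} {W : X →₀ ℤ} :
    HasWeilDivisor s W ↔ ∀ z : X, Order.coheight z = 1 → ∃ f : (X.functionField)ˣ,
      s.1 z = cartierGerm X z f ∧ X.ord (f : X.functionField) z = W z := by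
  refine forall₂_congr fun z _ => ⟨fun h => ?_, ?_⟩
  · obtain ⟨f, hf⟩ := cartierGerm_surjective z (s.1 z)
    exact ⟨f, hf.symm, h f hf.symm⟩
  · rintro ⟨f, hf, h⟩ g hg
    rw [← h]
    exact ord_eq_of_cartierGerm_eq (hg.symm.trans hf)

theorem HasWeilDivisor.div {s t : CartierDivisor X} {W W' : X →₀ ℤ} (hs : HasWeilDivisor s W)
    (ht : HasWeilDivisor t W') : HasWeilDivisor (s / t) (W - W') := by
  rw [hasWeilDivisor_iff_of_eq] at hs ht ⊢
  intro z hz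
  obtain ⟨f, hf, hf'⟩ := hs z hz
  obtain ⟨g, hg, hg'⟩ := ht z hz
  refine ⟨f / g, ?_, ?_⟩
  · rw [map_div, ← hf, ← hg]
    rfl
  · rw [div_eq_mul_inv, ord_units_mul, ord_units_inv, hf', hg', Finsupp.sub_apply, sub_eq_add_neg]

variable {A : CommRingCat.{0}} [IsDomain A] (j : Spec A ⟶ X) [IsOpenImmersion j]

theorem ord_chartFunction_of_notMem {p : Spec A} {b : A} (hb : b ∉ (p.asIdeal : Ideal A)) :
    X.ord (chartFunction j b) (j p) = 0 := by
  by_cases hz : Order.coheight (j p) = 1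
  · have hb0 : b ≠ 0 := by
      rintro rfl
      exact hb (zero_mem _)
    exact (Scheme.ord_eq_iff hz ((map_ne_zero_iff _ (chartFunction_injective j)).2 hb0)).2
      (ordHom_of_notMem j p hz hb)
  · exact Scheme.ord_eq_zero_of_coheight_neq_one hz _

/-- The prime ideal generated by a prime element, as a point of the spectrum. -/
def primePoint {q : A} (hq : Prime q) : Spec A :=
  (⟨Ideal.span {q}, (Ideal.span_singleton_prime hq.ne_zero).2 hq⟩ : PrimeSpectrum A)

omit [IsDomain A] in
theorem mem_primePoint {q : A} (hq : Prime q) {a : A} :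
    a ∈ ((primePoint hq).asIdeal : Ideal A) ↔ q ∣ a := Ideal.mem_span_singleton

theorem ord_chartFunction_primePoint [IsNoetherianRing A] {q : A} (hq : Prime q) :
    X.ord (chartFunction j q) (j (primePoint hq)) = 1 :=
  have hz : Order.coheight (j (primePoint hq)) = 1 :=
    coheight_eq_one_of_principal j _ hq.ne_zero rfl
  (Scheme.ord_eq_iff hz ((map_ne_zero_iff _ (chartFunction_injective j)).2 hq.ne_zero)).2
    (ordHom_of_principal j _ hz hq.ne_zero rfl)

theorem ord_pow {f : X.functionField} (hf : f ≠ 0) (z : X) (k : ℕ) :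
    X.ord (f ^ k) z = k * X.ord f z := by
  induction k with
  | zero => simp [ord_one]
  | succ k ih =>
    rw [pow_succ, Scheme.ord_mul (pow_ne_zero k hf) hf, ih]
    push_cast
    ring

/-- A fraction in lowest terms has a positive order at the prime factors of its numerator. -/
theorem not_dvd_of_ord_eq_zero [IsNoetherianRing A] {q a b : A} (hq : Prime q)
    (ha : a ≠ 0) (hb : ¬ q ∣ b) {f : X.functionField}
    (h : f * chartFunction j b = chartFunction j a)
    (h0 : X.ord f (j (primePoint hq)) = 0) : ¬ q ∣ a := by
  intro hqa
  have inj := chartFunction_injective j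
  obtain ⟨c, hc, hqc⟩ :=
    (FiniteMultiplicity.of_not_isUnit hq.not_isUnit ha).exists_eq_pow_mul_and_not_dvd
  have hne : ∀ x : A, x ≠ 0 → chartFunction j x ≠ 0 := fun x hx => (map_ne_zero_iff _ inj).2 hx
  have hb0 : b ≠ 0 := fun h => hb (h ▸ dvd_zero q)
  have hc0 : c ≠ 0 := fun h => hqc (h ▸ dvd_zero q)
  have hf : f ≠ 0 := by
    rintro rfl
    rw [zero_mul] at h
    exact hne a ha h.symm
  have h1 := congrArg (fun g => X.ord g (j (primePoint hq))) h
  simp only at h1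
  rw [Scheme.ord_mul hf (hne b hb0), h0,
    ord_chartFunction_of_notMem j (fun h => hb ((mem_primePoint hq).1 h)), hc, map_mul, map_pow,
    Scheme.ord_mul (pow_ne_zero _ (hne q hq.ne_zero)) (hne c hc0), ord_pow (hne q hq.ne_zero),
    ord_chartFunction_primePoint,
    ord_chartFunction_of_notMem j (fun h => hqc ((mem_primePoint hq).1 h))] at h1
  have h2 : multiplicity q a ≠ 0 := multiplicity_ne_zero.2 hqa
  omega

omit [IsDomain A] in
theorem exists_prime_dvd_mem [IsNoetherianRing A] [UniqueFactorizationMonoid A] (p : Spec A)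
    (a : A) (ha : a ≠ 0) (hap : a ∈ (p.asIdeal : Ideal A)) :
    ∃ q : A, Prime q ∧ q ∣ a ∧ q ∈ (p.asIdeal : Ideal A) := by
  induction a using UniqueFactorizationMonoid.induction_on_prime with
  | h₁ => exact absurd rfl ha
  | h₂ u hu => exact absurd (Ideal.eq_top_of_isUnit_mem _ hap hu) (p.2.ne_top)
  | h₃ a q ha0 hq ih =>
    rcases p.2.mem_or_mem hap with h | h
    · exact ⟨q, hq, dvd_mul_right q a, h⟩
    · obtain ⟨r, hr, hra, hrp⟩ := ih ha0 h
      exact ⟨r, hr, hra.mul_left q, hrp⟩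

/-- In a factorial chart, a rational function without zeros and poles through a point is a unit
of the local ring of the point. -/
theorem mem_stalkUnits_of_ord_eq_zero [IsNoetherianRing A] [UniqueFactorizationMonoid A]
    (p : Spec A) (f : (X.functionField)ˣ)
    (h : ∀ q : Spec A, (q.asIdeal : Ideal A) ≤ p.asIdeal → Order.coheight (j q) = 1 →
      X.ord (f : X.functionField) (j q) = 0) : f ∈ stalkUnits X (j p) := by
  have inj := chartFunction_injective j
  obtain ⟨a, b, hb0, hab⟩ : ∃ a b : A, b ≠ 0 ∧
      (f : X.functionField) * chartFunction j b = chartFunction j a := by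
    let q : Spec A := (⊥ : PrimeSpectrum A)
    have hq : (f : (X.functionField)ˣ) ∈ stalkUnits X (j q) := by
      obtain ⟨r, s, hs, hrs⟩ := IsFractionRing.div_surjective
        (A := X.presheaf.stalk (j q)) (f : X.functionField)
      have hs0 : algebraMap _ X.functionField s ≠ 0 :=
        IsFractionRing.to_map_ne_zero_of_mem_nonZeroDivisors hs
      obtain ⟨a, b, hb, h⟩ := (mem_range_stalk_iff j q _).1 ⟨r, rfl⟩
      obtain ⟨c, d, hd, h'⟩ := (mem_range_stalk_iff j q _).1 ⟨s, rfl⟩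
      have key : ∀ x : A, x ∉ (q.asIdeal : Ideal A) ↔ x ≠ 0 := fun x => Iff.rfl
      have hc : c ≠ 0 := by
        rintro rfl
        rw [map_zero] at h'
        exact mul_ne_zero hs0 ((map_ne_zero_iff _ inj).2 ((key d).1 hd)) h'
      have hE : (f : X.functionField) * chartFunction j (b * c) = chartFunction j (a * d) := by
        rw [map_mul, map_mul, ← h, ← h', ← hrs]
        field_simp
      have hbc := mul_ne_zero ((key b).1 hb) hc
      refine (mem_stalkUnits_iff j q f).2 ⟨a * d, b * c, fun h0 => ?_, hbc, hE⟩
      have h0' : a * d = 0 := h0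
      rw [h0', map_zero] at hE
      exact mul_ne_zero f.ne_zero ((map_ne_zero_iff _ inj).2 hbc) hE
    obtain ⟨a, b, -, hb, h⟩ := (mem_stalkUnits_iff j q f).1 hq
    exact ⟨a, b, hb, h⟩
  have ha0 : a ≠ 0 := by
    rintro rfl
    rw [map_zero] at hab
    exact mul_ne_zero f.ne_zero ((map_ne_zero_iff _ inj).2 hb0) hab
  obtain ⟨a', b', c, hrel, rfl, rfl⟩ := UniqueFactorizationMonoid.exists_reduced_factors a ha0 b
  have hc : chartFunction j c ≠ 0 := (map_ne_zero_iff _ inj).2 (left_ne_zero_of_mul ha0)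
  have ha' := right_ne_zero_of_mul ha0
  have hb' := right_ne_zero_of_mul hb0
  have hab' : (f : X.functionField) * chartFunction j b' = chartFunction j a' := by
    rw [map_mul, map_mul] at hab
    apply mul_left_cancel₀ hc
    rw [← hab]
    ring
  have hba' : ((f⁻¹ : (X.functionField)ˣ) : X.functionField) * chartFunction j a' =
      chartFunction j b' := by
    rw [← hab', ← mul_assoc, Units.inv_mul, one_mul]
  have hle : ∀ {q : A} (hq : Prime q), q ∈ (p.asIdeal : Ideal A) →
      X.ord (f : X.functionField) (j (primePoint hq)) = 0 := fun hq hqp =>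
    h (primePoint hq) ((Ideal.span_singleton_le_iff_mem _).2 hqp)
      (coheight_eq_one_of_principal j _ hq.ne_zero rfl)
  refine (mem_stalkUnits_iff j p f).2 ⟨a', b', fun hmem => ?_, fun hmem => ?_, hab'⟩
  · obtain ⟨q, hq, hqa, hqp⟩ := exists_prime_dvd_mem p a' ha' hmem
    exact not_dvd_of_ord_eq_zero j hq ha' (fun hqb => hq.not_isUnit (hrel hqa hqb)) hab'
      (hle hq hqp) hqa
  · obtain ⟨q, hq, hqb, hqp⟩ := exists_prime_dvd_mem p b' hb' hmem
    refine not_dvd_of_ord_eq_zero j hq hb' (fun hqa => hq.not_isUnit (hrel hqa hqb)) hba' ?_ hqb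
    rw [ord_units_inv, hle hq hqp, neg_zero]

omit [IsLocallyNoetherian X] in
/-- A rational function that is regular where `b` does not vanish is a fraction whose denominator
is a power of `b`. -/
theorem exists_mul_pow_eq (b : A) (f : X.functionField)
    (h : ∀ p : Spec A, b ∉ (p.asIdeal : Ideal A) →
      f ∈ (algebraMap (X.presheaf.stalk (j p)) X.functionField).range) :
    ∃ (k : ℕ) (a : A), f * chartFunction j b ^ k = chartFunction j a := by
  let I : Ideal A :=
    { carrier := {c | ∃ a, f * chartFunction j c = chartFunction j a}
      zero_mem' := ⟨0, by simp⟩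
      add_mem' := by
        rintro c d ⟨a, ha⟩ ⟨a', ha'⟩
        exact ⟨a + a', by rw [map_add, map_add, mul_add, ha, ha']⟩
      smul_mem' := by
        rintro r c ⟨a, ha⟩
        exact ⟨r * a, by rw [smul_eq_mul, map_mul, map_mul, ← ha]; ring⟩ }
  have hb : b ∈ I.radical := by
    rw [Ideal.radical_eq_sInf, Ideal.mem_sInf]
    rintro P ⟨hIP, hP⟩
    by_contra hbP
    obtain ⟨a, c, hc, hac⟩ := (mem_range_stalk_iff j (⟨P, hP⟩ : PrimeSpectrum A) f).1 (h _ hbP)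
    exact hc (hIP ⟨a, hac⟩)
  obtain ⟨k, a, hk⟩ := hb
  exact ⟨k, a, by rw [← map_pow, hk]⟩

/-- A Cartier divisor is principal on a factorial chart. The induction removes the prime factors of
a function `b` outside whose zeros the divisor is trivial. -/
theorem exists_eq_cartierGerm_of_factorial [IsNoetherianRing A] [UniqueFactorizationMonoid A]
    (s : CartierDivisor X) :
    ∃ f : (X.functionField)ˣ, ∀ p : Spec A, s.1 (j p) = cartierGerm X (j p) f := by
  have step : ∀ b : A, b ≠ 0 → ∀ t : CartierDivisor X,
      (∀ p : Spec A, b ∉ (p.asIdeal : Ideal A) → t.1 (j p) = 1) →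
      ∃ f : (X.functionField)ˣ, ∀ p : Spec A, t.1 (j p) = cartierGerm X (j p) f := by
    intro b hb
    induction b using UniqueFactorizationMonoid.induction_on_prime with
    | h₁ => exact absurd rfl hb
    | h₂ u hu =>
      intro t ht
      refine ⟨1, fun p => ?_⟩
      rw [map_one]
      exact ht p fun h => p.2.ne_top (Ideal.eq_top_of_isUnit_mem _ h hu)
    | h₃ b q hb0 hq ih =>
      intro t ht
      let z := j (primePoint hq)
      have hz : Order.coheight z = 1 := coheight_eq_one_of_principal j _ hq.ne_zero rfl
      let u : (X.functionField)ˣ := Units.mk0 (chartFunction j q)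
        ((map_ne_zero_iff _ (chartFunction_injective j)).2 hq.ne_zero)
      have hu : X.ord (u : X.functionField) z = 1 := ord_chartFunction_primePoint j hq
      have hzpow : ∀ (k : ℤ) (y : X), X.ord ((u ^ k : (X.functionField)ˣ) : X.functionField) y =
          k * X.ord (u : X.functionField) y := by
        intro k y
        obtain ⟨r, rfl | rfl⟩ := k.eq_nat_or_neg
        · rw [zpow_natCast, Units.val_pow_eq_pow_val, ord_pow u.ne_zero]
        · rw [zpow_neg, zpow_natCast, ord_units_inv, Units.val_pow_eq_pow_val, ord_pow u.ne_zero]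
          ring
      obtain ⟨g, hg⟩ := cartierGerm_surjective z (t.1 z)
      obtain ⟨f, hf⟩ := ih hb0 (t / principal X (u ^ X.ord (g : X.functionField) z)) (by
        intro p hp
        obtain ⟨U, hU, h, hh⟩ := (t / principal X (u ^ X.ord (g : X.functionField) z)).2 (j p)
        rw [hh _ hU, cartierGerm_eq_one_iff]
        refine mem_stalkUnits_of_ord_eq_zero j p h fun r hr hr1 => ?_
        have hrU : j r ∈ U := (specializes_chart j hr).mem_open U.2 hU
        have hrh := hh _ hrU
        have hdef : (t / principal X (u ^ X.ord (g : X.functionField) z)).1 (j r) =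
          t.1 (j r) / cartierGerm X (j r) (u ^ X.ord (g : X.functionField) z) := rfl
        rw [hdef] at hrh
        by_cases hqr : q ∈ (r.asIdeal : Ideal A)
        · have hzr : z = j r := eq_of_specializes_of_coheight_eq_one
            (specializes_chart j ((Ideal.span_singleton_le_iff_mem _).2 hqr)) hz hr1
          rw [← hzr, ← hg, ← map_div] at hrh
          have h3 := ord_eq_of_cartierGerm_eq hrh
          rw [div_eq_mul_inv, ord_units_mul, ord_units_inv, hzpow, hu] at h3
          rw [← hzr]
          omega
        · have hbr : b ∉ (r.asIdeal : Ideal A) := fun h => hp (hr h)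
          rw [ht r fun h => (r.2.mem_or_mem h).elim hqr hbr, ← map_one (cartierGerm X (j r)),
            ← map_div] at hrh
          have h3 := ord_eq_of_cartierGerm_eq hrh
          have h4 : X.ord (u : X.functionField) (j r) = 0 := ord_chartFunction_of_notMem j hqr
          rw [div_eq_mul_inv, ord_units_mul, ord_units_inv, hzpow, h4, Units.val_one,
            ord_one] at h3
          omega)
      refine ⟨f * u ^ X.ord (g : X.functionField) z, fun p => ?_⟩
      rw [map_mul, ← hf p]
      exact (div_mul_cancel _ _).symm
  -- near the generic point the divisor is given by one function
  let q : Spec A := (⊥ : PrimeSpectrum A)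
  obtain ⟨U, hU, f, hf⟩ := s.2 (j q)
  obtain ⟨_, ⟨b, rfl⟩, hb, hbU⟩ :=
    (PrimeSpectrum.isTopologicalBasis_basic_opens (R := A)).exists_subset_of_mem_open
      (show q ∈ ((j ⁻¹ᵁ U : (Spec A).Opens) : Set (Spec A)) from hU) (j ⁻¹ᵁ U).2
  have hb0 : b ≠ 0 := hb
  obtain ⟨g, hg⟩ := step b hb0 (s / principal X f) fun p hp => by
    change s.1 (j p) / cartierGerm X (j p) f = 1
    rw [hf (j p) (hbU hp), div_self']
  refine ⟨g * f, fun p => ?_⟩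
  rw [map_mul, ← hg p]
  exact (div_mul_cancel _ _).symm

end Factorial

/-! ### Torus-invariant divisors -/

section Divisor

variable {n : ℕ}

namespace Fan

variable (F : Fan n)

/-- The rays of the fan `F` that lie in the cone `σ`. -/
def raysIn (σ : F.cones) : Set (Fin n → ℤ) := {u | u ∈ F.rays ∧ toReal u ∈ σ.1}

/-- The cone `σ` is generated by the rays of the fan that it contains. -/
def RayGenerated (σ : F.cones) : Prop := σ.1 = coneHull (F.raysIn σ)

variable {F} in
theorem RayGenerated.mem_dualMonoid {σ : F.cones} (h : F.RayGenerated σ) {m : Fin n → ℤ} :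
    m ∈ dualMonoid σ.1 ↔ ∀ ρ : F.rays, toReal ρ.1 ∈ σ.1 → 0 ≤ m ⬝ᵥ ρ.1 := by
  constructor
  · intro hm ρ hρ
    exact dot_nonneg_of_mem hm hρ
  · intro hm
    rw [h, mem_dualMonoid_coneHull]
    rintro u ⟨hu, huσ⟩
    exact hm ⟨u, hu⟩ huσ

/-- The open torus. -/
def torus : Set F.toricVariety := Set.range (F.chart F.torusCone)

variable {F} in
theorem chart_comap {τ σ : F.cones} (h : τ.1 ≤ σ.1) (p : PrimeSpectrum (coordRing τ.1)) :
    F.chart σ (PrimeSpectrum.comap (coordMap h) p) = F.chart τ p := by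
  have h1 := F.map_comp_chart (τ := τ) (σ := σ) h
  have h2 : (Spec.map (CommRingCat.ofHom (coordMap h)) ≫ F.chart σ) p = F.chart τ p := by rw [h1]
  exact h2

instance : UniqueFactorizationMonoid (CommRingCat.of (coordRing F.torusCone.1)) :=
  MulEquiv.uniqueFactorizationMonoid (laurentEquiv n).symm.toMulEquiv inferInstance

/-- A point of codimension one in the chart of a cone that is generated by rays is in the torus or
is the generic point of the divisor of a ray of the cone. -/
theorem mem_torus_or_eq_orbitPoint {σ : F.cones} (hσ : F.RayGenerated σ)
    {p : PrimeSpectrum (coordRing σ.1)} (hz : Order.coheight (F.chart σ p) = 1) :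
    F.chart σ p ∈ F.torus ∨
      ∃ ρ : F.rays, toReal ρ.1 ∈ σ.1 ∧ F.chart σ p = F.orbitPoint (F.rayCone ρ) := by
  classical
  by_cases hT : F.chart σ p ∈ F.torus
  · exact Or.inl hT
  refine Or.inr ?_
  let χ : dualMonoid σ.1 → coordRing σ.1 := fun m => AddMonoidAlgebra.single m 1
  have hχ : ∀ a b, χ (a + b) = χ a * χ b := fun a b => by
    simp only [χ, AddMonoidAlgebra.single_mul_single, mul_one]
  have hbot : F.torusCone ≤ σ := (bot_le : (⊥ : PointedCone ℝ (Fin n → ℝ)) ≤ σ.1)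
  obtain ⟨m₀, hm₀, hface, -⟩ := F.exists_away hbot
  have hp₀ : χ ⟨m₀, hm₀⟩ ∈ p.asIdeal := by
    by_contra h
    have h2 := F.range_diagram_map (homOfLE hbot) hm₀ hface
    obtain ⟨q, hq⟩ : p ∈ Set.range (F.diagram.map (homOfLE hbot)) := by
      rw [h2]
      exact h
    refine hT ⟨q, ?_⟩
    rw [← hq]
    exact (chart_comap (τ := F.torusCone) bot_le q).symm
  -- the characters that are positive on some ray vanish at the point
  obtain ⟨ρ, hρσ, hρ⟩ : ∃ ρ : F.rays, toReal ρ.1 ∈ σ.1 ∧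
      ∀ s : dualMonoid σ.1, 0 < s.1 ⬝ᵥ ρ.1 → χ s ∈ p.asIdeal := by
    by_contra! hcon
    have : ∀ ρ : F.rays, ∃ s : dualMonoid σ.1,
        (toReal ρ.1 ∈ σ.1 → 0 < s.1 ⬝ᵥ ρ.1) ∧ χ s ∉ p.asIdeal := by
      intro ρ
      by_cases h : toReal ρ.1 ∈ σ.1
      · obtain ⟨s, hs, hs'⟩ := hcon ρ h
        exact ⟨s, fun _ => hs, hs'⟩
      · exact ⟨0, fun h' => absurd h' h, fun h0 => p.2.ne_top ((Ideal.eq_top_iff_one _).2 h0)⟩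
    choose s hs hsp using this
    have := Fintype.ofFinite F.rays
    let t := ∑ ρ, s ρ
    have ht : χ t ∉ p.asIdeal := by
      have hsum : ∀ S : Finset F.rays, χ (∑ ρ ∈ S, s ρ) ∉ p.asIdeal := by
        intro S
        induction S using Finset.induction_on with
        | empty => exact fun h0 => p.2.ne_top ((Ideal.eq_top_iff_one _).2 h0)
        | insert ρ S hρ ih =>
          rw [Finset.sum_insert hρ, hχ]
          exact fun h => (p.2.mem_or_mem h).elim (hsp ρ) ih
      exact hsum _
    have htpos : ∀ ρ : F.rays, toReal ρ.1 ∈ σ.1 → 0 < t.1 ⬝ᵥ ρ.1 := by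
      intro ρ hρ
      have h1 : t.1 ⬝ᵥ ρ.1 = ∑ ρ', (s ρ').1 ⬝ᵥ ρ.1 := by
        rw [← sum_dotProduct]
        congr 1
        exact map_sum (dualMonoid σ.1).subtype s Finset.univ
      rw [h1]
      exact Finset.sum_pos' (fun ρ' _ => dot_nonneg_of_mem (s ρ').2 hρ) ⟨ρ, Finset.mem_univ _, hs ρ hρ⟩
    let k : ℕ := ∑ ρ : F.rays, (m₀ ⬝ᵥ ρ.1).natAbs
    have hk : k • t.1 - m₀ ∈ dualMonoid σ.1 := hσ.mem_dualMonoid.2 fun ρ hρ => by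
      have h1 : (m₀ ⬝ᵥ ρ.1).natAbs ≤ k :=
        Finset.single_le_sum (f := fun ρ : F.rays => (m₀ ⬝ᵥ ρ.1).natAbs)
          (fun _ _ => Nat.zero_le _) (Finset.mem_univ ρ)
      have h2 := htpos ρ hρ
      rw [sub_dotProduct, smul_dotProduct, nsmul_eq_mul]
      have h3 : m₀ ⬝ᵥ ρ.1 ≤ (k : ℤ) := by omega
      nlinarith
    have hkt : χ (k • t) ∈ p.asIdeal := by
      have : k • t = ⟨m₀, hm₀⟩ + ⟨_, hk⟩ := Subtype.ext (by
        change k • t.1 = m₀ + (k • t.1 - m₀)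
        abel)
      rw [this, hχ]
      exact Ideal.mul_mem_right _ _ hp₀
    have hpow : χ (k • t) = χ t ^ k := by
      simp only [χ, AddMonoidAlgebra.single_pow, one_pow]
    rw [hpow] at hkt
    exact ht (p.2.mem_of_pow_mem k hkt)
  refine ⟨ρ, hρσ, ?_⟩
  have hle : (F.rayCone ρ).1 ≤ σ.1 := F.rayCone_le hρσ
  have hsp : F.orbitPoint (F.rayCone ρ) ⤳ F.chart σ p := by
    rw [← F.chart_orbitPrime, ← chart_comap hle]
    refine specializes_chart (F.chart σ) fun a ha => ?_
    have ha' : coordMap hle a ∈ (F.orbitPrime (F.rayCone ρ)).asIdeal := ha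
    rw [F.mem_orbitPrime_rayCone] at ha'
    change a ∈ p.asIdeal
    rw [← a.sum_coeff_single]
    refine Ideal.sum_mem _ fun m hm => ?_
    have h1 : m.1 ∈ (toLaurent _ (coordMap hle a)).coeff.support := by
      rw [toLaurent_coordMap, Finsupp.mem_support_iff, coeff_toLaurent]
      exact Finsupp.mem_support_iff.1 hm
    obtain ⟨h2, h3⟩ := mem_support_toLaurent h1
    have h4 := hρ m (ha' _ h3)
    have h5 : AddMonoidAlgebra.single m (a.coeff m) =
        AddMonoidAlgebra.single 0 (a.coeff m) * χ m := by
      simp [χ, AddMonoidAlgebra.single_mul_single]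
    rw [h5]
    exact Ideal.mul_mem_left _ _ h4
  exact (eq_of_specializes_of_coheight_eq_one hsp (F.coheight_orbitPoint_rayCone ρ) hz).symm

/-- The character of `m` as a rational function. -/
noncomputable def character (m : Fin n → ℤ) : (F.toricVariety.functionField)ˣ :=
  Units.mk0 (F.ratFun (AddMonoidAlgebra.single m 1))
    ((map_ne_zero_iff _ F.ratFun_injective).2 (by simp))

theorem val_character (m : Fin n → ℤ) : (F.character m : F.toricVariety.functionField) =
    F.ratFun (AddMonoidAlgebra.single m 1) := rfl

theorem character_add (m w : Fin n → ℤ) :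
    F.character (m + w) = F.character m * F.character w := by
  apply Units.ext
  rw [Units.val_mul, val_character, val_character, val_character, ← map_mul,
    AddMonoidAlgebra.single_mul_single, one_mul]

theorem inv_character_mul (m w : Fin n → ℤ) :
    (F.character m)⁻¹ * F.character w = F.character (w - m) := by
  rw [inv_mul_eq_iff_eq_mul, ← character_add, add_sub_cancel]

theorem ord_character (m : Fin n → ℤ) (ρ : F.rays) :
    F.toricVariety.ord (F.character m : F.toricVariety.functionField)
      (F.orbitPoint (F.rayCone ρ)) = m ⬝ᵥ ρ.1 := by
  have h := F.ord_orbitPoint (ρ := ρ) (f := F.character m) (a := AddMonoidAlgebra.single m 1)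
    (b := 1) (by rw [map_one, mul_one]; rfl) (hasOrder_single ρ.1 m one_ne_zero)
    (hasOrder_single ρ.1 0 one_ne_zero)
  rwa [zero_dotProduct, sub_zero] at h

theorem character_mem_stalkUnits {σ : F.cones} (p : PrimeSpectrum (coordRing σ.1))
    {m : Fin n → ℤ} (hm : m ∈ dualMonoid σ.1) (hm' : -m ∈ dualMonoid σ.1) :
    F.character m ∈ stalkUnits F.toricVariety (F.chart σ p) := by
  refine (F.mem_stalkUnits_chart_iff σ p _).2 ⟨AddMonoidAlgebra.single ⟨m, hm⟩ 1, 1, fun h => ?_,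
    fun h => p.2.ne_top ((Ideal.eq_top_iff_one _).2 h), ?_⟩
  · refine p.2.ne_top ((Ideal.eq_top_iff_one _).2 ?_)
    have : (1 : coordRing σ.1) =
        AddMonoidAlgebra.single ⟨-m, hm'⟩ 1 * AddMonoidAlgebra.single ⟨m, hm⟩ 1 := by
      rw [AddMonoidAlgebra.single_mul_single, one_mul, AddMonoidAlgebra.one_def]
      congr 1
      ext i
      simp
    rw [this]
    exact Ideal.mul_mem_left _ _ h
  · rw [map_one, map_one, mul_one, toLaurent_single]
    rfl

theorem character_mem_stalkUnits_of_mem_torus {z : F.toricVariety} (hz : z ∈ F.torus)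
    (m : Fin n → ℤ) : F.character m ∈ stalkUnits F.toricVariety z := by
  obtain ⟨p, rfl⟩ := hz
  have h : ∀ m : Fin n → ℤ, m ∈ dualMonoid F.torusCone.1 := fun m x hx => by
    rw [(Submodule.mem_bot _).1 hx, dotProduct_zero]
  exact F.character_mem_stalkUnits p (h _) (h _)

/-- Different rays have different divisors: the orders of the characters along the divisor determine
the ray. -/
theorem orbitPoint_rayCone_injective :
    Function.Injective fun ρ : F.rays => F.orbitPoint (F.rayCone ρ) := by
  intro ρ ρ' h
  have h1 : ∀ m : Fin n → ℤ, m ⬝ᵥ ρ.1 = m ⬝ᵥ ρ'.1 := fun m => by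
    rw [← ord_character, ← ord_character]
    exact congrArg _ h
  ext i
  simpa using h1 (Pi.single i 1)

theorem orbitPoint_rayCone_notMem_torus (ρ : F.rays) :
    F.orbitPoint (F.rayCone ρ) ∉ F.torus := by
  intro h
  obtain ⟨m, hm⟩ := exists_dot_eq_one ρ.2.1
  have h1 := ord_eq_zero_of_mem_stalkUnits (F.character_mem_stalkUnits_of_mem_torus h m)
  rw [ord_character] at h1
  omega

theorem divisor_orbitPoint (a : F.rays →₀ ℤ) (ρ : F.rays) :
    F.divisor a (F.orbitPoint (F.rayCone ρ)) = a ρ :=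
  Finsupp.mapDomain_apply F.orbitPoint_rayCone_injective a ρ

theorem divisor_of_mem_torus (a : F.rays →₀ ℤ) {z : F.toricVariety} (hz : z ∈ F.torus) :
    F.divisor a z = 0 := by
  refine Finsupp.mapDomain_of_notMem_range _ _ ?_
  rintro ⟨ρ, rfl⟩
  exact F.orbitPoint_rayCone_notMem_torus ρ hz

/-- A rational function that has order zero on an open part of the torus which contains `b ≠ 0`
differs from a Laurent polynomial by a power of `b`, and so does its inverse. -/
theorem exists_laurent_of_ord_eq_zero (f : (F.toricVariety.functionField)ˣ) {σ : F.cones}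
    (b : coordRing σ.1)
    (h : ∀ z ∈ F.torus, (∃ p : PrimeSpectrum (coordRing σ.1), b ∉ p.asIdeal ∧ F.chart σ p = z) →
      Order.coheight z = 1 → F.toricVariety.ord (f : F.toricVariety.functionField) z = 0) :
    ∃ (k : ℕ) (a c : Laurent n), f * F.ratFun (toLaurent σ.1 b ^ k) = F.ratFun a ∧
      a * c = toLaurent σ.1 b ^ (2 * k) := by
  have hle : F.torusCone.1 ≤ σ.1 := bot_le
  have hunit : ∀ p : PrimeSpectrum (coordRing F.torusCone.1), coordMap hle b ∉ p.asIdeal →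
      f ∈ stalkUnits F.toricVariety (F.chart F.torusCone p) := by
    intro p hp
    refine mem_stalkUnits_of_ord_eq_zero (F.chart F.torusCone) p f fun q hq hq1 => ?_
    exact h _ ⟨q, rfl⟩ ⟨PrimeSpectrum.comap (coordMap hle) q, fun hb => hp (hq hb),
      chart_comap hle q⟩ hq1
  have hchart : chartFunction (F.chart F.torusCone) (coordMap hle b) =
      F.ratFun (toLaurent σ.1 b) := by
    rw [← toLaurent_coordMap hle]
    exact (F.ratFun_toLaurent_bot _).symm
  obtain ⟨k, a, ha⟩ := exists_mul_pow_eq (F.chart F.torusCone) (coordMap hle b)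
    (f : F.toricVariety.functionField) fun p hp => ((mem_stalkUnits_iff_range _ _).1 (hunit p hp)).1
  obtain ⟨l, c, hc⟩ := exists_mul_pow_eq (F.chart F.torusCone) (coordMap hle b)
    ((f⁻¹ : (F.toricVariety.functionField)ˣ) : F.toricVariety.functionField)
    fun p hp => ((mem_stalkUnits_iff_range _ _).1 (hunit p hp)).2
  rw [hchart] at ha hc
  have ha2 := F.ratFun_toLaurent_bot a
  have hc2 := F.ratFun_toLaurent_bot c
  rw [← show F.ratFun (toLaurent _ a) = _ from ha2] at ha
  rw [← show F.ratFun (toLaurent _ c) = _ from hc2] at hc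
  refine ⟨k + l, toLaurent _ a * toLaurent σ.1 b ^ l, toLaurent _ c * toLaurent σ.1 b ^ k, ?_, ?_⟩
  · rw [map_mul, ← ha, map_pow, map_pow]
    ring
  · apply F.ratFun_injective
    rw [map_mul, map_mul, map_mul, ← ha, ← hc, map_pow, map_pow, map_pow]
    calc _ = ((f : F.toricVariety.functionField) *
          ((f⁻¹ : (F.toricVariety.functionField)ˣ) : F.toricVariety.functionField)) *
          F.ratFun (toLaurent σ.1 b) ^ (2 * (k + l)) := by ring
      _ = _ := by rw [Units.mul_inv, one_mul]

/-- An open neighbourhood of a point of a chart contains a principal open subset of the chart. -/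
theorem exists_basicOpen {σ : F.cones} {p : PrimeSpectrum (coordRing σ.1)}
    {U : F.toricVariety.Opens} (h : F.chart σ p ∈ U) : ∃ b : coordRing σ.1, b ∉ p.asIdeal ∧
      ∀ q : PrimeSpectrum (coordRing σ.1), b ∉ q.asIdeal → F.chart σ q ∈ U := by
  have hopen : IsOpen {q : PrimeSpectrum (coordRing σ.1) | F.chart σ q ∈ U} :=
    ((F.chart σ) ⁻¹ᵁ U).2
  obtain ⟨_, ⟨b, rfl⟩, hb, hbU⟩ :=
    PrimeSpectrum.isTopologicalBasis_basic_opens.exists_subset_of_mem_open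
      (show p ∈ {q : PrimeSpectrum (coordRing σ.1) | F.chart σ q ∈ U} from h) hopen
  exact ⟨b, hb, fun q hq => hbU hq⟩

/-- A function on the chart of `σ` vanishes along the divisor of a ray of `σ` if and only if all its
exponents are positive on the ray. -/
theorem mem_orbitPrime_comap {σ : F.cones} {ρ : F.rays} (hle : (F.rayCone ρ).1 ≤ σ.1)
    {b : coordRing σ.1} : b ∈ (PrimeSpectrum.comap (coordMap hle)
      (F.orbitPrime (F.rayCone ρ))).asIdeal ↔
      ∀ m ∈ (toLaurent σ.1 b).coeff.support, 0 < m ⬝ᵥ ρ.1 := by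
  have h1 : b ∈ (PrimeSpectrum.comap (coordMap hle)
      (F.orbitPrime (F.rayCone ρ))).asIdeal ↔
      coordMap hle b ∈ (F.orbitPrime (F.rayCone ρ)).asIdeal := Iff.rfl
  rw [h1, F.mem_orbitPrime_rayCone, ← toLaurent_coordMap hle]
  constructor
  · intro h m hm
    obtain ⟨h2, h3⟩ := mem_support_toLaurent hm
    exact h _ h3
  · intro h m hm
    refine h m.1 ?_
    rw [Finsupp.mem_support_iff, coeff_toLaurent]
    exact Finsupp.mem_support_iff.1 hm

/-- A Cartier divisor on a toric variety whose cones are generated by rays is trivial if its Weil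
divisor is. This is where the normality of the variety enters. -/
theorem eq_one_of_hasWeilDivisor_zero (hF : ∀ σ : F.cones, F.RayGenerated σ)
    {t : CartierDivisor F.toricVariety} (ht : HasWeilDivisor t 0) : t = 1 := by
  classical
  refine Subtype.ext (funext fun x => ?_)
  change t.1 x = 1
  obtain ⟨σ, p, rfl⟩ := F.exists_chart x
  obtain ⟨U, hU, g, hg⟩ := t.2 (F.chart σ p)
  have hord : ∀ z ∈ U, Order.coheight z = 1 →
      F.toricVariety.ord (g : F.toricVariety.functionField) z = 0 :=
    fun z hzU hz => ht z hz g (hg z hzU)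
  rw [hg _ hU, cartierGerm_eq_one_iff]
  obtain ⟨b, hb, hbU⟩ := F.exists_basicOpen hU
  obtain ⟨k, a, c, ha, hac⟩ := F.exists_laurent_of_ord_eq_zero g b (by
    rintro z - ⟨q, hq, rfl⟩ hz
    exact hord _ (hbU q hq) hz)
  have hB0 : toLaurent σ.1 b ≠ 0 := fun h0 => hb (by
    rw [(map_eq_zero_iff _ (toLaurent_injective _)).1 h0]
    exact zero_mem _)
  have hac0 : a * c ≠ 0 := hac ▸ pow_ne_zero _ hB0
  have := Fintype.ofFinite F.rays
  choose oa hoa using fun ρ : F.rays => exists_hasOrder ρ.1 (left_ne_zero_of_mul hac0)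
  choose oc hoc using fun ρ : F.rays => exists_hasOrder ρ.1 (right_ne_zero_of_mul hac0)
  choose ob hob using fun ρ : F.rays => exists_hasOrder ρ.1 hB0
  have hsum : ∀ ρ, oa ρ + oc ρ = (2 * k : ℕ) * ob ρ := fun ρ =>
    ((hoa ρ).mul (hoc ρ)).unique (hac ▸ (hob ρ).pow (2 * k))
  -- multiplication by a high power of `b` removes the poles along the rays where `b` vanishes
  let N : ℕ := ∑ ρ : F.rays, ((oa ρ).natAbs + (oc ρ).natAbs)
  have hN : ∀ ρ : F.rays, toReal ρ.1 ∈ σ.1 →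
      0 ≤ oa ρ + N * ob ρ ∧ 0 ≤ oc ρ + N * ob ρ := by
    intro ρ hρ
    have hle : (F.rayCone ρ).1 ≤ σ.1 := F.rayCone_le hρ
    have h1 : (oa ρ).natAbs + (oc ρ).natAbs ≤ N :=
      Finset.single_le_sum (f := fun ρ : F.rays => (oa ρ).natAbs + (oc ρ).natAbs)
        (fun _ _ => Nat.zero_le _) (Finset.mem_univ ρ)
    have hob0 : 0 ≤ ob ρ := by
      obtain ⟨m, hm, h⟩ := (hob ρ).2
      rw [← h]
      exact dot_nonneg_of_mem (mem_support_toLaurent hm).1 hρ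
    rcases hob0.eq_or_lt with h0 | h0
    · have hz : b ∉ (PrimeSpectrum.comap (coordMap hle)
          (F.orbitPrime (F.rayCone ρ))).asIdeal := fun h => by
        obtain ⟨m, hm, hm0⟩ := (hob ρ).2
        have := (F.mem_orbitPrime_comap hle).1 h m hm
        omega
      have hzU := hbU _ hz
      rw [chart_comap hle, chart_orbitPrime] at hzU
      have h2 := hord _ hzU (F.coheight_orbitPoint_rayCone ρ)
      rw [F.ord_orbitPoint ha (hoa ρ) ((hob ρ).pow k)] at h2
      have h3 := hsum ρ
      rw [← h0] at h2 h3 ⊢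
      simp only [mul_zero] at h2 h3 ⊢
      omega
    · have h2 : (oa ρ).natAbs + (oc ρ).natAbs ≤ (N : ℤ) * ob ρ := by
        have : ((oa ρ).natAbs + (oc ρ).natAbs : ℤ) ≤ N := by exact_mod_cast h1
        nlinarith
      omega
  have hmem : ∀ (h : Laurent n) (o : F.rays → ℤ), (∀ ρ, HasOrder ρ.1 h (o ρ)) →
      (∀ ρ : F.rays, toReal ρ.1 ∈ σ.1 → 0 ≤ o ρ + N * ob ρ) →
      ∃ a' : coordRing σ.1, toLaurent σ.1 a' = h * toLaurent σ.1 b ^ N := by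
    intro h o ho h0
    refine mem_range_toLaurent_iff.2 fun m hm => (hF σ).mem_dualMonoid.2 fun ρ hρ => ?_
    exact (h0 ρ hρ).trans (((ho ρ).mul ((hob ρ).pow N)).1 m hm)
  obtain ⟨a', ha'⟩ := hmem a oa hoa fun ρ hρ => (hN ρ hρ).1
  obtain ⟨c', hc'⟩ := hmem c oc hoc fun ρ hρ => (hN ρ hρ).2
  refine (F.mem_stalkUnits_chart_iff σ p g).2 ⟨a', b ^ (k + N), fun h => ?_,
    fun h => hb (p.2.mem_of_pow_mem _ h), ?_⟩
  · have h2 : a' * c' = b ^ (2 * k + 2 * N) := by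
      apply toLaurent_injective
      rw [map_mul, ha', hc', map_pow, pow_add, ← hac]
      ring
    exact hb (p.2.mem_of_pow_mem _ (h2 ▸ Ideal.mul_mem_right c' _ h))
  · rw [ha', map_mul, ← ha, map_pow, pow_add, map_mul, map_pow, map_pow]
    ring

/-- The orders of `f` along the four rays of a quadrangle satisfy the relation of the rays, if `f`
is a unit on the part of the torus where `b` does not vanish and `b` does not vanish along these
rays. -/
theorem ord_quadrangle {f : (F.toricVariety.functionField)ˣ} {σ : F.cones}
    {A B C D : F.rays} (hABCD : A.1 + C.1 = B.1 + D.1) (b : coordRing σ.1)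
    (hb : ∀ u ∈ ({A.1, B.1, C.1, D.1, A.1 + C.1} : Set (Fin n → ℤ)),
      HasOrder u (toLaurent σ.1 b) 0)
    (h : ∀ z ∈ F.torus, (∃ p : PrimeSpectrum (coordRing σ.1), b ∉ p.asIdeal ∧ F.chart σ p = z) →
      Order.coheight z = 1 → F.toricVariety.ord (f : F.toricVariety.functionField) z = 0) :
    F.toricVariety.ord (f : F.toricVariety.functionField) (F.orbitPoint (F.rayCone A)) +
      F.toricVariety.ord (f : F.toricVariety.functionField) (F.orbitPoint (F.rayCone C)) =
    F.toricVariety.ord (f : F.toricVariety.functionField) (F.orbitPoint (F.rayCone B)) +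
      F.toricVariety.ord (f : F.toricVariety.functionField) (F.orbitPoint (F.rayCone D)) := by
  obtain ⟨k, a, c, ha, hac⟩ := F.exists_laurent_of_ord_eq_zero f b h
  have hpow : ∀ r : ℕ, ∀ u ∈ ({A.1, B.1, C.1, D.1, A.1 + C.1} : Set (Fin n → ℤ)),
      HasOrder u (toLaurent σ.1 b ^ r) 0 := fun r u hu => by
    have := (hb u hu).pow r
    rwa [mul_zero] at this
  have hac0 : a * c ≠ 0 := by
    rw [hac]
    exact (hpow _ A.1 (by simp)).ne_zero
  choose o ho using fun ρ : F.rays => exists_hasOrder ρ.1 (left_ne_zero_of_mul hac0)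
  have hord : ∀ ρ : F.rays, ρ.1 ∈ ({A.1, B.1, C.1, D.1, A.1 + C.1} : Set (Fin n → ℤ)) →
      F.toricVariety.ord (f : F.toricVariety.functionField) (F.orbitPoint (F.rayCone ρ)) = o ρ :=
    fun ρ hρ => by rw [F.ord_orbitPoint ha (ho ρ) (hpow k _ hρ), sub_zero]
  rw [hord A (by simp), hord B (by simp), hord C (by simp), hord D (by simp)]
  refine HasOrder.quadrangle (g := c) hABCD (fun u hu => ?_) (ho A) (ho B) (ho C) (ho D)
  rw [hac]
  exact hpow _ u hu

/-- A Cartier divisor that is given by the character of `m σ` on the chart of each cone `σ` has the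
Weil divisor whose multiplicity at a ray is the value of these linear forms. -/
theorem hasWeilDivisor_of_character (hF : ∀ σ : F.cones, F.RayGenerated σ)
    {s : CartierDivisor F.toricVariety} {m : F.cones → Fin n → ℤ}
    (hs : ∀ (σ : F.cones) (p : PrimeSpectrum (coordRing σ.1)),
      s.1 (F.chart σ p) = cartierGerm F.toricVariety _ (F.character (m σ)))
    {a : F.rays →₀ ℤ} (hm : ∀ (σ : F.cones) (ρ : F.rays), toReal ρ.1 ∈ σ.1 → m σ ⬝ᵥ ρ.1 = a ρ) :
    HasWeilDivisor s (F.divisor a) := by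
  rw [hasWeilDivisor_iff_of_eq]
  intro z hz
  obtain ⟨σ, p, rfl⟩ := F.exists_chart z
  refine ⟨_, hs σ p, ?_⟩
  rcases F.mem_torus_or_eq_orbitPoint (hF σ) hz with h | ⟨ρ, hρ, h⟩
  · rw [F.divisor_of_mem_torus a h]
    exact ord_eq_zero_of_mem_stalkUnits (F.character_mem_stalkUnits_of_mem_torus h _)
  · rw [h, divisor_orbitPoint, ord_character, hm σ ρ hρ]

/-- Linear forms on the cones which agree on the rays glue to a Cartier divisor. -/
theorem exists_cartierDivisor_of_character (hF : ∀ σ : F.cones, F.RayGenerated σ)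
    (m : F.cones → Fin n → ℤ) (a : F.rays →₀ ℤ)
    (hm : ∀ (σ : F.cones) (ρ : F.rays), toReal ρ.1 ∈ σ.1 → m σ ⬝ᵥ ρ.1 = a ρ) :
    ∃ s : CartierDivisor F.toricVariety, ∀ (σ : F.cones) (p : PrimeSpectrum (coordRing σ.1)),
      s.1 (F.chart σ p) = cartierGerm F.toricVariety _ (F.character (m σ)) := by
  have hsub : ∀ {κ σ : F.cones} (_ : κ ≤ σ) (q : PrimeSpectrum (coordRing κ.1)),
      cartierGerm F.toricVariety (F.chart κ q) (F.character (m σ)) =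
        cartierGerm F.toricVariety (F.chart κ q) (F.character (m κ)) := by
    intro κ σ h q
    rw [cartierGerm_eq_iff, inv_character_mul]
    refine F.character_mem_stalkUnits q ?_ ?_ <;>
      refine (hF κ).mem_dualMonoid.2 fun ρ hρ => ?_
    · rw [sub_dotProduct, hm κ ρ hρ, hm σ ρ (h hρ), sub_self]
    · rw [neg_dotProduct, sub_dotProduct, hm κ ρ hρ, hm σ ρ (h hρ), sub_self, neg_zero]
  have hglue : ∀ (σ σ' : F.cones) (p : PrimeSpectrum (coordRing σ.1))
      (p' : PrimeSpectrum (coordRing σ'.1)) (_ : F.chart σ p = F.chart σ' p'),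
      cartierGerm F.toricVariety (F.chart σ p) (F.character (m σ)) =
        cartierGerm F.toricVariety (F.chart σ p) (F.character (m σ')) := by
    intro σ σ' p p' h
    obtain ⟨κ, fi, fj, q, h1, h2⟩ := (Scheme.IsLocallyDirected.ι_eq_ι_iff F.diagram).1 h
    have e : F.chart κ q = F.chart σ p := by
      rw [← h1]
      exact (chart_comap (leOfHom fi) q).symm
    rw [← e]
    exact (hsub (leOfHom fi) q).trans (hsub (leOfHom fj) q).symm
  choose c q hq using F.exists_chart
  have key : ∀ (σ : F.cones) (p : PrimeSpectrum (coordRing σ.1)),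
      cartierGerm F.toricVariety (F.chart σ p) (F.character (m (c (F.chart σ p)))) =
        cartierGerm F.toricVariety (F.chart σ p) (F.character (m σ)) := fun σ p =>
    (hglue σ _ p (q (F.chart σ p)) (hq _).symm).symm
  refine ⟨⟨fun x => cartierGerm F.toricVariety x (F.character (m (c x))), fun x => ?_⟩, key⟩
  obtain ⟨σ, p, rfl⟩ := F.exists_chart x
  refine ⟨(F.chart σ).opensRange, ⟨p, rfl⟩, F.character (m σ), ?_⟩
  rintro _ ⟨r, rfl⟩
  exact key σ r

end Fan

end Divisor

/-! ### Power series and ordinary double points -/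

section OrdinaryDoublePoint

open MvPowerSeries in
/-- A power series without constant term is a combination of the variables; the coefficient of the
`i`-th variable collects the monomials in which this is the first variable that occurs. -/
theorem exists_eq_sum_X_mul {r : ℕ} (f : MvPowerSeries (Fin r) ℂ) (h0 : constantCoeff f = 0) :
    ∃ g : Fin r → MvPowerSeries (Fin r) ℂ, f = ∑ i, X i * g i ∧
      ∀ k : ℕ, (∀ d, d.degree < k + 1 → coeff d f = 0) →
        ∀ i d, d.degree < k → coeff d (g i) = 0 := by
  classical
  let g : Fin r → MvPowerSeries (Fin r) ℂ := fun i e =>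
    if ∀ j < i, e j = 0 then coeff (e + Finsupp.single i 1) f else 0
  have hg : ∀ i e, coeff e (g i) =
      if ∀ j < i, e j = 0 then coeff (e + Finsupp.single i 1) f else 0 := fun i e => rfl
  refine ⟨g, ?_, ?_⟩
  · ext d
    rw [map_sum]
    simp_rw [X_def, coeff_monomial_mul, one_mul]
    by_cases hd : d = 0
    · subst hd
      rw [coeff_zero_eq_constantCoeff_apply, h0, Finset.sum_eq_zero]
      intro i _
      rw [if_neg]
      intro h
      have := h i
      simp at this
    · have hne : (Finset.univ.filter fun i => d i ≠ 0).Nonempty := by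
        by_contra hcon
        rw [Finset.not_nonempty_iff_eq_empty] at hcon
        refine hd (Finsupp.ext fun i => ?_)
        by_contra hi
        have : i ∈ Finset.univ.filter fun i => d i ≠ 0 := by simpa using hi
        rw [hcon] at this
        simp at this
      obtain ⟨i₀, hi₀, hmin⟩ := (Finset.univ.filter fun i => d i ≠ 0).exists_min_image id hne
      rw [Finset.mem_filter] at hi₀
      have hz : ∀ j < i₀, d j = 0 := fun j hj => by
        by_contra h
        have := hmin j (by simpa using h)
        exact absurd hj (not_lt.2 this)
      have hle : ∀ i, Finsupp.single i 1 ≤ d ↔ d i ≠ 0 := fun i => by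
        rw [Finsupp.single_le_iff]
        omega
      rw [Finset.sum_eq_single i₀]
      · rw [if_pos ((hle i₀).2 hi₀.2), hg, if_pos, tsub_add_cancel_of_le ((hle i₀).2 hi₀.2)]
        intro j hj
        rw [Finsupp.tsub_apply, hz j hj, Nat.zero_sub]
      · intro i _ hi
        split_ifs with h
        · rw [hg, if_neg]
          intro hall
          have hlt : i₀ < i := lt_of_le_of_ne
            (hmin i (by simpa using (hle i).1 h)) hi.symm
          have := hall i₀ hlt
          rw [Finsupp.tsub_apply, Finsupp.single_eq_of_ne hi.symm] at this
          exact hi₀.2 (by omega)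
        · rfl
      · simp
  · intro k hk i d hd
    rw [hg]
    split_ifs
    · refine hk _ ?_
      rw [map_add, Finsupp.degree_single]
      omega
    · rfl

open MvPowerSeries in
/-- The powers of the ideal of the variables are given by the vanishing of coefficients. -/
theorem mem_span_X_pow_iff {r : ℕ} (k : ℕ) (f : MvPowerSeries (Fin r) ℂ) :
    f ∈ Ideal.span (Set.range X) ^ k ↔ ∀ d, d.degree < k → coeff d f = 0 := by
  constructor
  · have hJ : ∀ k : ℕ, ∀ f ∈ (Ideal.span (Set.range X) : Ideal (MvPowerSeries (Fin r) ℂ)) ^ k,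
        (k : ℕ∞) ≤ f.order := by
      intro k
      induction k with
      | zero => intro f _; simp
      | succ k ih =>
        intro f hf
        rw [pow_succ] at hf
        induction hf using Submodule.mul_induction_on' with
        | mem_mul_mem a ha b hb =>
          have h1 : (1 : ℕ∞) ≤ b.order := by
            rw [one_le_order_iff_constCoeff_eq_zero]
            have : Ideal.span (Set.range X) ≤
                RingHom.ker (constantCoeff (σ := Fin r) (R := ℂ)) := by
              rw [Ideal.span_le]
              rintro _ ⟨i, rfl⟩
              exact constantCoeff_X i
            exact this hb
          push_cast
          exact (add_le_add (ih a ha) h1).trans le_order_mul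
        | add a _ b _ ha hb => exact (le_min ha hb).trans min_order_le_add
    exact fun hf d hd => coeff_of_lt_order ((Nat.cast_lt.2 hd).trans_le (hJ k f hf))
  · induction k generalizing f with
    | zero => simp
    | succ k ih =>
      intro h
      obtain ⟨g, hg, hgk⟩ := exists_eq_sum_X_mul f (by
        rw [← coeff_zero_eq_constantCoeff_apply]
        exact h 0 (by simp))
      rw [hg, pow_succ']
      exact Ideal.sum_mem _ fun i _ => Ideal.mul_mem_mul (Ideal.subset_span ⟨i, rfl⟩)
        (ih _ (hgk k h i))

open MvPowerSeries in
/-- Vanishing to order `k + 1` at the origin means vanishing of the value and vanishing of all first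
partial derivatives to order `k`. -/
theorem coeff_eq_zero_succ_iff {r : ℕ} (k : ℕ) (f : MvPowerSeries (Fin r) ℂ) :
    (∀ d, d.degree < k + 1 → coeff d f = 0) ↔
      constantCoeff f = 0 ∧ ∀ i, ∀ d, d.degree < k → coeff d (pderiv ℂ i f) = 0 := by
  constructor
  · intro h
    refine ⟨by rw [← coeff_zero_eq_constantCoeff_apply]; exact h 0 (by simp), fun i d hd => ?_⟩
    rw [coeff_pderiv, h _ (by rw [map_add, Finsupp.degree_single]; omega), zero_mul]
  · rintro ⟨h0, h⟩ d hd
    by_cases hd0 : d = 0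
    · subst hd0
      rw [coeff_zero_eq_constantCoeff_apply, h0]
    · obtain ⟨i, hi⟩ := Finsupp.ne_iff.1 hd0
      have hle : Finsupp.single i 1 ≤ d := by
        rw [Finsupp.single_le_iff]
        have : d i ≠ 0 := hi
        omega
      obtain ⟨e, rfl⟩ := exists_add_of_le hle
      rw [map_add, Finsupp.degree_single] at hd
      have h1 := h i e (by omega)
      rw [coeff_pderiv, mul_eq_zero] at h1
      rw [add_comm]
      exact h1.resolve_right (Nat.cast_add_one_ne_zero (e i))

open MvPowerSeries in
theorem mem_span_X_pow_one_iff {r : ℕ} (f : MvPowerSeries (Fin r) ℂ) :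
    f ∈ Ideal.span (Set.range X) ^ 1 ↔ constantCoeff f = 0 := by
  rw [mem_span_X_pow_iff, coeff_eq_zero_succ_iff]
  simp

open MvPowerSeries in
theorem mem_span_X_pow_two_iff {r : ℕ} (f : MvPowerSeries (Fin r) ℂ) :
    f ∈ Ideal.span (Set.range X) ^ 2 ↔
      constantCoeff f = 0 ∧ ∀ i, constantCoeff (pderiv ℂ i f) = 0 := by
  rw [mem_span_X_pow_iff, coeff_eq_zero_succ_iff]
  simp_rw [coeff_eq_zero_succ_iff]
  simp

open MvPowerSeries in
theorem mem_span_X_pow_three_iff {r : ℕ} (f : MvPowerSeries (Fin r) ℂ) :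
    f ∈ Ideal.span (Set.range X) ^ 3 ↔
      constantCoeff f = 0 ∧ ∀ i, constantCoeff (pderiv ℂ i f) = 0 ∧
        ∀ j, constantCoeff (pderiv ℂ j (pderiv ℂ i f)) = 0 := by
  rw [mem_span_X_pow_iff, coeff_eq_zero_succ_iff]
  simp_rw [coeff_eq_zero_succ_iff]
  simp

/-- The equation of an ordinary double point. -/
noncomputable def nodeEquation : MvPowerSeries (Fin 4) ℂ := ∑ i, MvPowerSeries.X i ^ 2

open MvPowerSeries in
theorem isMaximal_span_X {r : ℕ} :
    (Ideal.span (Set.range X) : Ideal (MvPowerSeries (Fin r) ℂ)).IsMaximal := by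
  have : (Ideal.span (Set.range X) : Ideal (MvPowerSeries (Fin r) ℂ)) =
      RingHom.ker (constantCoeff (σ := Fin r) (R := ℂ)) := by
    ext f
    have := mem_span_X_pow_one_iff f
    rwa [pow_one] at this
  rw [this]
  exact RingHom.ker_isMaximal_of_surjective _ fun c => ⟨C c, constantCoeff_C c⟩

/-- The elements of the local ring of an ordinary double point have lifts to power series, which
are unique up to multiples of the equation and are compatible with the powers of the maximal
ideals. -/
theorem IsOrdinaryDoublePoint.exists_lift {R : Type*} [CommRing R] [IsLocalRing R]
    [IsNoetherianRing R] (h : IsOrdinaryDoublePoint R) :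
    ∃ F : R → MvPowerSeries (Fin 4) ℂ,
      (∀ r s, F (r + s) - (F r + F s) ∈ Ideal.span {nodeEquation}) ∧
      (∀ r s, F (r * s) - F r * F s ∈ Ideal.span {nodeEquation}) ∧
      (∀ (k : ℕ) (r : R), r ∈ IsLocalRing.maximalIdeal R ^ k ↔
        F r ∈ Ideal.span (Set.range MvPowerSeries.X) ^ k ⊔ Ideal.span {nodeEquation}) ∧
      ∀ (k : ℕ) (f : MvPowerSeries (Fin 4) ℂ), ∃ r, F r - f ∈
        Ideal.span (Set.range MvPowerSeries.X) ^ k ⊔ Ideal.span {nodeEquation} := by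
  obtain ⟨e⟩ := h
  let I : Ideal (MvPowerSeries (Fin 4) ℂ) := Ideal.span {nodeEquation}
  let M : Ideal (MvPowerSeries (Fin 4) ℂ) := Ideal.span (Set.range MvPowerSeries.X)
  let m := IsLocalRing.maximalIdeal R
  let Rh := AdicCompletion m R
  let e' : Rh ≃+* MvPowerSeries (Fin 4) ℂ ⧸ I := e
  have hfg : m.FG := m.fg_of_isNoetherianRing
  have hloc : IsLocalRing (MvPowerSeries (Fin 4) ℂ ⧸ I) := e'.isLocalRing
  have hmax : IsLocalRing.maximalIdeal (MvPowerSeries (Fin 4) ℂ ⧸ I) =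
      M.map (Ideal.Quotient.mk I) := by
    have hM : M.IsMaximal := isMaximal_span_X
    rcases Ideal.map_eq_top_or_isMaximal_of_surjective (Ideal.Quotient.mk I)
      Ideal.Quotient.mk_surjective hM with h | h
    · exfalso
      have h2 : M ⊔ I = ⊤ := by
        have := congrArg (Ideal.comap (Ideal.Quotient.mk I)) h
        rwa [Ideal.comap_map_of_surjective _ Ideal.Quotient.mk_surjective,
          ← RingHom.ker_eq_comap_bot, Ideal.mk_ker, Ideal.comap_top] at this
      have h3 : I ≤ M := by
        refine (Ideal.span_singleton_le_iff_mem _).2 (Ideal.sum_mem _ fun i _ => ?_)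
        exact Ideal.pow_mem_of_mem _ (Ideal.subset_span (Set.mem_range_self i)) 2 (by norm_num)
      rw [sup_eq_left.2 h3] at h2
      exact hM.ne_top h2
    · exact (IsLocalRing.eq_maximalIdeal h).symm
  have hme : (IsLocalRing.maximalIdeal Rh).map e' = M.map (Ideal.Quotient.mk I) := by
    rw [← hmax]
    rcases Ideal.map_eq_top_or_isMaximal_of_surjective e' e'.surjective
      (IsLocalRing.maximalIdeal.isMaximal Rh) with h | h
    · exfalso
      have := congrArg (Ideal.comap e') h
      rw [Ideal.comap_map_of_bijective _ e'.bijective, Ideal.comap_top] at this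
      exact (IsLocalRing.maximalIdeal.isMaximal Rh).ne_top this
    · exact IsLocalRing.eq_maximalIdeal h
  -- the kernel of the evaluation of the completion at the `k`-th level
  have hker : ∀ (k : ℕ) (y : Rh) (f : MvPowerSeries (Fin 4) ℂ), e' y = Ideal.Quotient.mk I f →
      (AdicCompletion.eval m R k y = 0 ↔ f ∈ M ^ k ⊔ I) := by
    intro k y f hyf
    have h1 : AdicCompletion.eval m R k y = 0 ↔ y ∈ IsLocalRing.maximalIdeal Rh ^ k := by
      have e1 : IsLocalRing.maximalIdeal Rh = m.map (algebraMap R Rh) :=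
        AdicCompletion.maximalIdeal_eq_map
      rw [← LinearMap.mem_ker, ← AdicCompletion.pow_smul_top_eq_ker_eval hfg, e1,
        ← Ideal.map_pow, Ideal.smul_top_eq_map, Submodule.restrictScalars_mem]
    have h2 : y ∈ IsLocalRing.maximalIdeal Rh ^ k ↔
        e' y ∈ ((IsLocalRing.maximalIdeal Rh) ^ k).map e' := by
      rw [← Ideal.mem_comap, Ideal.comap_map_of_bijective e' e'.bijective]
    rw [h1, h2, Ideal.map_pow, hme, ← Ideal.map_pow, hyf, Ideal.mem_map_iff_of_surjective _
      Ideal.Quotient.mk_surjective]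
    constructor
    · rintro ⟨g, hg, hgf⟩
      have h3 := Ideal.Quotient.eq.1 hgf.symm
      rw [← add_sub_cancel g f]
      exact Submodule.add_mem_sup hg h3
    · intro hf
      obtain ⟨g, hg, i, hi, rfl⟩ := Submodule.mem_sup.1 hf
      exact ⟨g, hg, by rw [map_add, Ideal.Quotient.eq_zero_iff_mem.2 hi, add_zero]⟩
  choose F hF using fun r : R => Ideal.Quotient.mk_surjective (I := I) (e' (algebraMap R Rh r))
  have heval : ∀ (k : ℕ) (r : R), AdicCompletion.eval m R k (algebraMap R Rh r) =
      Submodule.Quotient.mk r := fun k r => rfl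
  refine ⟨F, fun r s => ?_, fun r s => ?_, fun k r => ?_, fun k f => ?_⟩
  · rw [← Ideal.Quotient.eq, map_add, hF, hF, hF, map_add, map_add]
  · rw [← Ideal.Quotient.eq, map_mul, hF, hF, hF, map_mul, map_mul]
  · rw [← hker k _ _ (hF r).symm, heval, Submodule.Quotient.mk_eq_zero, smul_eq_mul, Ideal.mul_top]
  · obtain ⟨y, hy⟩ := e'.surjective (Ideal.Quotient.mk I f)
    obtain ⟨r, hr⟩ := Submodule.Quotient.mk_surjective _ (AdicCompletion.eval m R k y)
    refine ⟨r, (hker k (algebraMap R Rh r - y) _ ?_).1 ?_⟩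
    · rw [map_sub, map_sub, hF, hy]
    · rw [map_sub, heval, ← hr, sub_self]

section NodeEquation

open MvPowerSeries

theorem constantCoeff_pderiv_mul {r : ℕ} (i : Fin r) (f g : MvPowerSeries (Fin r) ℂ) :
    constantCoeff (pderiv ℂ i (f * g)) =
      constantCoeff f * constantCoeff (pderiv ℂ i g) +
        constantCoeff g * constantCoeff (pderiv ℂ i f) := by
  rw [Derivation.leibniz, map_add, smul_eq_mul, smul_eq_mul, map_mul, map_mul]

theorem constantCoeff_pderiv_pderiv_mul {r : ℕ} (i j : Fin r) (f g : MvPowerSeries (Fin r) ℂ) :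
    constantCoeff (pderiv ℂ j (pderiv ℂ i (f * g))) =
      constantCoeff f * constantCoeff (pderiv ℂ j (pderiv ℂ i g)) +
        constantCoeff g * constantCoeff (pderiv ℂ j (pderiv ℂ i f)) +
        (constantCoeff (pderiv ℂ i f) * constantCoeff (pderiv ℂ j g) +
        constantCoeff (pderiv ℂ j f) * constantCoeff (pderiv ℂ i g)) := by
  rw [Derivation.leibniz, map_add, smul_eq_mul, smul_eq_mul, map_add, constantCoeff_pderiv_mul,
    constantCoeff_pderiv_mul]
  ring

theorem pderiv_nodeEquation (i : Fin 4) : pderiv ℂ i nodeEquation = C 2 * X i := by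
  rw [nodeEquation, map_sum, Finset.sum_eq_single i]
  · rw [pderiv_pow, pderiv_X_self, mul_one, Nat.cast_ofNat, map_ofNat, pow_one]
  · intro j _ hj
    rw [pderiv_pow, pderiv_X_of_ne hj, mul_zero]
  · simp

/-- The multiples of the equation have no linear terms, and their Hessian at the origin is a scalar
matrix. -/
theorem derivatives_of_mem_span_nodeEquation {g : MvPowerSeries (Fin 4) ℂ}
    (hg : g ∈ Ideal.span {nodeEquation}) : constantCoeff g = 0 ∧
      (∀ i, constantCoeff (pderiv ℂ i g) = 0) ∧ ∃ t : ℂ, ∀ i j,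
        constantCoeff (pderiv ℂ j (pderiv ℂ i g)) = if i = j then t else 0 := by
  have h0 : constantCoeff nodeEquation = 0 := by simp [nodeEquation]
  have h1 : ∀ i, constantCoeff (pderiv ℂ i nodeEquation) = 0 := fun i => by
    rw [pderiv_nodeEquation]
    simp
  have h2 : ∀ i j, constantCoeff (pderiv ℂ j (pderiv ℂ i nodeEquation)) =
      if i = j then 2 else 0 := fun i j => by
    rw [pderiv_nodeEquation, constantCoeff_pderiv_mul]
    by_cases h : i = j
    · subst h
      simp
    · rw [pderiv_X_of_ne h]
      simp [h]
  obtain ⟨w, rfl⟩ := Ideal.mem_span_singleton'.1 hg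
  refine ⟨by rw [map_mul, h0, mul_zero], fun i => ?_, constantCoeff w * 2, fun i j => ?_⟩
  · rw [constantCoeff_pderiv_mul, h0, h1]
    ring
  · rw [constantCoeff_pderiv_pderiv_mul, h0, h1, h1, h2]
    split_ifs <;> ring

/-- Every scalar matrix is the Hessian at the origin of a multiple of the equation. -/
theorem exists_mem_span_nodeEquation (t : ℂ) : ∃ g ∈ Ideal.span {nodeEquation}, ∀ i j,
    constantCoeff (pderiv ℂ j (pderiv ℂ i g)) = if i = j then t else 0 := by
  refine ⟨C (t / 2) * nodeEquation, Ideal.mul_mem_left _ _ (Ideal.mem_span_singleton_self _),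
    fun i j => ?_⟩
  have h0 : constantCoeff nodeEquation = 0 := by simp [nodeEquation]
  rw [constantCoeff_pderiv_pderiv_mul, h0, pderiv_nodeEquation, constantCoeff_pderiv_mul]
  by_cases h : i = j
  · subst h
    simp
  · rw [pderiv_X_of_ne h]
    simp [h]

theorem mem_pow_one_sup_iff (f : MvPowerSeries (Fin 4) ℂ) :
    f ∈ Ideal.span (Set.range X) ^ 1 ⊔ Ideal.span {nodeEquation} ↔ constantCoeff f = 0 := by
  constructor
  · intro hf
    obtain ⟨g, hg, i, hi, rfl⟩ := Submodule.mem_sup.1 hf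
    rw [map_add, (mem_span_X_pow_one_iff g).1 hg, (derivatives_of_mem_span_nodeEquation hi).1,
      add_zero]
  · exact fun h => Submodule.mem_sup_left ((mem_span_X_pow_one_iff f).2 h)

theorem mem_pow_two_sup_iff (f : MvPowerSeries (Fin 4) ℂ) :
    f ∈ Ideal.span (Set.range X) ^ 2 ⊔ Ideal.span {nodeEquation} ↔
      constantCoeff f = 0 ∧ ∀ i, constantCoeff (pderiv ℂ i f) = 0 := by
  constructor
  · intro hf
    obtain ⟨g, hg, w, hw, rfl⟩ := Submodule.mem_sup.1 hf
    have h1 := (mem_span_X_pow_two_iff g).1 hg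
    have h2 := derivatives_of_mem_span_nodeEquation hw
    exact ⟨by rw [map_add, h1.1, h2.1, add_zero],
      fun i => by rw [map_add, map_add, h1.2, h2.2.1, add_zero]⟩
  · exact fun h => Submodule.mem_sup_left ((mem_span_X_pow_two_iff f).2 h)

/-- A power series without constant and linear terms is in the cube of the ideal of the variables
modulo the equation if and only if its Hessian at the origin is a scalar matrix. -/
theorem mem_pow_three_sup_iff (f : MvPowerSeries (Fin 4) ℂ) :
    f ∈ Ideal.span (Set.range X) ^ 3 ⊔ Ideal.span {nodeEquation} ↔
      constantCoeff f = 0 ∧ (∀ i, constantCoeff (pderiv ℂ i f) = 0) ∧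
        ∃ t : ℂ, ∀ i j, constantCoeff (pderiv ℂ j (pderiv ℂ i f)) = if i = j then t else 0 := by
  constructor
  · intro hf
    obtain ⟨g, hg, w, hw, rfl⟩ := Submodule.mem_sup.1 hf
    have h1 := (mem_span_X_pow_three_iff g).1 hg
    obtain ⟨h2, h3, t, h4⟩ := derivatives_of_mem_span_nodeEquation hw
    refine ⟨by rw [map_add, h1.1, h2, add_zero], fun i => ?_, t, fun i j => ?_⟩
    · rw [map_add, map_add, (h1.2 i).1, h3, add_zero]
    · rw [map_add, map_add, map_add, (h1.2 i).2, h4, zero_add]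
  · rintro ⟨h1, h2, t, h3⟩
    obtain ⟨w, hw, hw2⟩ := exists_mem_span_nodeEquation t
    obtain ⟨h4, h5, -⟩ := derivatives_of_mem_span_nodeEquation hw
    rw [← sub_add_cancel f w]
    refine Submodule.add_mem_sup ((mem_span_X_pow_three_iff _).2 ⟨?_, fun i => ⟨?_, fun j => ?_⟩⟩) hw
    · rw [map_sub, h1, h4, sub_zero]
    · rw [map_sub, map_sub, h2, h5, sub_zero]
    · rw [map_sub, map_sub, map_sub, h3, hw2, sub_self]

end NodeEquation

open MvPowerSeries in
/-- The tangent space of an ordinary double point and its quadratic cone: `c` is the residue map and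
`l` is the differential, with values in the tangent space. A sum of products of elements of the
maximal ideal `m` is in `m ^ 3` if and only if the corresponding quadratic form is a multiple of the
equation. -/
theorem IsOrdinaryDoublePoint.exists_differential {R : Type*} [CommRing R] [IsLocalRing R]
    [IsNoetherianRing R] (h : IsOrdinaryDoublePoint R) :
    ∃ (c : R →+* ℂ) (l : R →+ (Fin 4 → ℂ)), Function.Surjective c ∧
      (∀ r, c r = 0 ↔ r ∈ IsLocalRing.maximalIdeal R) ∧
      (∀ r s, l (r * s) = c r • l s + c s • l r) ∧
      (∀ v, ∃ r ∈ IsLocalRing.maximalIdeal R, l r = v) ∧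
      (∀ r ∈ IsLocalRing.maximalIdeal R, l r = 0 ↔ r ∈ IsLocalRing.maximalIdeal R ^ 2) ∧
      ∀ {ι : Type} (s : Finset ι) (f g : ι → R),
        (∀ i ∈ s, f i ∈ IsLocalRing.maximalIdeal R) → (∀ i ∈ s, g i ∈ IsLocalRing.maximalIdeal R) →
        (∑ i ∈ s, f i * g i ∈ IsLocalRing.maximalIdeal R ^ 3 ↔
          ∃ t : ℂ, ∀ a b, ∑ i ∈ s, (l (f i) a * l (g i) b + l (f i) b * l (g i) a) =
            if a = b then t else 0) := by
  obtain ⟨F, hadd, hmul, hmem, hsurj⟩ := h.exists_lift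
  have hc : ∀ {f g : MvPowerSeries (Fin 4) ℂ}, f - g ∈ Ideal.span {nodeEquation} →
      constantCoeff f = constantCoeff g := fun hfg => by
    have h0 := (derivatives_of_mem_span_nodeEquation hfg).1
    rwa [map_sub, sub_eq_zero] at h0
  have hd : ∀ {f g : MvPowerSeries (Fin 4) ℂ}, f - g ∈ Ideal.span {nodeEquation} →
      ∀ i, constantCoeff (pderiv ℂ i f) = constantCoeff (pderiv ℂ i g) := fun hfg i => by
    have h0 := (derivatives_of_mem_span_nodeEquation hfg).2.1 i
    rwa [map_sub, map_sub, sub_eq_zero] at h0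
  have hker : ∀ r, constantCoeff (F r) = 0 ↔ r ∈ IsLocalRing.maximalIdeal R := fun r => by
    rw [← mem_pow_one_sup_iff, ← hmem, pow_one]
  let c' : R →+ ℂ := AddMonoidHom.mk' (fun r => constantCoeff (F r)) fun r s => by
    rw [hc (hadd r s), map_add]
  have hcmul : ∀ r s, c' (r * s) = c' r * c' s := fun r s => (hc (hmul r s)).trans (map_mul _ _ _)
  have hc1 : c' 1 = 1 := by
    have h1 := hcmul 1 1
    rw [one_mul] at h1
    have h2 : c' 1 ≠ 0 := fun h0 => (IsLocalRing.maximalIdeal.isMaximal R).ne_top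
      ((Ideal.eq_top_iff_one _).2 ((hker 1).1 h0))
    exact (mul_left_cancel₀ h2 (by rw [mul_one]; exact h1)).symm
  let c : R →+* ℂ := { c' with map_one' := hc1, map_mul' := hcmul }
  let l : R →+ (Fin 4 → ℂ) :=
    AddMonoidHom.mk' (fun r i => constantCoeff (pderiv ℂ i (F r))) fun r s => funext fun i => by
      rw [hd (hadd r s), map_add, map_add, Pi.add_apply]
  refine ⟨c, l, fun z => ?_, hker, fun r s => funext fun i => ?_, fun v => ?_, fun r hr => ?_,
    fun {ι} s f g hf hg => ?_⟩
  · obtain ⟨r, hr⟩ := hsurj 1 (C z)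
    rw [mem_pow_one_sup_iff, map_sub, constantCoeff_C, sub_eq_zero] at hr
    exact ⟨r, hr⟩
  · exact (hd (hmul r s) i).trans (constantCoeff_pderiv_mul i _ _)
  · obtain ⟨r, hr⟩ := hsurj 2 (∑ i, C (v i) * X i)
    rw [mem_pow_two_sup_iff] at hr
    refine ⟨r, (hker r).1 ?_, funext fun i => ?_⟩
    · have := hr.1
      rw [map_sub, sub_eq_zero] at this
      rw [this]
      simp
    · have := hr.2 i
      rw [map_sub, map_sub, sub_eq_zero] at this
      refine this.trans ?_
      rw [map_sum, map_sum, Finset.sum_eq_single i]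
      · rw [constantCoeff_pderiv_mul]
        simp
      · intro j _ hj
        rw [constantCoeff_pderiv_mul, pderiv_X_of_ne hj]
        simp
      · simp
  · rw [hmem 2, mem_pow_two_sup_iff, hker, and_iff_right hr]
    exact funext_iff
  · have hsum : F (∑ i ∈ s, f i * g i) - ∑ i ∈ s, F (f i) * F (g i) ∈
        Ideal.span {nodeEquation} := by
      rw [← Ideal.Quotient.eq, map_sum]
      let Φ : R →+ MvPowerSeries (Fin 4) ℂ ⧸ Ideal.span {nodeEquation} :=
        AddMonoidHom.mk' (fun r => Ideal.Quotient.mk _ (F r)) fun r s => by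
          rw [← map_add, Ideal.Quotient.eq]
          exact hadd r s
      refine (map_sum Φ _ _).trans (Finset.sum_congr rfl fun i _ => ?_)
      exact Ideal.Quotient.eq.2 (hmul (f i) (g i))
    have hsum' : F (∑ i ∈ s, f i * g i) ∈
        Ideal.span (Set.range X) ^ 3 ⊔ Ideal.span {nodeEquation} ↔
        ∑ i ∈ s, F (f i) * F (g i) ∈
          Ideal.span (Set.range X) ^ 3 ⊔ Ideal.span {nodeEquation} := by
      rw [← sub_add_cancel (F (∑ i ∈ s, f i * g i)) (∑ i ∈ s, F (f i) * F (g i))]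
      exact Ideal.add_mem_iff_right _ (Submodule.mem_sup_right hsum)
    have hf0 : ∀ i ∈ s, constantCoeff (F (f i)) = 0 := fun i hi => (hker _).2 (hf i hi)
    have hg0 : ∀ i ∈ s, constantCoeff (F (g i)) = 0 := fun i hi => (hker _).2 (hg i hi)
    rw [hmem 3, hsum', mem_pow_three_sup_iff, and_iff_right, and_iff_right]
    · refine exists_congr fun t => forall₂_congr fun a b => ?_
      rw [map_sum, map_sum, map_sum]
      refine Eq.congr_left (Finset.sum_congr rfl fun i hi => ?_)
      rw [constantCoeff_pderiv_pderiv_mul, hf0 i hi, hg0 i hi, zero_mul, zero_mul, zero_add,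
        zero_add]
      rfl
    · intro a
      rw [map_sum, map_sum]
      refine Finset.sum_eq_zero fun i hi => ?_
      rw [constantCoeff_pderiv_mul, hf0 i hi, hg0 i hi, zero_mul, zero_mul, zero_add]
    · rw [map_sum]
      exact Finset.sum_eq_zero fun i hi => by rw [map_mul, hf0 i hi, zero_mul]

end OrdinaryDoublePoint

/-! ### Generators and faces of cones -/

section Cones

variable {n : ℕ}

/-- The face of a cone cut out by a linear form is generated by the generators on it. -/
theorem mem_coneHull_of_dot_eq_zero {U : Set (Fin n → ℤ)} {w : Fin n → ℤ}
    (hw : ∀ u ∈ U, 0 ≤ w ⬝ᵥ u) {x : Fin n → ℝ} (hx : x ∈ coneHull U)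
    (h0 : toReal w ⬝ᵥ x = 0) : x ∈ coneHull {u | u ∈ U ∧ w ⬝ᵥ u = 0} := by
  have hdual : w ∈ dualMonoid (coneHull U) := mem_dualMonoid_coneHull.2 hw
  have key : toReal w ⬝ᵥ x = 0 → x ∈ coneHull {u | u ∈ U ∧ w ⬝ᵥ u = 0} := by
    induction hx using Submodule.span_induction with
    | mem x hx =>
      obtain ⟨u, hu, rfl⟩ := hx
      intro h
      rw [toReal_dot] at h
      exact toReal_mem_coneHull ⟨hu, by exact_mod_cast h⟩
    | zero => exact fun _ => zero_mem _
    | add x y hx hy ihx ihy =>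
      intro h
      rw [dotProduct_add] at h
      have h1 := hdual x hx
      have h2 := hdual y hy
      exact add_mem (ihx (by linarith) (by linarith)) (ihy (by linarith) (by linarith))
    | smul c x hx ih =>
      intro h
      have e : c • x = (c : ℝ) • x := rfl
      rw [e, dotProduct_smul, smul_eq_mul, mul_eq_zero] at h
      rcases h with h | h
      · rw [e, h, zero_smul]
        exact zero_mem _
      · exact Submodule.smul_mem _ c (ih h h)
  exact key h0

theorem isFace_coneHull {U W : Set (Fin n → ℤ)} (w : Fin n → ℤ) (hw : ∀ u ∈ U, 0 ≤ w ⬝ᵥ u)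
    (hW : ∀ u, u ∈ W ↔ u ∈ U ∧ w ⬝ᵥ u = 0) : IsFace (coneHull W) (coneHull U) := by
  obtain rfl : W = {u | u ∈ U ∧ w ⬝ᵥ u = 0} := Set.ext hW
  refine ⟨w, mem_dualMonoid_coneHull.2 hw, fun x => ⟨fun hx => ⟨?_, ?_⟩, fun hx =>
    mem_coneHull_of_dot_eq_zero hw hx.1 hx.2⟩⟩
  · exact coneHull_le (fun u hu => toReal_mem_coneHull hu.1) hx
  · exact (isPerp_coneHull (V := {u | u ∈ U ∧ w ⬝ᵥ u = 0})).2 (fun u hu => hu.2) x hx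

/-- Two cones with the same dual semigroup are equal. It is assumed that one contains the other, and
that each generator of the larger one is exposed by a linear form. -/
theorem coneHull_eq_of_dual {V : Finset (Fin n → ℤ)} {U : Set (Fin n → ℤ)}
    (hVU : ∀ v ∈ V, toReal v ∈ coneHull U)
    (hdual : ∀ m ∈ dualMonoid (coneHull (V : Set (Fin n → ℤ))), ∀ u ∈ U, 0 ≤ m ⬝ᵥ u)
    (hexp : ∀ u ∈ U, u ≠ 0 ∧ ∃ w : Fin n → ℤ, w ⬝ᵥ u = 0 ∧ ∀ u' ∈ U, u' ≠ u → 0 < w ⬝ᵥ u') :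
    coneHull (V : Set (Fin n → ℤ)) = coneHull U := by
  refine le_antisymm (coneHull_le hVU) (coneHull_le fun u hu => ?_)
  obtain ⟨hu0, w, hwu, hw⟩ := hexp u hu
  have hw0 : ∀ u' ∈ U, 0 ≤ w ⬝ᵥ u' := fun u' hu' => by
    by_cases h : u' = u
    · rw [h, hwu]
    · exact (hw u' hu' h).le
  have hset : {u' | u' ∈ U ∧ w ⬝ᵥ u' = 0} = {u} := by
    ext u'
    constructor
    · rintro ⟨h1, h2⟩
      by_contra h
      exact (hw u' h1 h).ne' h2
    · rintro rfl
      exact ⟨hu, hwu⟩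
  have hwV : ∀ v ∈ V, 0 ≤ w ⬝ᵥ v := fun v hv =>
    dot_nonneg_of_mem (mem_dualMonoid_coneHull.2 hw0) (hVU v hv)
  -- a generator `v ≠ 0` of the smaller cone on the ray of `u` has to exist
  obtain ⟨v, hv, hv0, hwv⟩ : ∃ v ∈ V, v ≠ 0 ∧ w ⬝ᵥ v = 0 := by
    by_contra! hcon
    obtain ⟨i, hi⟩ := Function.ne_iff.1 hu0
    let t : Fin n → ℤ := Pi.single i (-u i)
    have ht : t ⬝ᵥ u < 0 := by
      rw [single_dotProduct]
      have : 0 < u i * u i := mul_self_pos.2 hi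
      linarith
    let k : ℕ := ∑ v ∈ V, (t ⬝ᵥ v).natAbs
    have hmem : k • w + t ∈ dualMonoid (coneHull (V : Set (Fin n → ℤ))) := by
      rw [mem_dualMonoid_coneHull]
      intro v hv
      by_cases hv0 : v = 0
      · rw [hv0, dotProduct_zero]
      have h1 : (t ⬝ᵥ v).natAbs ≤ k :=
        Finset.single_le_sum (f := fun v => (t ⬝ᵥ v).natAbs) (fun _ _ => Nat.zero_le _) hv
      have h2 : 0 < w ⬝ᵥ v := lt_of_le_of_ne (hwV v hv) (hcon v hv hv0).symm
      have h3 : -(t ⬝ᵥ v) ≤ (k : ℤ) := by omega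
      rw [add_dotProduct, smul_dotProduct, nsmul_eq_mul]
      nlinarith
    have := hdual _ hmem u hu
    rw [add_dotProduct, smul_dotProduct, hwu, smul_zero] at this
    omega
  have h1 := mem_coneHull_of_dot_eq_zero hw0 (hVU v hv) (by rw [toReal_dot, hwv, Int.cast_zero])
  rw [hset] at h1
  obtain ⟨c, hc, hcv⟩ := mem_coneHull_singleton h1
  have hc0 : c ≠ 0 := by
    rintro rfl
    refine hv0 (funext fun i => ?_)
    have := congrFun hcv i
    simpa [toReal] using this
  have h2 : toReal u = (⟨c⁻¹, inv_nonneg.2 hc⟩ : {c : ℝ // 0 ≤ c}) • toReal v := by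
    change toReal u = c⁻¹ • toReal v
    rw [hcv, smul_smul, inv_mul_cancel₀ hc0, one_smul]
  rw [h2]
  exact Submodule.smul_mem _ _ (toReal_mem_coneHull hv)

theorem smul_toReal_mem_coneHull {U : Set (Fin n → ℤ)} {u : Fin n → ℤ} (hu : u ∈ U) {k : ℤ}
    (hk : 0 ≤ k) : toReal (k • u) ∈ coneHull U := by
  have : toReal (k • u) = (⟨(k : ℝ), by exact_mod_cast hk⟩ : {c : ℝ // 0 ≤ c}) • toReal u := by
    change toReal (k • u) = (k : ℝ) • toReal u
    ext i
    simp [toReal]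
  rw [this]
  exact Submodule.smul_mem _ _ (toReal_mem_coneHull hu)

theorem toReal_zero : toReal (0 : Fin n → ℤ) = 0 := by
  ext i
  simp [toReal]

theorem ne_zero_of_primitive {u : Fin n → ℤ}
    (hu : ∀ (k : ℤ) (w : Fin n → ℤ), u = k • w → IsUnit k) : u ≠ 0 := by
  intro h
  have := hu 0 0 (by rw [h, zero_smul])
  exact not_isUnit_zero this

/-- A vector on which a linear form takes the value `1` is primitive. -/
theorem primitive_of_dot_eq_one {u m : Fin n → ℤ} (h : m ⬝ᵥ u = 1) (k : ℤ) (w : Fin n → ℤ)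
    (hw : u = k • w) : IsUnit k := by
  rw [hw, dotProduct_smul, smul_eq_mul] at h
  exact IsUnit.of_mul_eq_one _ h

namespace Fan

variable (F : Fan n)

/-- A ray of the fan in a cone that is generated by rays is one of the generators. -/
theorem mem_of_mem_coneHull {σ : F.cones} {U : Set (Fin n → ℤ)} (hU : U ⊆ F.rays)
    (hσ : σ.1 = coneHull U) {ρ : Fin n → ℤ} (hρ : ρ ∈ F.rays) (h : toReal ρ ∈ σ.1) : ρ ∈ U := by
  by_contra hρU
  obtain ⟨m, hm, hface⟩ := F.isFace_of_le (F.rayCone_le (ρ := ⟨ρ, hρ⟩) h)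
  have hpos : ∀ u ∈ U, 0 < m ⬝ᵥ u := fun u hu => by
    have huσ : toReal u ∈ σ.1 := hσ ▸ toReal_mem_coneHull hu
    refine lt_of_le_of_ne (dot_nonneg_of_mem hm huσ) fun h0 => hρU ?_
    have h1 : toReal u ∈ (F.rayCone ⟨ρ, hρ⟩).1 :=
      (hface _).2 ⟨huσ, by rw [toReal_dot, ← h0, Int.cast_zero]⟩
    rw [← eq_of_mem_coneHull_singleton hρ.1 (hU hu).1 h1]
    exact hu
  have h2 : toReal m ⬝ᵥ toReal ρ = 0 :=
    ((hface _).1 (toReal_mem_coneHull (Set.mem_singleton ρ))).2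
  have h3 := mem_coneHull_of_dot_eq_zero (fun u hu => (hpos u hu).le) (hσ ▸ h) h2
  have h4 : {u | u ∈ U ∧ m ⬝ᵥ u = 0} = (∅ : Set (Fin n → ℤ)) :=
    Set.eq_empty_of_forall_notMem fun u hu => (hpos u hu.1).ne' hu.2
  rw [h4, coneHull, Set.image_empty] at h3
  have h5 : toReal ρ = 0 := by simpa [PointedCone.hull] using h3
  refine ne_zero_of_primitive hρ.1 (funext fun i => ?_)
  have := congrFun h5 i
  simpa [toReal] using this

theorem rayGenerated_of_eq {σ : F.cones} {U : Set (Fin n → ℤ)} (hU : U ⊆ F.rays)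
    (hσ : σ.1 = coneHull U) : F.RayGenerated σ := by
  refine le_antisymm ?_ (coneHull_le fun u hu => hu.2)
  rw [hσ]
  exact coneHull_le fun u hu => toReal_mem_coneHull ⟨hU hu, hσ ▸ toReal_mem_coneHull hu⟩

/-- The generators of a cone of the fan which are exposed by linear forms are rays of the fan. -/
theorem mem_rays_of_exposed {σ : F.cones} {U : Set (Fin n → ℤ)} (hσ : σ.1 = coneHull U)
    {u m w : Fin n → ℤ} (hu : u ∈ U) (hm : m ⬝ᵥ u = 1) (hwu : w ⬝ᵥ u = 0)
    (hw : ∀ u' ∈ U, u' ≠ u → 0 < w ⬝ᵥ u') : u ∈ F.rays := by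
  refine ⟨primitive_of_dot_eq_one hm, F.face_mem σ.1 σ.2 _ ?_⟩
  rw [hσ]
  refine isFace_coneHull w (fun u' hu' => ?_) fun u' => ⟨?_, fun h => ?_⟩
  · by_cases h : u' = u
    · rw [h, hwu]
    · exact (hw u' hu' h).le
  · rintro rfl
    exact ⟨hu, hwu⟩
  · by_contra hne
    exact (hw u' h.1 hne).ne' h.2

/-- The dual cone of a cone of a fan has full dimension: each character is the difference of two
elements of the semigroup. -/
theorem exists_add_mem_dualMonoid (σ : F.cones) (m : Fin n → ℤ) :
    ∃ w ∈ dualMonoid σ.1, m + w ∈ dualMonoid σ.1 := by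
  obtain ⟨m₀, hm₀, hface⟩ := F.isFace_of_le (τ := F.torusCone) (σ := σ)
    (bot_le : (⊥ : PointedCone ℝ (Fin n → ℝ)) ≤ σ.1)
  obtain ⟨V, hV⟩ := F.rational σ.1 σ.2
  let k : ℕ := ∑ v ∈ V, (m ⬝ᵥ v).natAbs
  refine ⟨k • m₀, nsmul_mem (S := dualMonoid σ.1) hm₀ k, ?_⟩
  rw [hV, mem_dualMonoid_coneHull]
  intro v hv
  have hvσ : toReal v ∈ σ.1 := hV ▸ toReal_mem_coneHull hv
  by_cases h0 : m₀ ⬝ᵥ v = 0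
  · have h1 : toReal v = 0 := (Submodule.mem_bot _).1
      ((hface _).2 ⟨hvσ, by rw [toReal_dot, h0, Int.cast_zero]⟩)
    have h2 : v = 0 := funext fun i => by
      have := congrFun h1 i
      simpa [toReal] using this
    rw [h2, dotProduct_zero]
  · have h1 : (m ⬝ᵥ v).natAbs ≤ k :=
      Finset.single_le_sum (f := fun v => (m ⬝ᵥ v).natAbs) (fun _ _ => Nat.zero_le _) hv
    have h2 : 0 < m₀ ⬝ᵥ v := lt_of_le_of_ne (dot_nonneg_of_mem hm₀ hvσ) (Ne.symm h0)
    have h3 : -(m ⬝ᵥ v) ≤ (k : ℤ) := by omega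
    rw [add_dotProduct, smul_dotProduct, nsmul_eq_mul]
    nlinarith

/-- An additive function on the semigroup of a cone which vanishes only on the units. -/
theorem exists_height (σ : F.cones) : ∃ v : Fin n → ℤ, ∀ m ∈ dualMonoid σ.1,
    0 ≤ m ⬝ᵥ v ∧ (m ⬝ᵥ v = 0 ↔ IsPerp σ.1 m) := by
  obtain ⟨V, hV⟩ := F.rational σ.1 σ.2
  refine ⟨∑ v ∈ V, v, fun m hm => ?_⟩
  rw [hV] at hm ⊢
  have h0 := mem_dualMonoid_coneHull.1 hm
  rw [dotProduct_sum, isPerp_coneHull]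
  exact ⟨Finset.sum_nonneg h0, Finset.sum_eq_zero_iff_of_nonneg h0⟩

end Fan

end Cones

/-! ### Monomial relations in regular local rings -/

section Regular

open IsLocalRing

/-- The maximal ideal of a regular local ring is generated by `dim R` elements of any given system
of generators. -/
theorem exists_finset_span_eq_maximalIdeal {R : Type*} [CommRing R] [IsRegularLocalRing R]
    {ι : Type*} (x : ι → R) (hx : Ideal.span (Set.range x) = maximalIdeal R) :
    ∃ I : Finset ι, Ideal.span (x '' I) = maximalIdeal R ∧ (I.card : WithBot ℕ∞) = ringKrullDim R := by
  classical
  have hmem : ∀ i, x i ∈ maximalIdeal R := fun i => hx ▸ Ideal.subset_span ⟨i, rfl⟩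
  let y : ι → maximalIdeal R := fun i => ⟨x i, hmem i⟩
  have key : ∀ s : Set ι, Submodule.span R (y '' s) = ⊤ ↔
      Ideal.span (x '' s) = maximalIdeal R := by
    intro s
    have hinj := Submodule.map_injective_of_injective (maximalIdeal R).injective_subtype
    rw [← hinj.eq_iff, Submodule.map_span, Submodule.map_top, Submodule.range_subtype,
      ← Set.image_comp]
    rfl
  have hy : Submodule.span (ResidueField R)
      (Set.range ((maximalIdeal R).toCotangent ∘ y)) = ⊤ := by
    rw [Set.range_comp, CotangentSpace.span_image_eq_top_iff, ← Set.image_univ, key,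
      Set.image_univ, hx]
  obtain ⟨κ, a, ha, hspan, hli⟩ :=
    exists_linearIndependent' (ResidueField R) ((maximalIdeal R).toCotangent ∘ y)
  rw [hy] at hspan
  let b := Module.Basis.mk hli hspan.ge
  have := Module.Finite.finite_basis b
  have := Fintype.ofFinite κ
  refine ⟨Finset.univ.image a, ?_, ?_⟩
  · rw [← key, ← CotangentSpace.span_image_eq_top_iff, Finset.coe_image, Finset.coe_univ,
      Set.image_univ, ← hspan, ← Set.range_comp, ← Set.range_comp]
    rfl
  · rw [Finset.card_image_of_injective _ ha, Finset.card_univ,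
      ← Module.finrank_eq_card_basis b]
    exact (IsRegularLocalRing.iff_finrank_cotangentSpace R).1 inferInstance

theorem isUnit_add_of_mem_maximalIdeal {R : Type*} [CommRing R] [IsLocalRing R] {u m : R}
    (hu : IsUnit u) (hm : m ∈ maximalIdeal R) : IsUnit (u + m) := by
  by_contra h
  have h1 : u + m ∈ maximalIdeal R := (mem_maximalIdeal _).2 h
  have h2 := Ideal.sub_mem _ h1 hm
  rw [add_sub_cancel_right] at h2
  exact (mem_maximalIdeal _).1 h2 hu

/-- The elements of a system of parameters satisfy no monomial relation with disjoint exponents: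
modulo such a relation and `x i - e i * x s₀` for `i ≠ s₀`, with suitable units `e i`, the
parameter `x s₀` would be nilpotent, so that the maximal ideal would be minimal over an ideal with
too few generators. -/
theorem eq_zero_of_monomial_relation {R : Type*} [CommRing R] [IsLocalRing R] [IsNoetherianRing R]
    (hN : ∀ k : ℕ, k ≠ 0 → IsUnit (k : R)) {ι : Type*} [Fintype ι] {x : ι → R}
    (hx : Ideal.span (Set.range x) = maximalIdeal R)
    (hcard : (Fintype.card ι : WithBot ℕ∞) = ringKrullDim R) {α β : ι → ℕ} {u : R} (hu : IsUnit u)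
    (h : ∏ i, x i ^ α i = u * ∏ i, x i ^ β i) (hdisj : ∀ i, α i = 0 ∨ β i = 0) :
    ∀ i, α i = 0 := by
  classical
  have hmem : ∀ i, x i ∈ maximalIdeal R := fun i => hx ▸ Ideal.subset_span ⟨i, rfl⟩
  by_contra! hα
  obtain ⟨s, hs⟩ := hα
  have hβs : β s = 0 := (hdisj s).resolve_left hs
  obtain ⟨s₀, hs₀⟩ : ∃ s₀, β s₀ ≠ 0 := by
    by_contra! hβ
    have h1 : ∏ i, x i ^ α i ∈ maximalIdeal R := by
      rw [← Finset.mul_prod_erase _ _ (Finset.mem_univ s)]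
      exact Ideal.mul_mem_right _ _ (Ideal.pow_mem_of_mem _ (hmem s) _ (Nat.pos_of_ne_zero hs))
    rw [h] at h1
    simp only [hβ, pow_zero, Finset.prod_const_one, mul_one] at h1
    exact (mem_maximalIdeal _).1 h1 hu
  have hne : s ≠ s₀ := by
    rintro rfl
    exact hs₀ hβs
  let a := ∑ i, α i
  let b := ∑ i, β i
  -- a unit `ε` for which the relation does not become trivial
  obtain ⟨ε, c, v, hv, hεv⟩ : ∃ (ε : R) (c : ℕ) (v : R), IsUnit v ∧
      x s₀ ^ c * v = ε ^ α s * x s₀ ^ a - u * x s₀ ^ b := by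
    have hpow : ∀ k, k ≠ 0 → ∀ w : R, w * x s₀ ^ k ∈ maximalIdeal R := fun k hk w =>
      Ideal.mul_mem_left _ _ (Ideal.pow_mem_of_mem _ (hmem s₀) _ (Nat.pos_of_ne_zero hk))
    rcases lt_trichotomy a b with hab | hab | hab
    · refine ⟨1, a, 1 + (-u) * x s₀ ^ (b - a),
        isUnit_add_of_mem_maximalIdeal isUnit_one (hpow _ (by omega) _), ?_⟩
      conv_rhs => rw [← Nat.add_sub_of_le hab.le]
      rw [pow_add]
      ring
    · by_cases h1 : IsUnit (1 - u)
      · exact ⟨1, a, _, h1, by rw [← hab]; ring⟩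
      · have h2 : (1 - u) ∈ maximalIdeal R := (mem_maximalIdeal _).2 h1
        have h3 : 1 < 2 ^ α s := Nat.one_lt_two_pow hs
        refine ⟨2, a, _, isUnit_add_of_mem_maximalIdeal (hN (2 ^ α s - 1) (by omega)) h2, ?_⟩
        rw [Nat.cast_sub h3.le, ← hab]
        push_cast
        ring
    · refine ⟨1, b, -u + 1 * x s₀ ^ (a - b),
        isUnit_add_of_mem_maximalIdeal hu.neg (hpow _ (by omega) _), ?_⟩
      conv_rhs => rw [← Nat.add_sub_of_le hab.le]
      rw [pow_add]
      ring
  -- modulo `J` all parameters are multiples of `x s₀` by units, and the relation becomes the vanishing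
  -- of `x s₀ ^ c`; but `J` has one generator less than the dimension
  let e : ι → R := fun i => if i = s then ε else 1
  let T : Finset R := (Finset.univ.erase s₀).image fun i => x i - e i * x s₀
  let J : Ideal R := Ideal.span T
  have hJ : ∀ i, Ideal.Quotient.mk J (x i) = Ideal.Quotient.mk J (e i * x s₀) := by
    intro i
    by_cases hi : i = s₀
    · have : e i = 1 := if_neg (fun h' => hne (h'.symm.trans hi))
      rw [this, one_mul, hi]
    · refine Ideal.Quotient.eq.2 (Ideal.subset_span ?_)
      exact Finset.mem_coe.2 (Finset.mem_image.2 ⟨i, Finset.mem_erase.2 ⟨hi, Finset.mem_univ i⟩, rfl⟩)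
  have hprod : ∀ γ : ι → ℕ, Ideal.Quotient.mk J (∏ i, x i ^ γ i) =
      Ideal.Quotient.mk J (ε ^ γ s * x s₀ ^ ∑ i, γ i) := by
    intro γ
    have h1 : ∏ i, (e i * x s₀) ^ γ i = ε ^ γ s * x s₀ ^ ∑ i, γ i := by
      simp_rw [mul_pow]
      rw [Finset.prod_mul_distrib, Finset.prod_pow_eq_pow_sum, Finset.prod_eq_single s]
      · rw [show e s = ε from if_pos rfl]
      · intro i _ hi
        rw [show e i = 1 from if_neg hi, one_pow]
      · simp
    rw [← h1, map_prod, map_prod]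
    exact Finset.prod_congr rfl fun i _ => by rw [map_pow, map_pow, hJ]
  have hnil : x s₀ ^ c ∈ J := by
    rw [← Ideal.mul_unit_mem_iff_mem _ hv, hεv, ← Ideal.Quotient.eq, ← hprod α, h, map_mul, hprod β,
      hβs, pow_zero, one_mul, ← map_mul]
  have hmin : maximalIdeal R ∈ J.minimalPrimes := by
    refine ⟨⟨inferInstance, Ideal.span_le.2 ?_⟩, fun P hP _ => ?_⟩
    · intro y hy
      obtain ⟨i, -, rfl⟩ := Finset.mem_image.1 (Finset.mem_coe.1 hy)
      exact Ideal.sub_mem _ (hmem i) (Ideal.mul_mem_left _ _ (hmem s₀))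
    · have h0 : x s₀ ∈ P := hP.1.mem_of_pow_mem c (hP.2 hnil)
      rw [← hx, Ideal.span_le]
      rintro _ ⟨i, rfl⟩
      have h1 := hP.2 (Ideal.Quotient.eq.1 (hJ i))
      have h2 := Ideal.add_mem _ h1 (Ideal.mul_mem_left _ (e i) h0)
      rwa [sub_add_cancel] at h2
  have h1 := Ideal.height_le_card_of_mem_minimalPrimes_span_finset hmin
  have h2 : T.card ≤ Fintype.card ι - 1 := by
    refine Finset.card_image_le.trans ?_
    rw [Finset.card_erase_of_mem (Finset.mem_univ s₀), Finset.card_univ]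
  have h3 : 0 < Fintype.card ι := Fintype.card_pos_iff.2 ⟨s₀⟩
  rw [← maximalIdeal_height_eq_ringKrullDim] at hcard
  have h4 : (Fintype.card ι : ℕ∞) = (maximalIdeal R).height := by exact_mod_cast hcard
  rw [← h4] at h1
  have h5 : Fintype.card ι ≤ T.card := by exact_mod_cast h1
  omega

/-- The monomials in a system of parameters of a local domain are independent modulo units. -/
theorem eq_of_monomial_relation {R : Type*} [CommRing R] [IsLocalRing R] [IsNoetherianRing R]
    [IsDomain R] (hN : ∀ k : ℕ, k ≠ 0 → IsUnit (k : R)) {ι : Type*} [Fintype ι] {x : ι → R}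
    (hx0 : ∀ i, x i ≠ 0) (hx : Ideal.span (Set.range x) = maximalIdeal R)
    (hcard : (Fintype.card ι : WithBot ℕ∞) = ringKrullDim R) {α β : ι → ℕ} {u : R} (hu : IsUnit u)
    (h : ∏ i, x i ^ α i = u * ∏ i, x i ^ β i) : α = β := by
  have hP : ∏ i, x i ^ min (α i) (β i) ≠ 0 :=
    Finset.prod_ne_zero_iff.2 fun i _ => pow_ne_zero _ (hx0 i)
  have hsplit : ∀ γ : ι → ℕ, (∀ i, min (α i) (β i) ≤ γ i) → ∏ i, x i ^ γ i =
      (∏ i, x i ^ min (α i) (β i)) * ∏ i, x i ^ (γ i - min (α i) (β i)) := fun γ hγ => by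
    rw [← Finset.prod_mul_distrib]
    exact Finset.prod_congr rfl fun i _ => by rw [← pow_add, Nat.add_sub_of_le (hγ i)]
  rw [hsplit α fun i => min_le_left _ _, hsplit β fun i => min_le_right _ _, mul_left_comm] at h
  have h1 := mul_left_cancel₀ hP h
  have h2 := eq_zero_of_monomial_relation hN hx hcard hu h1 fun i => by omega
  obtain ⟨w, hw⟩ := hu
  have h3 : ∏ i, x i ^ (β i - min (α i) (β i)) =
      (w⁻¹ : Rˣ) * ∏ i, x i ^ (α i - min (α i) (β i)) := by
    rw [h1, ← hw, ← mul_assoc, Units.inv_mul, one_mul]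
  have h4 := eq_zero_of_monomial_relation hN hx hcard (w⁻¹).isUnit h3 fun i => by omega
  funext i
  have := h2 i
  have := h4 i
  omega

end Regular

/-! ### Cones whose orbit consists of regular points -/

section RegularCone

open IsLocalRing

variable {n : ℕ} {σ : PointedCone ℝ (Fin n → ℝ)}

theorem IsPerp.add {m m' : Fin n → ℤ} (h : IsPerp σ m) (h' : IsPerp σ m') : IsPerp σ (m + m') :=
  fun x hx => by rw [toReal_add, add_dotProduct, h x hx, h' x hx, add_zero]

theorem IsPerp.neg {m : Fin n → ℤ} (h : IsPerp σ m) : IsPerp σ (-m) :=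
  fun x hx => by rw [toReal_neg, neg_dotProduct, h x hx, neg_zero]

theorem isPerp_zero : IsPerp σ (0 : Fin n → ℤ) := fun x _ => by rw [toReal_zero, zero_dotProduct]

theorem IsPerp.mem_dualMonoid {m : Fin n → ℤ} (h : IsPerp σ m) : m ∈ dualMonoid σ :=
  fun x hx => (h x hx).ge

/-- If a sum of two elements of the dual semigroup vanishes on the cone, then both do. -/
theorem IsPerp.of_add {m m' : Fin n → ℤ} (hm : m ∈ dualMonoid σ) (hm' : m' ∈ dualMonoid σ)
    (h : IsPerp σ (m + m')) : IsPerp σ m := fun x hx => by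
  have h1 := h x hx
  have h2 := hm x hx
  have h3 := hm' x hx
  rw [toReal_add, add_dotProduct] at h1
  linarith

variable (σ) in
/-- The ideal of the closure of the orbit of `σ` in the coordinate ring of `σ`. -/
noncomputable abbrev orbitIdeal : Ideal (coordRing σ) := RingHom.ker (Fan.orbitHom σ)

instance : (orbitIdeal σ).IsPrime := RingHom.ker_isPrime _

/-- The ideal of the orbit closure is generated by the characters that do not vanish on the cone. -/
theorem orbitIdeal_eq_span : orbitIdeal σ =
    Ideal.span (AddMonoidAlgebra.of' ℂ (dualMonoid σ) '' {s | ¬ IsPerp σ s.1}) := by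
  ext a
  rw [mem_ker_orbitHom_iff, AddMonoidAlgebra.mem_ideal_span_of'_image]
  refine forall₂_congr fun m _ => ⟨fun h => ⟨m, h, 0, (zero_add m).symm⟩, ?_⟩
  rintro ⟨t, ht, d, rfl⟩ h
  refine ht (IsPerp.of_add (σ := σ) t.2 d.2 ?_)
  rw [add_comm]
  exact h

variable {R : Type*} [CommRing R] [Algebra (coordRing σ) R]
  [IsLocalization.AtPrime R (orbitIdeal σ)]

variable (R) in
/-- The germ of a character at the generic point of an orbit. -/
noncomputable def germ (s : dualMonoid σ) : R :=
  algebraMap (coordRing σ) R (AddMonoidAlgebra.single s 1)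

omit [IsLocalization.AtPrime R (orbitIdeal σ)] in
theorem germ_add (s t : dualMonoid σ) : germ R (s + t) = germ R s * germ R t := by
  rw [germ, germ, germ, ← map_mul, AddMonoidAlgebra.single_mul_single, one_mul]

omit [IsLocalization.AtPrime R (orbitIdeal σ)] in
theorem germ_zero : germ R (0 : dualMonoid σ) = 1 := by
  rw [germ, ← AddMonoidAlgebra.one_def, map_one]

omit [IsLocalization.AtPrime R (orbitIdeal σ)] in
theorem germ_nsmul (k : ℕ) (s : dualMonoid σ) : germ R (k • s) = germ R s ^ k := by
  induction k with
  | zero => rw [zero_smul, germ_zero, pow_zero]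
  | succ k ih => rw [succ_nsmul, germ_add, ih, pow_succ]

omit [IsLocalization.AtPrime R (orbitIdeal σ)] in
theorem germ_sum {ι : Type*} (I : Finset ι) (s : ι → dualMonoid σ) :
    germ R (∑ i ∈ I, s i) = ∏ i ∈ I, germ R (s i) := by
  classical
  induction I using Finset.induction_on with
  | empty => exact germ_zero
  | insert i I hi ih => rw [Finset.sum_insert hi, Finset.prod_insert hi, germ_add, ih]

omit [IsLocalization.AtPrime R (orbitIdeal σ)] in
theorem isUnit_germ {s : dualMonoid σ} (hs : IsPerp σ s.1) : IsUnit (germ R s) := by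
  refine IsUnit.of_mul_eq_one (germ R ⟨-s.1, hs.neg.mem_dualMonoid⟩) ?_
  rw [← germ_add, ← germ_zero (σ := σ)]
  congr 1
  ext i
  simp

theorem isUnit_natCast_of_algebra (A : Type*) {R : Type*} [CommRing A] [Algebra ℂ A] [CommRing R]
    [Algebra A R] {k : ℕ} (hk : k ≠ 0) : IsUnit (k : R) := by
  have h1 : IsUnit (algebraMap ℂ A k) := (IsUnit.mk0 (k : ℂ) (Nat.cast_ne_zero.2 hk)).map _
  have h2 := h1.map (algebraMap A R)
  rwa [map_natCast, map_natCast] at h2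

theorem germ_ne_zero (s : dualMonoid σ) : germ R s ≠ 0 := by
  have hinj := IsLocalization.injective R (orbitIdeal σ).primeCompl_le_nonZeroDivisors
  rw [germ, Ne, map_eq_zero_iff _ hinj, AddMonoidAlgebra.single_eq_zero]
  exact one_ne_zero

/-- The maximal ideal at the orbit is generated by germs of characters. In a regular local ring a
regular system of parameters can therefore be chosen among them. -/
theorem maximalIdeal_eq_span_germ [IsLocalRing R] :
    Ideal.span (Set.range fun s : {s : dualMonoid σ // ¬ IsPerp σ s.1} => germ R s.1) =
      maximalIdeal R := by
  rw [← IsLocalization.AtPrime.map_eq_maximalIdeal (orbitIdeal σ) R, orbitIdeal_eq_span,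
    Ideal.map_span, ← Set.image_comp, Set.image_eq_range]
  rfl

/-- If the germ of a character lies in an ideal generated by germs of characters, then it is a
multiple of one of them. -/
theorem exists_eq_add_of_germ_mem_span {T : Set (dualMonoid σ)} {s : dualMonoid σ}
    (h : germ R s ∈ Ideal.span (germ R '' T)) : ∃ t ∈ T, ∃ d : dualMonoid σ, s = d + t := by
  classical
  have h1 : germ R '' T = algebraMap (coordRing σ) R '' (AddMonoidAlgebra.of' ℂ (dualMonoid σ) '' T) := by
    rw [← Set.image_comp]
    rfl
  rw [h1, ← Ideal.map_span, germ,
    IsLocalization.algebraMap_mem_map_algebraMap_iff (orbitIdeal σ).primeCompl R] at h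
  obtain ⟨b, hb, hbs⟩ := h
  obtain ⟨e, he, hperp⟩ : ∃ e ∈ b.coeff.support, IsPerp σ e.1 := by
    by_contra! hcon
    exact hb (mem_ker_orbitHom_iff.2 hcon)
  rw [AddMonoidAlgebra.mem_ideal_span_of'_image] at hbs
  have hmem : e + s ∈ (b * AddMonoidAlgebra.single s 1).coeff.support := by
    rw [Finsupp.mem_support_iff, AddMonoidAlgebra.coeff_mul_single_eq_coeff_mul e, mul_one]
    · exact Finsupp.mem_support_iff.1 he
    · exact fun m' _ => add_left_inj s
  obtain ⟨t, ht, d, hd⟩ := hbs _ hmem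
  refine ⟨t, ht, ⟨-e.1, hperp.neg.mem_dualMonoid⟩ + d, Subtype.ext ?_⟩
  have h2 : e.1 + s.1 = d.1 + t.1 := congrArg Subtype.val hd
  change s.1 = -e.1 + d.1 + t.1
  rw [add_assoc, ← h2, neg_add_cancel_left]

/-- The semigroup of a cone is generated, up to units, by any of its elements whose germs generate
the maximal ideal. -/
theorem exists_eq_perp_add_sum [IsLocalRing R] {I : Type*} [Fintype I] (t : I → dualMonoid σ)
    (ht : Ideal.span (Set.range fun i => germ R (t i)) = maximalIdeal R)
    {v : Fin n → ℤ} (hv : ∀ m ∈ dualMonoid σ, 0 ≤ m ⬝ᵥ v ∧ (m ⬝ᵥ v = 0 ↔ IsPerp σ m))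
    (s : dualMonoid σ) : ∃ e : Fin n → ℤ, IsPerp σ e ∧ ∃ c : I → ℕ,
      s.1 = e + ∑ i, c i • (t i).1 := by
  classical
  obtain ⟨k, hk⟩ : ∃ k : ℕ, k = (s.1 ⬝ᵥ v).toNat := ⟨_, rfl⟩
  induction k using Nat.strong_induction_on generalizing s with
  | _ k ih =>
  by_cases hs : IsPerp σ s.1
  · exact ⟨s.1, hs, 0, by simp⟩
  · have h1 : germ R s ∈ Ideal.span (germ R '' Set.range t) := by
      rw [← Set.range_comp]
      change _ ∈ Ideal.span (Set.range fun i => germ R (t i))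
      rw [ht, ← maximalIdeal_eq_span_germ (σ := σ)]
      exact Ideal.subset_span ⟨⟨s, hs⟩, rfl⟩
    obtain ⟨_, ⟨i, rfl⟩, d, rfl⟩ := exists_eq_add_of_germ_mem_span h1
    have hti : ¬ IsPerp σ (t i).1 := fun h => by
      have h2 : germ R (t i) ∈ maximalIdeal R := ht ▸ Ideal.subset_span ⟨i, rfl⟩
      exact (mem_maximalIdeal _).1 h2 (isUnit_germ h)
    have h3 : 0 < (t i).1 ⬝ᵥ v :=
      lt_of_le_of_ne (hv _ (t i).2).1 fun h => hti ((hv _ (t i).2).2.1 h.symm)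
    have h4 := (hv _ d.2).1
    have h5 : (d + t i).1 ⬝ᵥ v = d.1 ⬝ᵥ v + (t i).1 ⬝ᵥ v := add_dotProduct _ _ _
    obtain ⟨e, he, c, hc⟩ := ih (d.1 ⬝ᵥ v).toNat (by omega) d rfl
    refine ⟨e, he, c + Pi.single i 1, ?_⟩
    change d.1 + (t i).1 = _
    rw [hc, add_assoc]
    congr 1
    simp only [Pi.add_apply, add_smul, Finset.sum_add_distrib]
    congr 1
    rw [Finset.sum_eq_single i]
    · simp
    · intro j _ hj
      simp [hj]
    · simp

/-- The exponents of a character in a regular system of parameters consisting of characters are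
unique. -/
theorem eq_of_perp_add_sum_eq [IsLocalRing R] [IsNoetherianRing R] {I : Type*} [Fintype I]
    {t : I → dualMonoid σ}
    (ht : Ideal.span (Set.range fun i => germ R (t i)) = maximalIdeal R)
    (hcard : (Fintype.card I : WithBot ℕ∞) = ringKrullDim R) {e e' : Fin n → ℤ} {z z' : I → ℤ}
    (he : IsPerp σ e) (he' : IsPerp σ e')
    (h : e + ∑ i, z i • (t i).1 = e' + ∑ i, z' i • (t i).1) : z = z' := by
  have := IsLocalization.isDomain_of_atPrime R (orbitIdeal σ)
  -- adding `k` to both systems of exponents makes them nonnegative, so that they are exponents of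
  -- monomials in the local ring
  let k : I → ℕ := fun i => (z i).natAbs + (z' i).natAbs
  have hk1 : ∀ i, 0 ≤ z i + k i := fun i => by
    have : (k i : ℤ) = (z i).natAbs + (z' i).natAbs := Nat.cast_add _ _
    omega
  have hk2 : ∀ i, 0 ≤ z' i + k i := fun i => by
    have : (k i : ℤ) = (z i).natAbs + (z' i).natAbs := Nat.cast_add _ _
    omega
  let α : (I → ℤ) → I → ℕ := fun y i => (y i + k i).toNat
  have hα : ∀ y : I → ℤ, (∀ i, 0 ≤ y i + k i) →
      ∑ i, α y i • (t i).1 = ∑ i, y i • (t i).1 + ∑ i, k i • (t i).1 := by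
    intro y hy
    rw [← Finset.sum_add_distrib]
    refine Finset.sum_congr rfl fun i _ => ?_
    rw [← natCast_zsmul, ← natCast_zsmul, ← add_smul, Int.toNat_of_nonneg (hy i)]
  have hval : ∀ y : I → ℕ, (∑ i, y i • t i : dualMonoid σ).1 = ∑ i, y i • (t i).1 := fun y =>
    map_sum (dualMonoid σ).subtype _ _
  have h1 : (⟨e, he.mem_dualMonoid⟩ + ∑ i, α z i • t i : dualMonoid σ) =
      ⟨e', he'.mem_dualMonoid⟩ + ∑ i, α z' i • t i := by
    refine Subtype.ext ?_
    change e + (∑ i, α z i • t i : dualMonoid σ).1 = e' + (∑ i, α z' i • t i : dualMonoid σ).1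
    rw [hval, hval, hα z fun i => hk1 i, hα z' fun i => hk2 i, ← add_assoc, ← add_assoc, h]
  have h2 := congrArg (germ R) h1
  rw [germ_add, germ_add, germ_sum, germ_sum] at h2
  simp only [germ_nsmul] at h2
  obtain ⟨w, hw⟩ := isUnit_germ (R := R) (s := ⟨e, he.mem_dualMonoid⟩) he
  have hu : IsUnit ((w⁻¹ : Rˣ) * germ R (⟨e', he'.mem_dualMonoid⟩ : dualMonoid σ)) :=
    (w⁻¹).isUnit.mul (isUnit_germ he')
  have h3 : ∏ i, germ R (t i) ^ α z i =
      ((w⁻¹ : Rˣ) * germ R (⟨e', he'.mem_dualMonoid⟩ : dualMonoid σ)) *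
        ∏ i, germ R (t i) ^ α z' i := by
    rw [mul_assoc, ← h2, ← hw, ← mul_assoc, Units.inv_mul, one_mul]
  have h4 := eq_of_monomial_relation (fun k hk => isUnit_natCast_of_algebra (coordRing σ) hk)
    (fun i => germ_ne_zero (t i)) ht hcard hu h3
  funext i
  have h5 := congrFun h4 i
  simp only [α] at h5
  have := hk1 i
  have := hk2 i
  omega

/-- A regular orbit of a cone gives elements `t i` of the dual semigroup and dual vectors `u i`. -/
theorem exists_dual_vectors [IsRegularLocalRing R] {v : Fin n → ℤ}
    (hv : ∀ m ∈ dualMonoid σ, 0 ≤ m ⬝ᵥ v ∧ (m ⬝ᵥ v = 0 ↔ IsPerp σ m))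
    (hdiff : ∀ m : Fin n → ℤ, ∃ w ∈ dualMonoid σ, m + w ∈ dualMonoid σ) :
    ∃ (I : Type) (_ : Fintype I) (_ : DecidableEq I) (t u : I → Fin n → ℤ),
      (∀ i, t i ∈ dualMonoid σ) ∧ (∀ i j, t i ⬝ᵥ u j = if i = j then 1 else 0) ∧
      (∀ m ∈ dualMonoid σ, ∀ i, 0 ≤ m ⬝ᵥ u i) ∧
      ∀ m, IsPerp σ (m - ∑ i, (m ⬝ᵥ u i) • t i) := by
  classical
  obtain ⟨J, hJ, hcard⟩ := exists_finset_span_eq_maximalIdeal _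
    (maximalIdeal_eq_span_germ (σ := σ) (R := R))
  let t : J → dualMonoid σ := fun i => i.1.1
  have ht : Ideal.span (Set.range fun i => germ R (t i)) = maximalIdeal R := by
    rw [← hJ, Set.image_eq_range]
    rfl
  have hcard' : (Fintype.card J : WithBot ℕ∞) = ringKrullDim R := by
    rw [← hcard, Fintype.card_coe]
  have hnat := exists_eq_perp_add_sum t ht hv
  -- the exponents of `m` are those of `m + w` minus those of `w`
  have hex : ∀ m : Fin n → ℤ, ∃ z : J → ℤ, IsPerp σ (m - ∑ i, z i • (t i).1) := by
    intro m
    obtain ⟨w, hw, hmw⟩ := hdiff m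
    obtain ⟨e, he, c, hc⟩ := hnat ⟨w, hw⟩
    obtain ⟨e', he', c', hc'⟩ := hnat ⟨m + w, hmw⟩
    refine ⟨fun i => c' i - c i, ?_⟩
    have h1 : m - ∑ i, ((c' i : ℤ) - c i) • (t i).1 = e' + -e := by
      simp only [sub_smul, Finset.sum_sub_distrib, natCast_zsmul]
      simp only at hc hc'
      have h2 : m = e' + ∑ i, c' i • (t i).1 - (e + ∑ i, c i • (t i).1) := by
        rw [← hc', ← hc, add_sub_cancel_right]
      rw [h2]
      abel
    rw [h1]
    exact he'.add he.neg
  choose z hz using hex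
  have huniq : ∀ m (y : J → ℤ), IsPerp σ (m - ∑ i, y i • (t i).1) → y = z m := by
    intro m y hy
    refine eq_of_perp_add_sum_eq ht hcard' hy (hz m) ?_
    rw [sub_add_cancel, sub_add_cancel]
  let ψ : (Fin n → ℤ) →+ (J → ℤ) :=
    { toFun := z
      map_zero' := (huniq 0 0 (by simpa using isPerp_zero)).symm
      map_add' := fun a b => (huniq _ _ (by
        have := (hz a).add (hz b)
        convert this using 1
        simp only [Pi.add_apply, add_smul, Finset.sum_add_distrib]
        abel)).symm }
  -- the exponents are additive in the character; the `i`-th one is the linear form of a vector `u i`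
  let u : J → Fin n → ℤ := fun i j => ψ (Pi.single j 1) i
  have hu : ∀ m i, m ⬝ᵥ u i = z m i := by
    intro m i
    have h1 : m = ∑ j, m j • (Pi.single j 1 : Fin n → ℤ) := by
      ext k
      simp [Finset.sum_apply, Pi.single_apply]
    have h2 : z m i = ψ m i := rfl
    rw [h2]
    conv_rhs => rw [h1, map_sum, Finset.sum_apply]
    simp only [map_zsmul, Pi.smul_apply, smul_eq_mul]
    rfl
  have hzt : ∀ i, z (t i).1 = Pi.single i 1 := fun i => (huniq _ _ (by
    rw [Finset.sum_eq_single i]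
    · simpa using isPerp_zero
    · intro j _ hj
      simp [hj]
    · simp)).symm
  let ε := Fintype.equivFin J
  refine ⟨Fin (Fintype.card J), inferInstance, inferInstance, fun i => (t (ε.symm i)).1,
    fun i => u (ε.symm i), fun i => (t _).2, fun i j => ?_, fun m hm i => ?_, fun m => ?_⟩
  · rw [hu, hzt, Pi.single_apply]
    simp [eq_comm]
  · obtain ⟨e, he, c, hc⟩ := hnat ⟨m, hm⟩
    have h1 : (fun i => (c i : ℤ)) = z m := huniq _ _ (by
      have h2 : m = e + ∑ i, c i • (t i).1 := hc
      simp only [natCast_zsmul]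
      rw [h2, add_sub_cancel_right]
      exact he)
    rw [hu, ← h1]
    exact Int.natCast_nonneg _
  · have h1 : ∑ i, (m ⬝ᵥ u (ε.symm i)) • (t (ε.symm i)).1 = ∑ i, z m i • (t i).1 := by
      simp only [hu]
      exact Equiv.sum_comp ε.symm fun i => z m i • (t i).1
    rw [h1]
    exact hz m

end RegularCone

section RegularConeGenerators

variable {n : ℕ} (F : Fan n)

/-- A cone whose orbit consists of regular points is generated by rays of the fan that are part of a
basis of the lattice. -/
theorem Fan.exists_dual_basis_of_regular (σ : F.cones)
    [IsRegularLocalRing (F.toricVariety.presheaf.stalk (F.orbitPoint σ))] :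
    ∃ (I : Type) (_ : Fintype I) (_ : DecidableEq I) (t u : I → Fin n → ℤ),
      (∀ i j, t i ⬝ᵥ u j = if i = j then 1 else 0) ∧
      Set.range u ⊆ F.rays ∧ σ.1 = coneHull (Set.range u) := by
  let _ : Algebra (coordRing σ.1) (F.toricVariety.presheaf.stalk (F.orbitPoint σ)) :=
    (chartToStalk (F.chart σ) (F.orbitPrime σ)).toAlgebra
  have : IsLocalization.AtPrime (F.toricVariety.presheaf.stalk (F.orbitPoint σ))
      (orbitIdeal σ.1) := isLocalization_chartToStalk (F.chart σ) (F.orbitPrime σ)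
  obtain ⟨v, hv⟩ := F.exists_height σ
  obtain ⟨I, _, _, t, u, ht, htu, hnn, hperp⟩ := exists_dual_vectors
    (R := F.toricVariety.presheaf.stalk (F.orbitPoint σ)) hv (F.exists_add_mem_dualMonoid σ)
  have hwit : ∀ j, ∃ w : Fin n → ℤ, w ⬝ᵥ u j = 0 ∧ ∀ u' ∈ Set.range u, u' ≠ u j → 0 < w ⬝ᵥ u' := by
    intro j
    have hsum : ∀ k, (∑ i ∈ Finset.univ.erase j, t i) ⬝ᵥ u k = if k = j then 0 else 1 := by
      intro k
      rw [sum_dotProduct]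
      simp only [htu, Finset.sum_ite_eq', Finset.mem_erase, Finset.mem_univ, and_true]
      by_cases h : k = j <;> simp [h]
    refine ⟨_, (hsum j).trans (if_pos rfl), ?_⟩
    rintro _ ⟨k, rfl⟩ hk
    rw [hsum, if_neg fun h => hk (congrArg u h)]
    exact one_pos
  have hσ : σ.1 = coneHull (Set.range u) := by
    obtain ⟨V, hV⟩ := F.rational σ.1 σ.2
    rw [hV]
    refine coneHull_eq_of_dual (fun v hv => ?_) (fun m hm => ?_) ?_
    · have hvσ : toReal v ∈ σ.1 := hV ▸ toReal_mem_coneHull hv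
      have h1 : v = ∑ i, (t i ⬝ᵥ v) • u i := by
        have key : ∀ m : Fin n → ℤ, m ⬝ᵥ v = m ⬝ᵥ ∑ i, (t i ⬝ᵥ v) • u i := by
          intro m
          have h2 := hperp m _ hvσ
          rw [toReal_dot, sub_dotProduct, sum_dotProduct] at h2
          have h3 : m ⬝ᵥ v - ∑ i, ((m ⬝ᵥ u i) • t i) ⬝ᵥ v = 0 := by exact_mod_cast h2
          rw [sub_eq_zero.1 h3, dotProduct_sum]
          refine Finset.sum_congr rfl fun i _ => ?_
          rw [smul_dotProduct, dotProduct_smul, smul_eq_mul, smul_eq_mul, mul_comm]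
        ext i
        simpa using key (Pi.single i 1)
      have h2 : toReal v = ∑ i, toReal ((t i ⬝ᵥ v) • u i) := by
        conv_lhs => rw [h1]
        exact map_sum (⟨⟨toReal, toReal_zero⟩, toReal_add⟩ : (Fin n → ℤ) →+ (Fin n → ℝ)) _ _
      rw [h2]
      exact Submodule.sum_mem _ fun i _ =>
        smul_toReal_mem_coneHull (Set.mem_range_self i) (dot_nonneg_of_mem (ht i) hvσ)
    · rintro _ ⟨i, rfl⟩
      exact hnn m (hV ▸ hm) i
    · rintro _ ⟨j, rfl⟩
      refine ⟨fun h => ?_, hwit j⟩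
      have h1 := htu j j
      rw [if_pos rfl, h, dotProduct_zero] at h1
      exact zero_ne_one h1
  refine ⟨I, inferInstance, inferInstance, t, u, htu, ?_, hσ⟩
  rintro _ ⟨j, rfl⟩
  obtain ⟨w, hw0, hw⟩ := hwit j
  exact F.mem_rays_of_exposed hσ (Set.mem_range_self j) ((htu j j).trans (if_pos rfl)) hw0 hw

end RegularConeGenerators

/-! ### Characters at an ordinary double point -/

section NodalCone

open IsLocalRing

variable {n : ℕ} {σ : PointedCone ℝ (Fin n → ℝ)}

theorem orbitHom_single_of_isPerp {w : dualMonoid σ} (hw : IsPerp σ w.1) (c : ℂ) :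
    Fan.orbitHom σ (AddMonoidAlgebra.single w c) = AddMonoidAlgebra.single w.1 c := by
  classical
  rw [Fan.orbitHom, AddMonoidAlgebra.lift_single]
  change c • (if IsPerp σ w.1 then AddMonoidAlgebra.single w.1 (1 : ℂ) else 0) = _
  rw [if_pos hw]
  simp

variable {R : Type*} [CommRing R] [IsLocalRing R] [Algebra (coordRing σ) R]
  [IsLocalization.AtPrime R (orbitIdeal σ)]

theorem algebraMap_mem_maximalIdeal_iff {a : coordRing σ} :
    algebraMap (coordRing σ) R a ∈ maximalIdeal R ↔ a ∈ orbitIdeal σ := by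
  have h := IsLocalization.AtPrime.under_maximalIdeal R (orbitIdeal σ)
  rw [← h]
  rfl

/-- If the residue field at the orbit of `σ` is `ℂ`, then `σ` has full dimension: the germ of a
character that is invertible at the orbit has roots of all orders modulo the maximal ideal, which
is impossible for a nontrivial character of the orbit. -/
theorem eq_zero_of_isPerp {c : R →+* ℂ} (hc : Function.Surjective c)
    (hc0 : ∀ r, c r = 0 ↔ r ∈ maximalIdeal R) {m : Fin n → ℤ} (hm : IsPerp σ m) : m = 0 := by
  by_contra hm0
  have hpos : 0 < m ⬝ᵥ m := by
    obtain ⟨i, hi⟩ := Function.ne_iff.1 hm0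
    exact Finset.sum_pos' (fun j _ => mul_self_nonneg (m j))
      ⟨i, Finset.mem_univ i, mul_self_pos.2 hi⟩
  let s : dualMonoid σ := ⟨m, hm.mem_dualMonoid⟩
  let K : ℕ := (m ⬝ᵥ m).toNat + 1
  obtain ⟨y, hy⟩ := IsAlgClosed.exists_pow_nat_eq (c (germ R s)) (Nat.succ_pos (m ⬝ᵥ m).toNat)
  obtain ⟨r, rfl⟩ := hc y
  obtain ⟨⟨a, b⟩, hab⟩ := IsLocalization.surj (orbitIdeal σ).primeCompl r
  have h1 : a ^ K - AddMonoidAlgebra.single s 1 * b.1 ^ K ∈ orbitIdeal σ := by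
    rw [← algebraMap_mem_maximalIdeal_iff (R := R), ← hc0]
    have h2 : algebraMap (coordRing σ) R (a ^ K - AddMonoidAlgebra.single s 1 * b.1 ^ K) =
        (r ^ K - germ R s) * algebraMap (coordRing σ) R b.1 ^ K := by
      rw [map_sub, map_mul, map_pow, map_pow, ← hab, mul_pow, sub_mul]
      rfl
    rw [h2, map_mul, map_sub, map_pow, hy, sub_self, zero_mul]
  have h2 : Fan.orbitHom σ a ^ K = AddMonoidAlgebra.single m 1 * Fan.orbitHom σ b.1 ^ K := by
    have h3 := RingHom.mem_ker.1 h1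
    rw [map_sub, map_mul, map_pow, map_pow, orbitHom_single_of_isPerp hm, sub_eq_zero] at h3
    exact h3
  have hb0 : Fan.orbitHom σ b.1 ≠ 0 := fun h => b.2 (RingHom.mem_ker.2 h)
  obtain ⟨l, hl⟩ := exists_hasOrder m hb0
  have h3 := (hasOrder_single m m (one_ne_zero (α := ℂ))).mul (hl.pow K)
  rw [← h2] at h3
  have ha0 : Fan.orbitHom σ a ≠ 0 := fun h => h3.ne_zero (by rw [h, zero_pow (Nat.succ_ne_zero _)])
  obtain ⟨k, hk⟩ := exists_hasOrder m ha0
  have h4 := (hk.pow K).unique h3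
  have hK : (K : ℤ) = m ⬝ᵥ m + 1 := by
    simp only [K]
    omega
  have h5 : (K : ℤ) ∣ m ⬝ᵥ m := ⟨k - l, by linarith⟩
  have h6 := Int.le_of_dvd hpos h5
  omega

/-- The exponents of an element of a product of ideals are sums of exponents that occur in the
factors. -/
theorem exists_add_of_mem_mul {P Q : dualMonoid σ → Prop} {I J : Ideal (coordRing σ)}
    (hI : ∀ x ∈ I, ∀ m ∈ x.coeff.support, P m) (hJ : ∀ x ∈ J, ∀ m ∈ x.coeff.support, Q m)
    {x : coordRing σ} (hx : x ∈ I * J) :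
    ∀ m ∈ x.coeff.support, ∃ s t, P s ∧ Q t ∧ m = s + t := by
  classical
  induction hx using Submodule.mul_induction_on' with
  | mem_mul_mem a ha b hb =>
    intro m hm
    obtain ⟨s, hs, t, ht, rfl⟩ := Finset.mem_add.1 (AddMonoidAlgebra.support_coeff_mul_subset a b hm)
    exact ⟨s, t, hI a ha s hs, hJ b hb t ht, rfl⟩
  | add a _ b _ iha ihb =>
    intro m hm
    rcases Finset.mem_union.1 (Finsupp.support_add hm) with h | h
    · exact iha m h
    · exact ihb m h

/-- The nonzero elements of the semigroup of a cone that are not sums of two nonzero elements. -/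
def irreducibles (σ : PointedCone ℝ (Fin n → ℝ)) : Set (dualMonoid σ) :=
  {s | s ≠ 0 ∧ ∀ t r, t ≠ 0 → r ≠ 0 → s ≠ t + r}

/-- The semigroup of a cone of full dimension is generated by its irreducible elements. -/
theorem mem_closure_irreducibles (hperp : ∀ m : Fin n → ℤ, IsPerp σ m → m = 0) {v : Fin n → ℤ}
    (hv : ∀ m ∈ dualMonoid σ, 0 ≤ m ⬝ᵥ v ∧ (m ⬝ᵥ v = 0 ↔ IsPerp σ m)) (s : dualMonoid σ) :
    s ∈ AddSubmonoid.closure (irreducibles σ) := by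
  have hpos : ∀ t : dualMonoid σ, t ≠ 0 → 0 < t.1 ⬝ᵥ v := fun t ht =>
    lt_of_le_of_ne (hv _ t.2).1 fun h =>
      ht (Subtype.ext (hperp _ ((hv _ t.2).2.1 h.symm)))
  obtain ⟨k, hk⟩ : ∃ k : ℕ, k = (s.1 ⬝ᵥ v).toNat := ⟨_, rfl⟩
  induction k using Nat.strong_induction_on generalizing s with
  | _ k ih =>
  by_cases hs0 : s = 0
  · rw [hs0]
    exact zero_mem _
  by_cases hs : s ∈ irreducibles σ
  · exact AddSubmonoid.subset_closure hs
  · have h1 : ∃ t r : dualMonoid σ, t ≠ 0 ∧ r ≠ 0 ∧ s = t + r := by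
      by_contra! hcon
      exact hs ⟨hs0, hcon⟩
    obtain ⟨t, r, ht, hr, rfl⟩ := h1
    have h2 : (t + r).1 ⬝ᵥ v = t.1 ⬝ᵥ v + r.1 ⬝ᵥ v := add_dotProduct _ _ _
    have h3 := hpos t ht
    have h4 := hpos r hr
    exact add_mem (ih _ (by omega) t rfl) (ih _ (by omega) r rfl)

section FullDimension

variable (hperp : ∀ m : Fin n → ℤ, IsPerp σ m → m = 0)
include hperp

theorem mem_orbitIdeal_iff {a : coordRing σ} :
    a ∈ orbitIdeal σ ↔ ∀ m ∈ a.coeff.support, m ≠ 0 := by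
  refine mem_ker_orbitHom_iff.trans (forall₂_congr fun m _ => not_congr ⟨fun h => ?_, ?_⟩)
  · exact Subtype.ext (hperp _ h)
  · rintro rfl
    exact isPerp_zero

theorem single_mem_orbitIdeal {s : dualMonoid σ} (hs : s ≠ 0) (c : ℂ) :
    AddMonoidAlgebra.single s c ∈ orbitIdeal σ := by
  rw [mem_orbitIdeal_iff hperp]
  intro m hm
  have := Finsupp.support_single_subset hm
  rw [Finset.mem_singleton] at this
  rwa [this]

theorem exists_add_of_mem_sq {x : coordRing σ} (hx : x ∈ orbitIdeal σ ^ 2) :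
    ∀ m ∈ x.coeff.support, ∃ s t : dualMonoid σ, s ≠ 0 ∧ t ≠ 0 ∧ m = s + t := by
  rw [pow_two] at hx
  exact exists_add_of_mem_mul (fun _ h => (mem_orbitIdeal_iff hperp).1 h)
    (fun _ h => (mem_orbitIdeal_iff hperp).1 h) hx

/-- The cube of the ideal of the fixed point is a monomial ideal: it contains the monomials of its
elements. -/
theorem single_mem_of_mem_cube {x : coordRing σ} (hx : x ∈ orbitIdeal σ ^ 3) :
    ∀ m ∈ x.coeff.support, AddMonoidAlgebra.single m (1 : ℂ) ∈ orbitIdeal σ ^ 3 := by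
  intro m hm
  rw [pow_succ, pow_two] at hx ⊢
  have h1 := fun x (h : x ∈ orbitIdeal σ) => (mem_orbitIdeal_iff hperp).1 h
  obtain ⟨s, t, ⟨r, q, hr, hq, rfl⟩, ht, rfl⟩ :=
    exists_add_of_mem_mul (fun x h => exists_add_of_mem_mul h1 h1 h) h1 hx m hm
  have h2 : (AddMonoidAlgebra.single (r + q + t) (1 : ℂ) : coordRing σ) =
      AddMonoidAlgebra.single r 1 * AddMonoidAlgebra.single q 1 * AddMonoidAlgebra.single t 1 := by
    simp only [AddMonoidAlgebra.single_mul_single, mul_one]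
  rw [h2]
  exact Ideal.mul_mem_mul (Ideal.mul_mem_mul (single_mem_orbitIdeal hperp hr 1)
    (single_mem_orbitIdeal hperp hq 1)) (single_mem_orbitIdeal hperp ht 1)

theorem sub_single_zero_mem_orbitIdeal (a : coordRing σ) :
    a - AddMonoidAlgebra.single 0 (a.coeff 0) ∈ orbitIdeal σ := by
  rw [mem_orbitIdeal_iff hperp]
  rintro m hm rfl
  simp at hm

/-- The orbit of a cone of full dimension is a fixed point, and its ideal is maximal. -/
theorem isMaximal_orbitIdeal : (orbitIdeal σ).IsMaximal := by
  refine Ideal.isMaximal_iff.2 ⟨fun h => Ideal.IsPrime.ne_top inferInstance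
    ((Ideal.eq_top_iff_one _).2 h), fun J a hJ ha haJ => ?_⟩
  have h0 : a.coeff 0 ≠ 0 := by
    intro h
    have := sub_single_zero_mem_orbitIdeal hperp a
    rw [h, AddMonoidAlgebra.single_zero, sub_zero] at this
    exact ha this
  have h1 := J.sub_mem haJ (hJ (sub_single_zero_mem_orbitIdeal hperp a))
  rw [sub_sub_cancel] at h1
  have h2 := J.mul_mem_left (AddMonoidAlgebra.single 0 (a.coeff 0)⁻¹) h1
  rwa [AddMonoidAlgebra.single_mul_single, inv_mul_cancel₀ h0, add_zero,
    ← AddMonoidAlgebra.one_def] at h2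

/-- Because the ideal of the fixed point is maximal, its powers agree with the powers of the maximal
ideal of the local ring. -/
theorem algebraMap_mem_maximalIdeal_pow_iff {a : coordRing σ} (k : ℕ) :
    algebraMap (coordRing σ) R a ∈ maximalIdeal R ^ k ↔ a ∈ orbitIdeal σ ^ k := by
  have := isMaximal_orbitIdeal hperp
  rw [← IsLocalization.AtPrime.under_maximalIdeal_pow (orbitIdeal σ) R k]
  rfl

end FullDimension

end NodalCone

section NodalRelations

open IsLocalRing

variable {n : ℕ} {σ : PointedCone ℝ (Fin n → ℝ)}
  {R : Type*} [CommRing R] [IsLocalRing R] [Algebra (coordRing σ) R]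
  [IsLocalization.AtPrime R (orbitIdeal σ)]

/-- The quadratic relations among the irreducible characters at an ordinary double point: there are
four irreducible characters, there is a nontrivial quadratic relation among them modulo the cube of
the maximal ideal, and each such relation is nondegenerate. -/
theorem exists_quadratic_relations [IsNoetherianRing R] (h : IsOrdinaryDoublePoint R)
    (hperp : ∀ m : Fin n → ℤ, IsPerp σ m → m = 0) :
    ∃ e : Fin 4 ≃ irreducibles σ,
      (∃ W : Matrix (Fin 4) (Fin 4) ℂ, W ≠ 0 ∧ (∀ i j, W i j = W j i) ∧
        ∑ i, ∑ j, AddMonoidAlgebra.single ((e i).1 + (e j).1) (W i j) ∈ orbitIdeal σ ^ 3) ∧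
      ∀ W : Matrix (Fin 4) (Fin 4) ℂ,
        ∑ i, ∑ j, AddMonoidAlgebra.single ((e i).1 + (e j).1) (W i j) ∈ orbitIdeal σ ^ 3 →
        ∀ i₀, (∀ j, W i₀ j + W j i₀ = 0) → ∀ i j, W i j + W j i = 0 := by
  classical
  obtain ⟨c, l, hc, hc0, hl, hlsurj, hlsq, hquad⟩ := h.exists_differential
  -- the isomorphism with the completed local ring of the standard node is one of rings and need not
  -- be linear over `ℂ`: the constants act on the cotangent space through the endomorphism `τ`
  let τ : ℂ →+* ℂ := c.comp ((algebraMap (coordRing σ) R).comp AddMonoidAlgebra.singleZeroRingHom)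
  have hcp : ∀ a ∈ orbitIdeal σ, c (algebraMap (coordRing σ) R a) = 0 := fun a ha =>
    (hc0 _).2 (algebraMap_mem_maximalIdeal_iff.2 ha)
  have hcτ : ∀ a : coordRing σ, c (algebraMap (coordRing σ) R a) = τ (a.coeff 0) := by
    intro a
    have h1 := hcp _ (sub_single_zero_mem_orbitIdeal hperp a)
    rw [map_sub, map_sub, sub_eq_zero] at h1
    exact h1
  have hc_germ : ∀ s : dualMonoid σ, s ≠ 0 → c (germ R s) = 0 := fun s hs =>
    hcp _ (single_mem_orbitIdeal hperp hs 1)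
  have hsingle : ∀ (s : dualMonoid σ) (z : ℂ), algebraMap (coordRing σ) R (.single s z) =
      algebraMap (coordRing σ) R (.single 0 z) * germ R s := fun s z => by
    rw [germ, ← map_mul, AddMonoidAlgebra.single_mul_single, zero_add, mul_one]
  have hl_single : ∀ (s : dualMonoid σ) (z : ℂ), s ≠ 0 →
      l (algebraMap (coordRing σ) R (.single s z)) = τ z • l (germ R s) := fun s z hs => by
    rw [hsingle, hl, hc_germ s hs, zero_smul, add_zero]
    rfl
  have hτsurj : Function.Surjective τ := by
    intro y
    obtain ⟨r, rfl⟩ := hc y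
    obtain ⟨⟨a, b⟩, hab⟩ := IsLocalization.surj (orbitIdeal σ).primeCompl r
    have h1 := congrArg c hab
    rw [map_mul, hcτ, hcτ] at h1
    have h2 : τ (b.1.coeff 0) ≠ 0 := by
      rw [← hcτ, Ne, hc0, algebraMap_mem_maximalIdeal_iff]
      exact b.2
    refine ⟨a.coeff 0 / b.1.coeff 0, ?_⟩
    rw [map_div₀, ← h1, mul_div_cancel_right₀ _ h2]
  -- the differentials of the irreducible characters form a basis of the cotangent space
  let P : irreducibles σ → Fin 4 → ℂ := fun s => l (germ R s.1)
  have hli : LinearIndependent ℂ P := by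
    rw [linearIndependent_iff']
    intro I g hg i hi
    choose z hz using fun k => hτsurj (g k)
    let a : coordRing σ := ∑ k ∈ I, AddMonoidAlgebra.single k.1 (z k)
    have ha : a ∈ orbitIdeal σ := Ideal.sum_mem _ fun k _ => single_mem_orbitIdeal hperp k.2.1 _
    have h1 : l (algebraMap (coordRing σ) R a) = 0 := by
      rw [map_sum, map_sum, ← hg]
      refine Finset.sum_congr rfl fun k _ => ?_
      rw [hl_single _ _ k.2.1, hz]
    rw [hlsq _ (algebraMap_mem_maximalIdeal_iff.2 ha),
      algebraMap_mem_maximalIdeal_pow_iff hperp] at h1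
    have h2 : a.coeff i.1 = z i := by
      simp only [a, AddMonoidAlgebra.coeff_sum, Finsupp.finsetSum_apply,
        AddMonoidAlgebra.coeff_single, Finsupp.single_apply, Subtype.ext_iff.symm]
      simp [hi]
    by_contra hgi
    have h3 : i.1 ∈ a.coeff.support := by
      rw [Finsupp.mem_support_iff, h2]
      intro h0
      rw [← hz, h0, map_zero] at hgi
      exact hgi rfl
    obtain ⟨s, t, hs, ht, hst⟩ := exists_add_of_mem_sq hperp h1 _ h3
    exact i.2.2 s t hs ht hst
  have hspan : ⊤ ≤ Submodule.span ℂ (Set.range P) := by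
    rintro v -
    obtain ⟨r, hr, rfl⟩ := hlsurj v
    obtain ⟨⟨a, b⟩, hab⟩ := IsLocalization.surj (orbitIdeal σ).primeCompl r
    have hb : c (algebraMap (coordRing σ) R b.1) ≠ 0 := by
      rw [Ne, hc0, algebraMap_mem_maximalIdeal_iff]
      exact b.2
    have h1 : c (algebraMap (coordRing σ) R b.1) • l r = l (algebraMap (coordRing σ) R a) := by
      rw [← hab, hl, (hc0 r).2 hr, zero_smul, zero_add]
    have ha : a ∈ orbitIdeal σ := by
      rw [← algebraMap_mem_maximalIdeal_iff (R := R), ← hab]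
      exact Ideal.mul_mem_right _ _ hr
    rw [← Submodule.smul_mem_iff _ hb, h1, ← a.sum_coeff_single]
    change l (algebraMap _ R (∑ s ∈ a.coeff.support, AddMonoidAlgebra.single s (a.coeff s))) ∈ _
    rw [map_sum, map_sum]
    refine Submodule.sum_mem _ fun s hs => ?_
    have hs0 := (mem_orbitIdeal_iff hperp).1 ha s hs
    rw [hl_single _ _ hs0]
    refine Submodule.smul_mem _ _ ?_
    by_cases hirr : s ∈ irreducibles σ
    · exact Submodule.subset_span ⟨⟨s, hirr⟩, rfl⟩
    · have h2 : ∃ t r : dualMonoid σ, t ≠ 0 ∧ r ≠ 0 ∧ s = t + r := by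
        by_contra! hcon
        exact hirr ⟨hs0, hcon⟩
      obtain ⟨t, r, ht, hr, rfl⟩ := h2
      rw [germ_add, hl, hc_germ t ht, hc_germ r hr, zero_smul, zero_smul, add_zero]
      exact zero_mem _
  let e : Fin 4 ≃ irreducibles σ :=
    (Pi.basisFun ℂ (Fin 4)).indexEquiv (Module.Basis.mk hli hspan)
  let Q : Matrix (Fin 4) (Fin 4) ℂ := Matrix.of fun i => P (e i)
  have hQ : IsUnit Q := by
    rw [← Matrix.linearIndependent_rows_iff_isUnit]
    exact hli.comp e e.injective
  have hQdet : IsUnit Q.det := (Matrix.isUnit_iff_isUnit_det Q).1 hQ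
  -- in the basis of the irreducible characters the quadratic form of `W` is a multiple of the
  -- equation of the node
  have hrel : ∀ W : Matrix (Fin 4) (Fin 4) ℂ,
      (∑ i, ∑ j, AddMonoidAlgebra.single ((e i).1 + (e j).1) (W i j) ∈ orbitIdeal σ ^ 3 ↔
        ∃ t : ℂ, Q.transpose * (W.map τ + (W.map τ).transpose) * Q = t • 1) := by
    intro W
    have h1 : algebraMap (coordRing σ) R
        (∑ i, ∑ j, AddMonoidAlgebra.single ((e i).1 + (e j).1) (W i j)) =
        ∑ x : Fin 4 × Fin 4, algebraMap (coordRing σ) R (.single (e x.1).1 (W x.1 x.2)) *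
          germ R (e x.2).1 := by
      rw [Fintype.sum_prod_type, map_sum]
      refine Finset.sum_congr rfl fun i _ => ?_
      rw [map_sum]
      refine Finset.sum_congr rfl fun j _ => ?_
      rw [germ, ← map_mul, AddMonoidAlgebra.single_mul_single, mul_one]
    rw [← algebraMap_mem_maximalIdeal_pow_iff (R := R) hperp, h1, hquad]
    · refine exists_congr fun t => ?_
      rw [← Matrix.ext_iff]
      refine forall₂_congr fun a b => ?_
      have h2 : ∑ x : Fin 4 × Fin 4,
          (l (algebraMap (coordRing σ) R (.single (e x.1).1 (W x.1 x.2))) a * l (germ R (e x.2).1) b +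
            l (algebraMap (coordRing σ) R (.single (e x.1).1 (W x.1 x.2))) b * l (germ R (e x.2).1) a) =
          (Q.transpose * (W.map τ + (W.map τ).transpose) * Q) a b := by
        have h3 : ∀ i j : Fin 4, ∀ a, l (algebraMap (coordRing σ) R (.single (e i).1 (W i j))) a =
            τ (W i j) * Q i a := fun i j a => by
          rw [hl_single _ _ (e i).2.1]
          rfl
        have h4 : ∀ j : Fin 4, ∀ a, l (germ R (e j).1) a = Q j a := fun _ _ => rfl
        simp only [h3, h4]
        rw [Finset.sum_add_distrib, Matrix.mul_add, Matrix.add_mul, Matrix.add_apply]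
        congr 1
        · rw [Fintype.sum_prod_type_right]
          simp only [Matrix.mul_apply, Matrix.transpose_apply, Matrix.map_apply, Finset.sum_mul]
          exact Finset.sum_congr rfl fun j _ => Finset.sum_congr rfl fun i _ => by ring
        · rw [Fintype.sum_prod_type]
          simp only [Matrix.mul_apply, Matrix.transpose_apply, Matrix.map_apply, Finset.sum_mul]
          exact Finset.sum_congr rfl fun j _ => Finset.sum_congr rfl fun i _ => by ring
      rw [h2, Matrix.smul_apply, Matrix.one_apply, smul_ite, smul_zero, smul_eq_mul, mul_one]
    · exact fun x _ => algebraMap_mem_maximalIdeal_iff.2 (single_mem_orbitIdeal hperp (e x.1).2.1 _)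
    · exact fun x _ => algebraMap_mem_maximalIdeal_iff.2 (single_mem_orbitIdeal hperp (e x.2).2.1 _)
  refine ⟨e, ?_, fun W hW i₀ hi₀ => ?_⟩
  · -- the equation of the node itself, written in the irreducible characters
    let Z : Matrix (Fin 4) (Fin 4) ℂ := (Q⁻¹).transpose * Q⁻¹
    have hZ : Z.transpose = Z := by
      rw [Matrix.transpose_mul, Matrix.transpose_transpose]
    choose W hW using fun i j => hτsurj (Z i j)
    have hWZ : (Matrix.of W).map τ = Z := by
      ext i j
      exact hW i j
    have hQZ : Q.transpose * Z * Q = 1 := by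
      rw [← Matrix.mul_assoc, ← Matrix.transpose_mul, Matrix.mul_assoc,
        Matrix.nonsing_inv_mul _ hQdet, Matrix.transpose_one, Matrix.one_mul]
    refine ⟨Matrix.of W, fun h0 => ?_, fun i j => ?_, (hrel _).2 ⟨2, ?_⟩⟩
    · rw [h0] at hWZ
      rw [← hWZ] at hQZ
      simp at hQZ
    · apply τ.injective
      change τ (W i j) = τ (W j i)
      rw [hW, hW]
      exact congrFun (congrFun hZ j) i
    · rw [hWZ, hZ, Matrix.mul_add, Matrix.add_mul, hQZ, two_smul]
  · obtain ⟨t, ht⟩ := (hrel W).1 hW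
    -- a multiple of the equation of the node is nondegenerate unless it is zero
    have h1 : (W.map τ + (W.map τ).transpose).det = 0 := by
      refine Matrix.det_eq_zero_of_row_eq_zero i₀ fun j => ?_
      rw [Matrix.add_apply, Matrix.transpose_apply, Matrix.map_apply, Matrix.map_apply, ← map_add,
        hi₀, map_zero]
    have h2 := congrArg Matrix.det ht
    rw [Matrix.det_mul, Matrix.det_mul, h1, mul_zero, zero_mul, Matrix.det_smul, Matrix.det_one,
      mul_one] at h2
    have ht0 : t = 0 := by
      by_contra hne
      exact pow_ne_zero _ hne h2.symm
    rw [ht0, zero_smul] at ht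
    have h3 : W.map τ + (W.map τ).transpose = 0 := by
      have hQT : IsUnit Q.transpose := (Matrix.isUnit_transpose Q).2 hQ
      exact (hQT.mul_right_eq_zero).1 ((hQ.mul_left_eq_zero).1 ht)
    intro i j
    have h4 := congrFun (congrFun h3 i) j
    rw [Matrix.add_apply, Matrix.transpose_apply, Matrix.map_apply, Matrix.map_apply, ← map_add,
      Matrix.zero_apply, map_eq_zero] at h4
    exact h4

/-- The semigroup of the cone of an ordinary double point is generated by four elements with one
relation `a + b = c + d`. -/
theorem exists_generators_of_isOrdinaryDoublePoint [IsNoetherianRing R]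
    (h : IsOrdinaryDoublePoint R) {v : Fin n → ℤ}
    (hv : ∀ m ∈ dualMonoid σ, 0 ≤ m ⬝ᵥ v ∧ (m ⬝ᵥ v = 0 ↔ IsPerp σ m)) :
    ∃ a b c d : Fin n → ℤ, a + b = c + d ∧
      dualMonoid σ = AddSubmonoid.closure {a, b, c, d} := by
  classical
  have hperp : ∀ m : Fin n → ℤ, IsPerp σ m → m = 0 := by
    obtain ⟨c, -, hc, hc0, -⟩ := h.exists_differential
    exact fun m hm => eq_zero_of_isPerp hc hc0 hm
  obtain ⟨e, ⟨W, hW0, hWs, hW⟩, hrel⟩ := exists_quadratic_relations h hperp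
  obtain ⟨i, j, hij⟩ : ∃ i j, W i j ≠ 0 := by
    by_contra! hcon
    exact hW0 (Matrix.ext hcon)
  have hsum : ∀ W : Matrix (Fin 4) (Fin 4) ℂ, ∀ m,
      (∑ i, ∑ j, AddMonoidAlgebra.single ((e i).1 + (e j).1) (W i j) : coordRing σ).coeff m =
        ∑ i, ∑ j, if (e i).1 + (e j).1 = m then W i j else 0 := fun W m => by
    simp only [AddMonoidAlgebra.coeff_sum, Finsupp.finsetSum_apply,
      AddMonoidAlgebra.coeff_single, Finsupp.single_apply]
  have hsingle : ∀ i j : Fin 4, ∑ i', ∑ j', AddMonoidAlgebra.single ((e i').1 + (e j').1)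
      (Matrix.single i j (1 : ℂ) i' j') = (AddMonoidAlgebra.single ((e i).1 + (e j).1) 1 :
        coordRing σ) := by
    intro i j
    rw [Finset.sum_eq_single i, Finset.sum_eq_single j]
    · simp
    · intro b _ hb
      simp [hb.symm]
    · simp
    · intro b _ hb
      refine Finset.sum_eq_zero fun b' _ => ?_
      simp [hb.symm]
    · simp
  -- the monomials of the product of `e i` and `e j` have to cancel with those of another product
  obtain ⟨k, l, hkl, h1, h2⟩ : ∃ k l, (e k).1 + (e l).1 = (e i).1 + (e j).1 ∧
      ¬ (k = i ∧ l = j) ∧ ¬ (k = j ∧ l = i) := by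
    by_contra! hcon
    have hcoeff : (∑ i, ∑ j, AddMonoidAlgebra.single ((e i).1 + (e j).1) (W i j) :
        coordRing σ).coeff ((e i).1 + (e j).1) ≠ 0 := by
      have h1 : ∀ k l, (if (e k).1 + (e l).1 = (e i).1 + (e j).1 then W k l else 0) =
          if (k = i ∧ l = j) ∨ (k = j ∧ l = i) then W i j else 0 := by
        intro k l
        by_cases hk : (e k).1 + (e l).1 = (e i).1 + (e j).1
        · have h2 : (k = i ∧ l = j) ∨ (k = j ∧ l = i) := by
            by_cases h3 : k = i ∧ l = j
            · exact Or.inl h3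
            · exact Or.inr ⟨by_contra fun h4 => by have := hcon k l hk; tauto,
                by_contra fun h4 => by have := hcon k l hk; tauto⟩
          rw [if_pos hk, if_pos h2]
          rcases h2 with ⟨rfl, rfl⟩ | ⟨rfl, rfl⟩
          · rfl
          · exact hWs _ _
        · rw [if_neg hk, if_neg]
          rintro (⟨rfl, rfl⟩ | ⟨rfl, rfl⟩)
          · exact hk rfl
          · exact hk (add_comm _ _)
      rw [hsum]
      simp only [h1]
      rw [← Fintype.sum_prod_type' (f := fun k l =>
        if (k = i ∧ l = j) ∨ (k = j ∧ l = i) then W i j else 0), ← Finset.sum_filter,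
        Finset.sum_const, nsmul_eq_mul]
      refine mul_ne_zero (Nat.cast_ne_zero.2 (Finset.card_ne_zero_of_mem (a := (i, j)) ?_)) hij
      simp
    -- otherwise this product alone is in the cube of the ideal, which is a degenerate relation
    have h1 := single_mem_of_mem_cube hperp hW _ (Finsupp.mem_support_iff.2 hcoeff)
    obtain ⟨i₀, hi₀⟩ := (by decide : ∀ i j : Fin 4, ∃ i₀, i₀ ≠ i ∧ i₀ ≠ j) i j
    have h2 := hrel (Matrix.single i j 1) (by rw [hsingle]; exact h1) i₀ (fun j' => by simp [hi₀.1.symm, hi₀.2.symm]) i j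
    rw [Matrix.single_apply_same, Matrix.single_apply] at h2
    split_ifs at h2 <;> norm_num at h2
  -- the relation is nondegenerate, so that it involves all four characters
  have hall : ∀ i₀, i₀ = i ∨ i₀ = j ∨ i₀ = k ∨ i₀ = l := by
    by_contra! hcon
    obtain ⟨i₀, hi, hj, hk, hl⟩ := hcon
    have h3 := hrel (Matrix.single i j 1 - Matrix.single k l 1) (by
      simp only [Matrix.sub_apply, AddMonoidAlgebra.single_sub, Finset.sum_sub_distrib, hsingle, hkl,
        sub_self]
      exact zero_mem _) i₀ (fun j' => by
        simp [hi.symm, hj.symm, hk.symm, hl.symm]) i j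
    simp only [Matrix.sub_apply, Matrix.single_apply, and_self, if_true, if_neg h1] at h3
    rw [if_neg h2] at h3
    split_ifs at h3 <;> norm_num at h3
  refine ⟨(e i).1.1, (e j).1.1, (e k).1.1, (e l).1.1, (congrArg Subtype.val hkl).symm,
    le_antisymm (fun s hs => ?_) ?_⟩
  · have h3 := mem_closure_irreducibles hperp hv ⟨s, hs⟩
    have h4 : s ∈ (AddSubmonoid.closure (irreducibles σ)).map (dualMonoid σ).subtype :=
      ⟨_, h3, rfl⟩
    rw [AddMonoidHom.map_mclosure] at h4
    refine AddSubmonoid.closure_mono ?_ h4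
    rintro _ ⟨t, ht, rfl⟩
    obtain ⟨i₀, hi₀⟩ := e.surjective ⟨t, ht⟩
    have h5 : (dualMonoid σ).subtype t = (e i₀).1.1 := by
      rw [hi₀]
      rfl
    rw [h5]
    rcases hall i₀ with rfl | rfl | rfl | rfl <;> simp
  · rw [AddSubmonoid.closure_le]
    rintro _ (rfl | rfl | rfl | rfl) <;> exact Subtype.property _

end NodalRelations

/-! ### The cone over a quadrangle -/

section QuadrangleCone

/-- The dual generators of the cone over a unit square: the vectors `A`, `B`, `C`, `D` are dual to
the generators `a`, `b`, `c`, `d` of the dual semigroup, where `a`, `c`, `b`, `d` cut out the faces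
`AB`, `BC`, `CD`, `DA`. -/
structure IsSquare (a b c d A B C D : Fin 3 → ℤ) : Prop where
  aA : a ⬝ᵥ A = 0
  aB : a ⬝ᵥ B = 0
  aC : a ⬝ᵥ C = 1
  aD : a ⬝ᵥ D = 1
  bA : b ⬝ᵥ A = 1
  bB : b ⬝ᵥ B = 1
  bC : b ⬝ᵥ C = 0
  bD : b ⬝ᵥ D = 0
  cA : c ⬝ᵥ A = 1
  cB : c ⬝ᵥ B = 0
  cC : c ⬝ᵥ C = 0
  cD : c ⬝ᵥ D = 1
  dA : d ⬝ᵥ A = 0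
  dB : d ⬝ᵥ B = 1
  dC : d ⬝ᵥ C = 1
  dD : d ⬝ᵥ D = 0
  add_eq : A + C = B + D

/-- The vertices of the square are primitive, and each of them is exposed by the sum of the two linear
forms that vanish on it. -/
theorem IsSquare.exposed {a b c d A B C D : Fin 3 → ℤ} (h : IsSquare a b c d A B C D) :
    ∀ u ∈ ({A, B, C, D} : Set (Fin 3 → ℤ)), (∃ m : Fin 3 → ℤ, m ⬝ᵥ u = 1) ∧
      ∃ w : Fin 3 → ℤ, w ⬝ᵥ u = 0 ∧
        ∀ u' ∈ ({A, B, C, D} : Set (Fin 3 → ℤ)), u' ≠ u → 0 < w ⬝ᵥ u' := by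
  obtain ⟨⟩ := h
  have key : ∀ u w w' : Fin 3 → ℤ, w ⬝ᵥ u = 0 → w' ⬝ᵥ u = 0 →
      (∀ u' ∈ ({A, B, C, D} : Set (Fin 3 → ℤ)), u' ≠ u → 0 < w ⬝ᵥ u' + w' ⬝ᵥ u') →
      ∃ w : Fin 3 → ℤ, w ⬝ᵥ u = 0 ∧
        ∀ u' ∈ ({A, B, C, D} : Set (Fin 3 → ℤ)), u' ≠ u → 0 < w ⬝ᵥ u' := by
    intro u w w' h1 h2 h3
    refine ⟨w + w', by rw [add_dotProduct, h1, h2, add_zero], fun u' hu' hne => ?_⟩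
    rw [add_dotProduct]
    exact h3 u' hu' hne
  rintro u (rfl | rfl | rfl | rfl)
  · refine ⟨⟨b, by assumption⟩, key _ a d (by assumption) (by assumption) ?_⟩
    rintro u' (rfl | rfl | rfl | rfl) hne <;> first | exact absurd rfl hne | omega
  · refine ⟨⟨b, by assumption⟩, key _ a c (by assumption) (by assumption) ?_⟩
    rintro u' (rfl | rfl | rfl | rfl) hne <;> first | exact absurd rfl hne | omega
  · refine ⟨⟨a, by assumption⟩, key _ b c (by assumption) (by assumption) ?_⟩
    rintro u' (rfl | rfl | rfl | rfl) hne <;> first | exact absurd rfl hne | omega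
  · refine ⟨⟨a, by assumption⟩, key _ b d (by assumption) (by assumption) ?_⟩
    rintro u' (rfl | rfl | rfl | rfl) hne <;> first | exact absurd rfl hne | omega

/-- If every vector is a difference of elements of the semigroup generated by `a`, `b`, `c`, `d` and
`a + b = c + d`, then `a`, `c`, `d` generate the lattice. -/
theorem exists_zsmul_add_eq {a b c d : Fin 3 → ℤ} (habcd : a + b = c + d)
    {S : AddSubmonoid (Fin 3 → ℤ)} (hS : S = AddSubmonoid.closure {a, b, c, d})
    (hdiff : ∀ m : Fin 3 → ℤ, ∃ w ∈ S, m + w ∈ S) (m : Fin 3 → ℤ) :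
    ∃ x y z : ℤ, x • a + y • c + z • d = m := by
  have h1 : S ≤ (Submodule.span ℤ {a, c, d}).toAddSubmonoid := by
    have ha : a ∈ Submodule.span ℤ {a, c, d} := Submodule.subset_span (by simp)
    have hc : c ∈ Submodule.span ℤ {a, c, d} := Submodule.subset_span (by simp)
    have hd : d ∈ Submodule.span ℤ {a, c, d} := Submodule.subset_span (by simp)
    have hb : b ∈ Submodule.span ℤ {a, c, d} := by
      have : b = c + d - a := by rw [← habcd, add_sub_cancel_left]
      rw [this]
      exact sub_mem (add_mem hc hd) ha
    rw [hS, AddSubmonoid.closure_le]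
    rintro _ (rfl | rfl | rfl | rfl) <;> assumption
  obtain ⟨w, hw, hmw⟩ := hdiff m
  have h2 := (Submodule.span ℤ {a, c, d}).sub_mem (h1 hmw) (h1 hw)
  rw [add_sub_cancel_right] at h2
  exact Submodule.mem_span_triple.1 h2

/-- A strictly convex cone whose dual semigroup is generated by four elements with `a + b = c + d`
is the cone over a unit square, whose vertices are given by the basis that is dual to `a`, `c`, `d`. -/
theorem exists_isSquare {a b c d : Fin 3 → ℤ} (habcd : a + b = c + d)
    {V : Finset (Fin 3 → ℤ)}
    (hS : dualMonoid (coneHull (V : Set (Fin 3 → ℤ))) = AddSubmonoid.closure {a, b, c, d})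
    (hdiff : ∀ m : Fin 3 → ℤ, ∃ w ∈ dualMonoid (coneHull (V : Set (Fin 3 → ℤ))),
      m + w ∈ dualMonoid (coneHull (V : Set (Fin 3 → ℤ)))) :
    ∃ A B C D : Fin 3 → ℤ, IsSquare a b c d A B C D ∧
      coneHull (V : Set (Fin 3 → ℤ)) = coneHull {A, B, C, D} := by
  choose x y z hxyz using exists_zsmul_add_eq habcd hS hdiff
  -- the basis of the lattice that is dual to `a`, `c`, `d`
  let N : Matrix (Fin 3) (Fin 3) ℤ := Matrix.of ![a, c, d]
  let Y : Matrix (Fin 3) (Fin 3) ℤ :=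
    Matrix.of fun i => ![x (Pi.single i 1), y (Pi.single i 1), z (Pi.single i 1)]
  have hYN : Y * N = 1 := by
    ext i j
    have h1 := congrFun (hxyz (Pi.single i 1)) j
    simp only [Matrix.mul_apply, Fin.sum_univ_three, Y, N, Matrix.of_apply]
    rw [Matrix.one_eq_pi_single, ← h1]
    rfl
  have hNY : N * Y = 1 := mul_eq_one_comm.1 hYN
  let f : Fin 3 → Fin 3 → ℤ := fun j i => Y i j
  have hdot : ∀ i j, N i ⬝ᵥ f j = if i = j then 1 else 0 := fun i j => by
    have h1 := congrFun (congrFun hNY i) j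
    rw [Matrix.one_apply] at h1
    exact h1
  have hexp : ∀ v : Fin 3 → ℤ, v = (a ⬝ᵥ v) • f 0 + (c ⬝ᵥ v) • f 1 + (d ⬝ᵥ v) • f 2 := by
    intro v
    have h1 : Y.mulVec (N.mulVec v) = v := by
      rw [Matrix.mulVec_mulVec, hYN, Matrix.one_mulVec]
    ext i
    have h2 := congrFun h1 i
    simp only [Matrix.mulVec, dotProduct, Fin.sum_univ_three] at h2
    rw [← h2]
    simp only [Pi.add_apply, Pi.smul_apply, smul_eq_mul, f, dotProduct, Fin.sum_univ_three, N,
      Matrix.of_apply, Matrix.cons_val]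
    ring
  have a0 : a ⬝ᵥ f 0 = 1 := hdot 0 0
  have a1 : a ⬝ᵥ f 1 = 0 := hdot 0 1
  have a2 : a ⬝ᵥ f 2 = 0 := hdot 0 2
  have c0 : c ⬝ᵥ f 0 = 0 := hdot 1 0
  have c1 : c ⬝ᵥ f 1 = 1 := hdot 1 1
  have c2 : c ⬝ᵥ f 2 = 0 := hdot 1 2
  have d0 : d ⬝ᵥ f 0 = 0 := hdot 2 0
  have d1 : d ⬝ᵥ f 1 = 0 := hdot 2 1
  have d2 : d ⬝ᵥ f 2 = 1 := hdot 2 2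
  have hb : ∀ v, b ⬝ᵥ v = c ⬝ᵥ v + d ⬝ᵥ v - a ⬝ᵥ v := fun v => by
    rw [← add_dotProduct, ← habcd, add_dotProduct, add_sub_cancel_left]
  have hsq : IsSquare a b c d (f 1) (f 2) (f 0 + f 2) (f 0 + f 1) := by
    constructor <;> first
      | (simp only [hb, dotProduct_add, a0, a1, a2, c0, c1, c2, d0, d1, d2]; done)
      | (simp only [hb, dotProduct_add, a0, a1, a2, c0, c1, c2, d0, d1, d2]; norm_num)
      | abel
  refine ⟨_, _, _, _, hsq, coneHull_eq_of_dual (fun v hv => ?_) (fun m hm => ?_) ?_⟩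
  · have hmem : ∀ m ∈ ({a, b, c, d} : Set (Fin 3 → ℤ)), 0 ≤ m ⬝ᵥ v := fun m hm =>
      mem_dualMonoid_coneHull.1 (hS ▸ AddSubmonoid.subset_closure hm) v hv
    have hav := hmem a (by simp)
    have hbv := hmem b (by simp)
    have hcv := hmem c (by simp)
    have hdv := hmem d (by simp)
    rw [hb] at hbv
    have hgen : ∀ u ∈ ({f 1, f 2, f 0 + f 2, f 0 + f 1} : Set (Fin 3 → ℤ)), ∀ k : ℤ, 0 ≤ k →
        toReal (k • u) ∈ coneHull {f 1, f 2, f 0 + f 2, f 0 + f 1} := fun u hu k hk =>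
      smul_toReal_mem_coneHull hu hk
    -- the diagonal through the second and the fourth vertex divides the cone into two simplicial cones
    rcases le_total (a ⬝ᵥ v) (c ⬝ᵥ v) with h | h
    · have h1 : v = (a ⬝ᵥ v) • (f 0 + f 1) + (c ⬝ᵥ v - a ⬝ᵥ v) • f 1 + (d ⬝ᵥ v) • f 2 := by
        conv_lhs => rw [hexp v]
        module
      rw [h1, toReal_add, toReal_add]
      exact add_mem (add_mem (hgen _ (by simp) _ hav) (hgen _ (by simp) _ (by linarith)))
        (hgen _ (by simp) _ hdv)
    · have h1 : v = (c ⬝ᵥ v) • (f 0 + f 1) + (a ⬝ᵥ v - c ⬝ᵥ v) • (f 0 + f 2) +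
          (c ⬝ᵥ v + d ⬝ᵥ v - a ⬝ᵥ v) • f 2 := by
        conv_lhs => rw [hexp v]
        module
      rw [h1, toReal_add, toReal_add]
      exact add_mem (add_mem (hgen _ (by simp) _ hcv) (hgen _ (by simp) _ (by linarith)))
        (hgen _ (by simp) _ hbv)
  · have h1 : AddSubmonoid.closure {a, b, c, d} ≤
        dualMonoid (coneHull {f 1, f 2, f 0 + f 2, f 0 + f 1}) := by
      rw [AddSubmonoid.closure_le]
      intro m hm
      refine mem_dualMonoid_coneHull.2 fun u hu => ?_
      obtain ⟨⟩ := hsq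
      rcases hm with rfl | rfl | rfl | rfl <;> rcases hu with rfl | rfl | rfl | rfl <;> omega
    exact mem_dualMonoid_coneHull.1 (h1 (hS ▸ hm))
  · intro u hu
    obtain ⟨⟨m, hm⟩, hw⟩ := hsq.exposed u hu
    exact ⟨ne_zero_of_primitive (primitive_of_dot_eq_one hm), hw⟩

/-- The relation of the diagonals is the only condition on the values of an integral linear form at
the vertices of the square. -/
theorem IsSquare.exists_dot_eq {a b c d A B C D : Fin 3 → ℤ} (h : IsSquare a b c d A B C D)
    {x y z w : ℤ} (hxyzw : x + z = y + w) :
    ∃ m : Fin 3 → ℤ, m ⬝ᵥ A = x ∧ m ⬝ᵥ B = y ∧ m ⬝ᵥ C = z ∧ m ⬝ᵥ D = w := by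
  obtain ⟨⟩ := h
  refine ⟨x • c + y • d + (z - y) • a, ?_, ?_, ?_, ?_⟩ <;>
    simp only [add_dotProduct, smul_dotProduct, smul_eq_mul, *] <;> linarith

theorem IsSquare.isFace {a b c d A B C D : Fin 3 → ℤ} (h : IsSquare a b c d A B C D) :
    IsFace (coneHull {A, B}) (coneHull {A, B, C, D}) ∧
    IsFace (coneHull {B, C}) (coneHull {A, B, C, D}) ∧
    IsFace (coneHull {C, D}) (coneHull {A, B, C, D}) ∧
    IsFace (coneHull {D, A}) (coneHull {A, B, C, D}) := by
  obtain ⟨⟩ := h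
  have key : ∀ (W : Set (Fin 3 → ℤ)) (w : Fin 3 → ℤ), W ⊆ {A, B, C, D} →
      (∀ u ∈ W, w ⬝ᵥ u = 0) → (∀ u ∈ ({A, B, C, D} : Set (Fin 3 → ℤ)), u ∈ W ∨ w ⬝ᵥ u = 1) →
      IsFace (coneHull W) (coneHull {A, B, C, D}) := by
    intro W w hW h0 h1
    refine isFace_coneHull w (fun u hu => ?_) fun u => ⟨fun hu => ⟨hW hu, h0 u hu⟩, fun hu => ?_⟩
    · rcases h1 u hu with h | h
      · exact (h0 u h).ge
      · omega
    · rcases h1 u hu.1 with h | h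
      · exact h
      · have := hu.2
        omega
  refine ⟨key _ a ?_ ?_ ?_, key _ c ?_ ?_ ?_, key _ b ?_ ?_ ?_, key _ d ?_ ?_ ?_⟩
  all_goals first
    | (rintro u (rfl | rfl) <;> first | assumption | simp)
    | (rintro u (rfl | rfl | rfl | rfl) <;> first | (right; assumption) | (left; simp))

/-- The diagonals of a quadrangle are not faces. -/
theorem IsSquare.not_isFace {a b c d A B C D : Fin 3 → ℤ} (h : IsSquare a b c d A B C D) :
    ¬ IsFace (coneHull {A, C}) (coneHull {A, B, C, D}) ∧
    ¬ IsFace (coneHull {B, D}) (coneHull {A, B, C, D}) := by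
  obtain ⟨⟩ := h
  have key : ∀ (P Q R S w : Fin 3 → ℤ), P + R = Q + S →
      Q ∈ ({A, B, C, D} : Set (Fin 3 → ℤ)) → S ∈ ({A, B, C, D} : Set (Fin 3 → ℤ)) →
      0 ≤ w ⬝ᵥ P → 0 ≤ w ⬝ᵥ R → w ⬝ᵥ Q < 0 →
      ¬ IsFace (coneHull {P, R}) (coneHull {A, B, C, D}) := by
    rintro P Q R S w hPQRS hQ hS hP hR hlt ⟨m, hm, hface⟩
    have h1 : ∀ u ∈ ({P, R} : Set (Fin 3 → ℤ)), m ⬝ᵥ u = 0 := fun u hu => by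
      have := ((hface _).1 (toReal_mem_coneHull hu)).2
      rw [toReal_dot] at this
      exact_mod_cast this
    have hP0 := h1 P (by simp)
    have hR0 := h1 R (by simp)
    have hQ0 := dot_nonneg_of_mem (σ := coneHull {A, B, C, D}) hm (toReal_mem_coneHull hQ)
    have hS0 := dot_nonneg_of_mem (σ := coneHull {A, B, C, D}) hm (toReal_mem_coneHull hS)
    have h2 : m ⬝ᵥ Q + m ⬝ᵥ S = 0 := by
      rw [← dotProduct_add, ← hPQRS, dotProduct_add, hP0, hR0, add_zero]
    have h3 : toReal Q ∈ coneHull {P, R} := (hface _).2 ⟨toReal_mem_coneHull hQ, by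
      rw [toReal_dot, show m ⬝ᵥ Q = 0 by omega, Int.cast_zero]⟩
    have h4 : w ∈ dualMonoid (coneHull {P, R}) := mem_dualMonoid_coneHull.2 (by
      rintro u (rfl | rfl) <;> assumption)
    have := dot_nonneg_of_mem h4 h3
    omega
  refine ⟨key A B C D (c - b) (by assumption) (by simp) (by simp) ?_ ?_ ?_,
    key B A D C (a - c) (Eq.symm (by assumption)) (by simp) (by simp) ?_ ?_ ?_⟩ <;>
  rw [sub_dotProduct] <;> omega

end QuadrangleCone

section NodalFan

/-- The diagonals of a quadrangle do not depend on its labelling: they are the pairs of vertices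
that are not adjacent. -/
theorem diagonals_eq {α : Type*} {r : α → α → Prop} {A B C D A' B' C' D' : α}
    (hAC : ¬ r A C) (hCA : ¬ r C A) (hBD : ¬ r B D) (hDB : ¬ r D B)
    (hnodup : [A', B', C', D'].Nodup) (hA : A' ∈ ({A, B, C, D} : Set α))
    (hB : B' ∈ ({A, B, C, D} : Set α)) (hC : C' ∈ ({A, B, C, D} : Set α))
    (hD : D' ∈ ({A, B, C, D} : Set α)) (h1 : r A' B') (h2 : r B' C') (h3 : r C' D')
    (h4 : r D' A') :
    ((A' = A ∧ C' = C ∨ A' = C ∧ C' = A) ∧ (B' = B ∧ D' = D ∨ B' = D ∧ D' = B)) ∨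
    ((A' = B ∧ C' = D ∨ A' = D ∧ C' = B) ∧ (B' = A ∧ D' = C ∨ B' = C ∧ D' = A)) := by
  simp only [List.nodup_cons, List.mem_cons, List.not_mem_nil, or_false, not_or] at hnodup
  obtain ⟨⟨hAB, hAC', hAD⟩, ⟨hBC, hBD'⟩, hCD, -⟩ := hnodup
  rcases hA with rfl | rfl | rfl | rfl <;> rcases hB with rfl | rfl | rfl | rfl <;>
    first
    | exact absurd rfl hAB
    | exact absurd h1 ‹_›
    | (rcases hC with rfl | rfl | rfl | rfl <;>
        first
        | exact absurd rfl hAC'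
        | exact absurd rfl hBC
        | exact absurd h2 ‹_›
        | (rcases hD with rfl | rfl | rfl | rfl <;>
            first
            | exact absurd rfl hAD
            | exact absurd rfl hBD'
            | exact absurd rfl hCD
            | simp))

namespace Fan

variable (F : Fan 3)

/-- The cone of an ordinary double point is a quadrangle. -/
theorem exists_isQuadrangle {σ : F.cones}
    (h : IsOrdinaryDoublePoint (F.toricVariety.presheaf.stalk (F.orbitPoint σ))) :
    ∃ (a b c d : Fin 3 → ℤ) (A B C D : F.rays), IsSquare a b c d A.1 B.1 C.1 D.1 ∧
      IsQuadrangle σ A B C D := by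
  let _ : Algebra (coordRing σ.1) (F.toricVariety.presheaf.stalk (F.orbitPoint σ)) :=
    (chartToStalk (F.chart σ) (F.orbitPrime σ)).toAlgebra
  have : IsLocalization.AtPrime (F.toricVariety.presheaf.stalk (F.orbitPoint σ))
      (orbitIdeal σ.1) := isLocalization_chartToStalk (F.chart σ) (F.orbitPrime σ)
  obtain ⟨v, hv⟩ := F.exists_height σ
  obtain ⟨a, b, c, d, habcd, hS⟩ := exists_generators_of_isOrdinaryDoublePoint h hv
  obtain ⟨V, hV⟩ := F.rational σ.1 σ.2
  obtain ⟨A, B, C, D, hsq, hcone⟩ := exists_isSquare habcd (hV ▸ hS)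
    (hV ▸ F.exists_add_mem_dualMonoid σ)
  rw [← hV] at hcone
  have hrays : ∀ u ∈ ({A, B, C, D} : Set (Fin 3 → ℤ)), u ∈ F.rays := fun u hu => by
    obtain ⟨⟨m, hm⟩, w, hw0, hw⟩ := hsq.exposed u hu
    exact F.mem_rays_of_exposed hcone hu hm hw0 hw
  obtain ⟨f1, f2, f3, f4⟩ := hsq.isFace
  rw [← hcone] at f1 f2 f3 f4
  refine ⟨a, b, c, d, ⟨A, hrays A (by simp)⟩, ⟨B, hrays B (by simp)⟩, ⟨C, hrays C (by simp)⟩,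
    ⟨D, hrays D (by simp)⟩, hsq, ?_, hcone, f1, f2, f3, f4⟩
  have hne : ∀ (m : Fin 3 → ℤ) {P Q : Fin 3 → ℤ} {hP : P ∈ F.rays} {hQ : Q ∈ F.rays},
      m ⬝ᵥ P ≠ m ⬝ᵥ Q → (⟨P, hP⟩ : F.rays) ≠ ⟨Q, hQ⟩ := fun m P Q hP hQ hPQ h =>
    hPQ (congrArg (fun E : F.rays => m ⬝ᵥ E.1) h)
  obtain ⟨⟩ := hsq
  simp only [List.nodup_cons, List.mem_cons, List.not_mem_nil, or_false, not_or,
    not_false_eq_true, List.nodup_nil, and_true]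
  exact ⟨⟨hne c (by omega), hne a (by omega), hne a (by omega)⟩,
    ⟨hne a (by omega), hne a (by omega)⟩, hne c (by omega)⟩

/-- In the cone of an ordinary double point the two diagonals have the same sum, and this is the
only linear relation between the values of an integral linear form on the four rays. -/
theorem IsQuadrangle.relations {F : Fan 3} {σ : F.cones}
    (h : IsOrdinaryDoublePoint (F.toricVariety.presheaf.stalk (F.orbitPoint σ)))
    {A B C D : F.rays} (hq : IsQuadrangle σ A B C D) :
    A.1 + C.1 = B.1 + D.1 ∧ ∀ x y z w : ℤ, x + z = y + w →
      ∃ m : Fin 3 → ℤ, m ⬝ᵥ A.1 = x ∧ m ⬝ᵥ B.1 = y ∧ m ⬝ᵥ C.1 = z ∧ m ⬝ᵥ D.1 = w := by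
  obtain ⟨a, b, c, d, P, Q, R, S, hsq, hPQRS⟩ := F.exists_isQuadrangle h
  have hrays : ({P.1, Q.1, R.1, S.1} : Set (Fin 3 → ℤ)) ⊆ F.rays := by
    rintro u (rfl | rfl | rfl | rfl) <;> exact Subtype.property _
  have hmem : ∀ E : F.rays, E.1 ∈ ({A.1, B.1, C.1, D.1} : Set (Fin 3 → ℤ)) →
      E ∈ ({P, Q, R, S} : Set F.rays) := fun E hE => by
    have h1 := F.mem_of_mem_coneHull hrays hPQRS.2.1 E.2
      (hq.2.1 ▸ toReal_mem_coneHull hE)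
    simpa only [Set.mem_insert_iff, Set.mem_singleton_iff, Subtype.ext_iff] using h1
  obtain ⟨hPR, hQS⟩ := hsq.not_isFace
  rw [← hPQRS.2.1] at hPR hQS
  have hex := fun x y z w h => hsq.exists_dot_eq (x := x) (y := y) (z := z) (w := w) h
  have hadd := hsq.add_eq
  -- all eight cyclic labellings of the square give the same relation
  rcases diagonals_eq (r := fun E E' : F.rays => IsFace (coneHull {E.1, E'.1}) σ.1)
    hPR (by rwa [Set.pair_comm]) hQS (by rwa [Set.pair_comm]) hq.1 (hmem A (by simp))
    (hmem B (by simp)) (hmem C (by simp)) (hmem D (by simp)) hq.2.2.1 hq.2.2.2.1 hq.2.2.2.2.1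
    hq.2.2.2.2.2 with
    ⟨⟨rfl, rfl⟩ | ⟨rfl, rfl⟩, ⟨rfl, rfl⟩ | ⟨rfl, rfl⟩⟩ |
    ⟨⟨rfl, rfl⟩ | ⟨rfl, rfl⟩, ⟨rfl, rfl⟩ | ⟨rfl, rfl⟩⟩
  · exact ⟨hadd, hex⟩
  · refine ⟨by rw [hadd, add_comm], fun x y z w h => ?_⟩
    obtain ⟨m, h1, h2, h3, h4⟩ := hex x w z y (by omega)
    exact ⟨m, h1, h4, h3, h2⟩
  · refine ⟨by rw [← hadd, add_comm], fun x y z w h => ?_⟩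
    obtain ⟨m, h1, h2, h3, h4⟩ := hex z y x w (by omega)
    exact ⟨m, h3, h2, h1, h4⟩
  · refine ⟨by rw [add_comm, hadd, add_comm], fun x y z w h => ?_⟩
    obtain ⟨m, h1, h2, h3, h4⟩ := hex z w x y (by omega)
    exact ⟨m, h3, h4, h1, h2⟩
  · refine ⟨hadd.symm, fun x y z w h => ?_⟩
    obtain ⟨m, h1, h2, h3, h4⟩ := hex y x w z (by omega)
    exact ⟨m, h2, h1, h4, h3⟩
  · refine ⟨by rw [← hadd, add_comm], fun x y z w h => ?_⟩
    obtain ⟨m, h1, h2, h3, h4⟩ := hex w x y z (by omega)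
    exact ⟨m, h2, h3, h4, h1⟩
  · refine ⟨by rw [add_comm, ← hadd], fun x y z w h => ?_⟩
    obtain ⟨m, h1, h2, h3, h4⟩ := hex y z w x (by omega)
    exact ⟨m, h4, h1, h2, h3⟩
  · refine ⟨by rw [add_comm, ← hadd, add_comm], fun x y z w h => ?_⟩
    obtain ⟨m, h1, h2, h3, h4⟩ := hex w z y x (by omega)
    exact ⟨m, h4, h3, h2, h1⟩

end Fan

end NodalFan

/-! ### Principal divisors at an ordinary double point -/

section Principal

variable {n : ℕ}

namespace Fan

variable (F : Fan n)

theorem exists_isPerp_of_notMem_orbitPrime {σ : F.cones} {b : coordRing σ.1}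
    (hb : b ∉ (F.orbitPrime σ).asIdeal) :
    ∃ m ∈ (toLaurent σ.1 b).coeff.support, IsPerp σ.1 m := by
  by_contra! hcon
  refine hb (mem_ker_orbitHom_iff.2 fun m hm => hcon _ ?_)
  rw [Finsupp.mem_support_iff, coeff_toLaurent]
  exact Finsupp.mem_support_iff.1 hm

theorem dot_eq_zero_of_isPerp {σ : PointedCone ℝ (Fin n → ℝ)} {m u : Fin n → ℤ}
    (hm : IsPerp σ m) (hu : toReal u ∈ σ) : m ⬝ᵥ u = 0 := by
  have := hm _ hu
  rw [toReal_dot] at this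
  exact_mod_cast this

/-- A function that does not vanish identically on the orbit of `σ` has order zero in all directions
of `σ`. -/
theorem hasOrder_zero_of_notMem_orbitPrime {σ : F.cones} {b : coordRing σ.1}
    (hb : b ∉ (F.orbitPrime σ).asIdeal) {u : Fin n → ℤ} (hu : toReal u ∈ σ.1) :
    HasOrder u (toLaurent σ.1 b) 0 := by
  obtain ⟨m, hm, hperp⟩ := F.exists_isPerp_of_notMem_orbitPrime hb
  exact ⟨fun w hw => dot_nonneg_of_mem (mem_support_toLaurent hw).1 hu,
    m, hm, dot_eq_zero_of_isPerp hperp hu⟩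

/-- The divisors of the rays of `σ` pass through the orbit of `σ`. -/
theorem exists_chart_eq_orbitPoint_rayCone {σ : F.cones} {b : coordRing σ.1}
    (hb : b ∉ (F.orbitPrime σ).asIdeal) {ρ : F.rays} (hρ : toReal ρ.1 ∈ σ.1) :
    ∃ p : PrimeSpectrum (coordRing σ.1), b ∉ p.asIdeal ∧
      F.chart σ p = F.orbitPoint (F.rayCone ρ) := by
  have hle : (F.rayCone ρ).1 ≤ σ.1 := F.rayCone_le hρ
  refine ⟨PrimeSpectrum.comap (coordMap hle) (F.orbitPrime (F.rayCone ρ)), fun h => ?_,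
    chart_comap hle _⟩
  obtain ⟨m, hm, hperp⟩ := F.exists_isPerp_of_notMem_orbitPrime hb
  have h1 := (F.mem_orbitPrime_comap hle).1 h m hm
  rw [dot_eq_zero_of_isPerp hperp hρ] at h1
  exact lt_irrefl _ h1

variable {F} in
theorem IsQuadrangle.toReal_mem {σ : F.cones} {A B C D : F.rays} (hq : IsQuadrangle σ A B C D)
    {ρ : F.rays} (hρ : ρ ∈ ({A, B, C, D} : Set F.rays)) : toReal ρ.1 ∈ σ.1 := by
  rw [hq.2.1]
  refine toReal_mem_coneHull ?_
  rcases hρ with rfl | rfl | rfl | rfl <;> simp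

variable {F} in
theorem IsQuadrangle.subset_rays (A B C D : F.rays) :
    ({A.1, B.1, C.1, D.1} : Set (Fin n → ℤ)) ⊆ F.rays := by
  rintro u (rfl | rfl | rfl | rfl) <;> exact Subtype.property _

variable {F} in
theorem IsQuadrangle.rayGenerated {σ : F.cones} {A B C D : F.rays}
    (hq : IsQuadrangle σ A B C D) : F.RayGenerated σ :=
  F.rayGenerated_of_eq (IsQuadrangle.subset_rays A B C D) hq.2.1

variable {F} in
theorem IsQuadrangle.mem_of_toReal_mem {σ : F.cones} {A B C D : F.rays}
    (hq : IsQuadrangle σ A B C D) {ρ : F.rays} (hρ : toReal ρ.1 ∈ σ.1) :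
    ρ = A ∨ ρ = B ∨ ρ = C ∨ ρ = D := by
  have h := F.mem_of_mem_coneHull (IsQuadrangle.subset_rays A B C D) hq.2.1 ρ.2 hρ
  simpa only [Set.mem_insert_iff, Set.mem_singleton_iff, Subtype.ext_iff] using h

variable {F} in
/-- A torus-invariant divisor that is principal at the orbit of a quadrangle with `A + C = B + D`
satisfies the corresponding relation. -/
theorem IsQuadrangle.add_eq_add_of_isPrincipalAt {σ : F.cones} {A B C D : F.rays}
    (hq : IsQuadrangle σ A B C D) (hABCD : A.1 + C.1 = B.1 + D.1) {a : F.rays →₀ ℤ}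
    (h : IsPrincipalAt (F.divisor a) (F.orbitPoint σ)) : a A + a C = a B + a D := by
  obtain ⟨U, hU, f, hf0, hf⟩ := h
  rw [← F.chart_orbitPrime] at hU
  obtain ⟨b, hb, hbU⟩ := F.exists_basicOpen hU
  have hord : ∀ ρ ∈ ({A, B, C, D} : Set F.rays),
      F.toricVariety.ord f (F.orbitPoint (F.rayCone ρ)) = a ρ := fun ρ hρ => by
    obtain ⟨p, hp, hpρ⟩ := F.exists_chart_eq_orbitPoint_rayCone hb (hq.toReal_mem hρ)
    rw [hf _ (hpρ ▸ hbU p hp) (F.coheight_orbitPoint_rayCone ρ), divisor_orbitPoint]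
  rw [← hord A (by simp), ← hord B (by simp), ← hord C (by simp), ← hord D (by simp)]
  refine F.ord_quadrangle (f := Units.mk0 f hf0) hABCD b (fun u hu =>
    F.hasOrder_zero_of_notMem_orbitPrime hb ?_) ?_
  · rcases hu with rfl | rfl | rfl | rfl | rfl
    · exact hq.toReal_mem (by simp)
    · exact hq.toReal_mem (by simp)
    · exact hq.toReal_mem (by simp)
    · exact hq.toReal_mem (by simp)
    · rw [toReal_add]
      exact add_mem (hq.toReal_mem (by simp)) (hq.toReal_mem (by simp))
  · rintro z hz ⟨p, hp, rfl⟩ hz1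
    exact (hf _ (hbU p hp) hz1).trans (F.divisor_of_mem_torus a hz)

/-- A torus-invariant divisor is principal at the orbit of a cone if it is given there by a linear
form. -/
theorem isPrincipalAt_of_dot_eq {σ : F.cones} (hσ : F.RayGenerated σ) {a : F.rays →₀ ℤ}
    {m : Fin n → ℤ} (hm : ∀ ρ : F.rays, toReal ρ.1 ∈ σ.1 → m ⬝ᵥ ρ.1 = a ρ) :
    IsPrincipalAt (F.divisor a) (F.orbitPoint σ) := by
  refine ⟨(F.chart σ).opensRange, ⟨F.orbitPrime σ, rfl⟩, F.character m, Units.ne_zero _, ?_⟩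
  rintro _ ⟨p, rfl⟩ hz
  rcases F.mem_torus_or_eq_orbitPoint hσ hz with h | ⟨ρ, hρ, h⟩
  · refine (ord_eq_zero_of_mem_stalkUnits
      (F.character_mem_stalkUnits_of_mem_torus h m)).trans (F.divisor_of_mem_torus a h).symm
  · have e1 := F.ord_character m ρ
    rw [← h, hm ρ hρ] at e1
    refine e1.trans ?_
    rw [← F.divisor_orbitPoint a ρ, ← h]

end Fan

/-- The local condition at an ordinary double point of a toric threefold. -/
theorem Fan.IsQuadrangle.isPrincipalAt_iff {F : Fan 3} {σ : F.cones}
    (h : IsOrdinaryDoublePoint (F.toricVariety.presheaf.stalk (F.orbitPoint σ)))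
    {A B C D : F.rays} (hq : IsQuadrangle σ A B C D) (a : F.rays →₀ ℤ) :
    IsPrincipalAt (F.divisor a) (F.orbitPoint σ) ↔ a A + a C = a B + a D := by
  obtain ⟨hABCD, hex⟩ := hq.relations h
  refine ⟨hq.add_eq_add_of_isPrincipalAt hABCD, fun ha => ?_⟩
  obtain ⟨m, hA, hB, hC, hD⟩ := hex _ _ _ _ ha
  refine F.isPrincipalAt_of_dot_eq hq.rayGenerated (m := m) fun ρ hρ => ?_
  rcases hq.mem_of_toReal_mem hρ with rfl | rfl | rfl | rfl <;> assumption

end Principal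

/-! ### Divisors on nodal toric threefolds and on their small resolutions -/

section Resolution

variable {n : ℕ}

theorem HasWeilDivisor.isPrincipalAt {X : Scheme.{0}} [IsIntegral X] [IsLocallyNoetherian X]
    {s : CartierDivisor X} {W : X →₀ ℤ} (h : HasWeilDivisor s W) (x : X) : IsPrincipalAt W x := by
  obtain ⟨U, hU, f, hf⟩ := s.2 x
  exact ⟨U, hU, f, f.ne_zero, fun z hz hz1 => h z hz1 f (hf z hz)⟩

namespace Fan

theorem divisor_sub (F : Fan n) (a a' : F.rays →₀ ℤ) :
    F.divisor (a - a') = F.divisor a - F.divisor a' :=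
  map_sub (Finsupp.mapDomain.addMonoidHom
    fun ρ : F.rays => F.orbitPoint ⟨coneHull {ρ.1}, ρ.2.2⟩) a a'

/-- The Picard group of the torus is trivial. -/
theorem exists_div_principal_eq_one (F : Fan n) (s : CartierDivisor F.toricVariety) :
    ∃ f, ∀ z ∈ F.torus, (s / principal F.toricVariety f).1 z = 1 := by
  obtain ⟨f, hf⟩ := exists_eq_cartierGerm_of_factorial (F.chart F.torusCone) s
  refine ⟨f, ?_⟩
  rintro _ ⟨p, rfl⟩
  change s.1 (F.chart F.torusCone p) / cartierGerm F.toricVariety _ f = 1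
  rw [div_eq_one]
  exact hf p

/-- A Cartier divisor that is trivial on the torus has a torus-invariant Weil divisor: there are no
other points of codimension one than those of the torus and of the rays. -/
theorem exists_hasWeilDivisor {F : Fan n} (hF : ∀ σ : F.cones, F.RayGenerated σ)
    {s : CartierDivisor F.toricVariety} (hs : ∀ z ∈ F.torus, s.1 z = 1) :
    ∃ a : F.rays →₀ ℤ, HasWeilDivisor s (F.divisor a) := by
  choose g hg using fun ρ : F.rays =>
    cartierGerm_surjective _ (s.1 (F.orbitPoint (F.rayCone ρ)))
  refine ⟨Finsupp.equivFunOnFinite.symm fun ρ =>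
    F.toricVariety.ord (g ρ : F.toricVariety.functionField) (F.orbitPoint (F.rayCone ρ)), ?_⟩
  rw [hasWeilDivisor_iff_of_eq]
  intro z hz
  obtain ⟨σ, p, rfl⟩ := F.exists_chart z
  rcases F.mem_torus_or_eq_orbitPoint (hF σ) hz with h | ⟨ρ, -, h⟩
  · refine ⟨1, ?_, ?_⟩
    · rw [hs _ h, map_one]
    · rw [F.divisor_of_mem_torus _ h, Units.val_one, ord_one]
  · rw [h]
    refine ⟨g ρ, (hg ρ).symm, ?_⟩
    rw [divisor_orbitPoint]
    rfl

/-- The divisor of a rational function satisfies the linear relations of the rays. -/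
theorem ord_add_eq_of_relation (F : Fan n) {f : (F.toricVariety.functionField)ˣ}
    {a : F.rays →₀ ℤ} (h : HasWeilDivisor (principal F.toricVariety f) (F.divisor a))
    {A B C D : F.rays} (hABCD : A.1 + C.1 = B.1 + D.1) : a A + a C = a B + a D := by
  have hord : ∀ z, Order.coheight z = 1 →
      F.toricVariety.ord (f : F.toricVariety.functionField) z = F.divisor a z :=
    fun z hz => h z hz f rfl
  simp only [← divisor_orbitPoint, ← hord _ (F.coheight_orbitPoint_rayCone _)]
  refine F.ord_quadrangle hABCD (1 : coordRing F.torusCone.1) (fun u _ => ?_) fun z hz _ hz1 => ?_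
  · rw [map_one]
    have := hasOrder_single u (0 : Fin n → ℤ) (one_ne_zero (α := ℂ))
    rwa [zero_dotProduct] at this
  · rw [hord z hz1, F.divisor_of_mem_torus a hz]

section Regular

variable {F : Fan n} (σ : F.cones)
  [IsRegularLocalRing (F.toricVariety.presheaf.stalk (F.orbitPoint σ))]

theorem rayGenerated_of_regular : F.RayGenerated σ := by
  obtain ⟨I, _, _, t, u, -, hu, hσ⟩ := F.exists_dual_basis_of_regular σ
  exact F.rayGenerated_of_eq hu hσ

/-- On a regular cone the values of an integral linear form on the rays can be prescribed. -/
theorem exists_dot_eq_of_regular (a : F.rays →₀ ℤ) :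
    ∃ m : Fin n → ℤ, ∀ ρ : F.rays, toReal ρ.1 ∈ σ.1 → m ⬝ᵥ ρ.1 = a ρ := by
  obtain ⟨I, _, _, t, u, htu, hu, hσ⟩ := F.exists_dual_basis_of_regular σ
  refine ⟨∑ i, a ⟨u i, hu ⟨i, rfl⟩⟩ • t i, fun ρ hρ => ?_⟩
  obtain ⟨j, hj⟩ := F.mem_of_mem_coneHull hu hσ ρ.2 hρ
  obtain rfl : (⟨u j, hu ⟨j, rfl⟩⟩ : F.rays) = ρ := Subtype.ext hj
  rw [sum_dotProduct, Finset.sum_eq_single j]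
  · rw [smul_dotProduct, htu, if_pos rfl, smul_eq_mul, mul_one]
  · intro i _ hi
    rw [smul_dotProduct, htu, if_neg hi, smul_zero]
  · simp

end Regular

/-- A quadrangle is not a regular cone: it has more rays than the dimension. -/
theorem IsQuadrangle.not_regular {F : Fan 3} {σ : F.cones} {A B C D : F.rays}
    (hq : IsQuadrangle σ A B C D) :
    ¬ IsRegularLocalRing (F.toricVariety.presheaf.stalk (F.orbitPoint σ)) := by
  intro h
  obtain ⟨I, _, _, t, u, htu, hu, hσ⟩ := F.exists_dual_basis_of_regular σ
  have hli : LinearIndependent ℤ u := by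
    rw [Fintype.linearIndependent_iff]
    intro g hg j
    have h1 := congrArg (fun v => t j ⬝ᵥ v) hg
    simp only [dotProduct_sum, dotProduct_smul, htu, dotProduct_zero] at h1
    simpa using h1
  have hcard := hli.fintype_card_le_finrank
  rw [Module.finrank_fin_fun] at hcard
  let e : Fin 4 → F.rays := ![A, B, C, D]
  have he : Function.Injective e := by
    rw [← List.nodup_ofFn]
    simpa [e, List.ofFn_succ] using hq.1
  have hmem : ∀ k, ∃ i, u i = (e k).1 := fun k => by
    refine F.mem_of_mem_coneHull hu hσ (e k).2 (hq.toReal_mem ?_)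
    fin_cases k <;> simp [e]
  choose idx hidx using hmem
  have hinj : Function.Injective idx := fun k l hkl => he (Subtype.ext (by
    rw [← hidx, ← hidx, hkl]))
  have := Fintype.card_le_of_injective idx hinj
  rw [Fintype.card_fin] at this
  omega

section ToricMap

variable {G F : Fan n} (h : Refines G F)

theorem pullbackFunction_toricMap_surjective :
    Function.Surjective (pullbackFunction (toricMap h)) := by
  intro f
  obtain ⟨a, b, hb, hf⟩ := G.exists_ratFun f
  refine ⟨F.ratFun a / F.ratFun b, ?_⟩
  rw [map_div₀, pullbackFunction_toricMap, pullbackFunction_toricMap, ← hf,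
    mul_div_cancel_right₀ _ ((map_ne_zero_iff _ G.ratFun_injective).2 hb)]

theorem comap_coordMap_refl {σ : PointedCone ℝ (Fin n → ℝ)} (hσ : σ ≤ σ)
    (p : PrimeSpectrum (coordRing σ)) : PrimeSpectrum.comap (coordMap hσ) p = p := by
  rw [coordMap_refl]
  rfl

theorem toricMap_torus (p : PrimeSpectrum (coordRing (⊥ : PointedCone ℝ (Fin n → ℝ)))) :
    toricMap h (G.chart G.torusCone p) = F.chart F.torusCone p :=
  (toricMap_chart h G.torusCone F.torusCone le_rfl p).trans
    (congrArg (F.chart F.torusCone) (comap_coordMap_refl le_rfl p))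

theorem toricMap_mem_torus {z : G.toricVariety} (hz : z ∈ G.torus) : toricMap h z ∈ F.torus := by
  obtain ⟨p, rfl⟩ := hz
  exact ⟨p, (toricMap_torus h p).symm⟩

/-- The toric morphism is the identity on the torus, so that units there can be recognized after
pullback. -/
theorem mem_stalkUnits_of_pullback (p : PrimeSpectrum (coordRing (⊥ : PointedCone ℝ (Fin n → ℝ))))
    {f : (F.toricVariety.functionField)ˣ}
    (hf : Units.map (pullbackFunction (toricMap h)).toMonoidHom f ∈
      stalkUnits G.toricVariety (G.chart G.torusCone p)) :
    f ∈ stalkUnits F.toricVariety (F.chart F.torusCone p) := by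
  obtain ⟨a, b, ha, hb, hab⟩ := (G.mem_stalkUnits_chart_iff G.torusCone p _).1 hf
  refine (F.mem_stalkUnits_chart_iff F.torusCone p f).2 ⟨a, b, ha, hb, ?_⟩
  apply (pullbackFunction (toricMap h)).injective
  rw [map_mul, pullbackFunction_toricMap, pullbackFunction_toricMap]
  exact hab

variable {ρ : F.rays} {ρ' : G.rays} (hρ : ρ'.1 = ρ.1)
include hρ

theorem toricMap_orbitPoint :
    toricMap h (G.orbitPoint (G.rayCone ρ')) = F.orbitPoint (F.rayCone ρ) := by
  obtain ⟨u, hu⟩ := ρ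
  obtain ⟨u', hu'⟩ := ρ'
  obtain rfl : u' = u := hρ
  exact (toricMap_chart h (G.rayCone ⟨u', hu'⟩) (F.rayCone ⟨u', hu⟩) le_rfl
    (G.orbitPrime (G.rayCone ⟨u', hu'⟩))).trans
    (congrArg (F.chart (F.rayCone ⟨u', hu⟩)) (comap_coordMap_refl le_rfl _))

/-- The order of a rational function along the divisor of a common ray does not change under pullback:
both are given by the exponents of the function. -/
theorem ord_pullback (f : (F.toricVariety.functionField)ˣ) :
    G.toricVariety.ord (pullbackFunction (toricMap h) f) (G.orbitPoint (G.rayCone ρ')) =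
      F.toricVariety.ord (f : F.toricVariety.functionField) (F.orbitPoint (F.rayCone ρ)) := by
  obtain ⟨a, b, hb, hab⟩ := F.exists_ratFun f
  have ha : a ≠ 0 := by
    rintro rfl
    rw [map_zero] at hab
    exact mul_ne_zero f.ne_zero ((map_ne_zero_iff _ F.ratFun_injective).2 hb) hab
  obtain ⟨k, hk⟩ := exists_hasOrder ρ.1 ha
  obtain ⟨l, hl⟩ := exists_hasOrder ρ.1 hb
  rw [F.ord_orbitPoint hab hk hl]
  refine G.ord_orbitPoint (a := a) (b := b) ?_ (hρ ▸ hk) (hρ ▸ hl)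
  rw [← pullbackFunction_toricMap h, ← pullbackFunction_toricMap h, ← map_mul, hab]

end ToricMap

end Fan

end Resolution

section PicardGroup

section Classes

variable {X : Scheme.{0}} [IsIntegral X]

theorem divisorClass_surjective : Function.Surjective (divisorClass X) :=
  QuotientGroup.mk'_surjective _

theorem divisorClass_eq_one_iff {s : CartierDivisor X} :
    divisorClass X s = 1 ↔ ∃ f, principal X f = s :=
  QuotientGroup.eq_one_iff s

theorem divisorClass_principal (f : (X.functionField)ˣ) :
    divisorClass X (principal X f) = 1 :=
  divisorClass_eq_one_iff.2 ⟨f, rfl⟩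

theorem divisorClass_div_principal (s : CartierDivisor X) (f : (X.functionField)ˣ) :
    divisorClass X (s / principal X f) = divisorClass X s := by
  rw [map_div, divisorClass_principal, div_one]

theorem CartierDivisor.pullback_apply {Y : Scheme.{0}} [IsIntegral Y] (π : Y ⟶ X) [IsDominant π]
    {s : CartierDivisor X} {y : Y} {x : X} (hx : π y = x) {f : (X.functionField)ˣ}
    (hf : s.1 x = cartierGerm X x f) : (CartierDivisor.pullback π s).1 y =
      cartierGerm Y y (Units.map (pullbackFunction π).toMonoidHom f) := by
  subst hx
  exact congrArg (CartierGerm.pullback π y) hf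

end Classes

/-- A homomorphism on a group whose elements have representatives in another group, if it is
trivial on the representatives of the identity. -/
theorem exists_hom_of_representatives {P M N : Type*} [CommGroup P] [AddCommGroup M]
    [AddCommGroup N] {r : M → P → Prop} (hex : ∀ L, ∃ a, r a L)
    (hsub : ∀ a a' L L', r a L → r a' L' → r (a - a') (L / L')) (ψ : M →+ N)
    (hψ : ∀ a, r a 1 → ψ a = 0) :
    ∃ φ : Additive P →+ N, ∀ a L, r a L → φ (Additive.ofMul L) = ψ a := by
  have huniq : ∀ a a' L, r a L → r a' L → ψ a = ψ a' := fun a a' L ha ha' => by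
    have h1 := hsub a a' L L ha ha'
    rw [div_self'] at h1
    rw [← sub_eq_zero, ← map_sub]
    exact hψ _ h1
  choose c hc using hex
  refine ⟨AddMonoidHom.ofMapSub (fun L => ψ (c L.toMul)) fun L L' => ?_, fun a L ha =>
    huniq _ _ L (hc L) ha⟩
  rw [← map_sub]
  exact huniq _ _ _ (hc _) (hsub _ _ _ _ (hc _) (hc _))

namespace Fan

theorem pullback_eq_one_of_mem_torus {n : ℕ} {G F : Fan n}
    (h : Refines G F) {s : CartierDivisor F.toricVariety} (hs : ∀ z ∈ F.torus, s.1 z = 1)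
    {z : G.toricVariety} (hz : z ∈ G.torus) :
    (CartierDivisor.pullback (toricMap h) s).1 z = 1 := by
  have h1 := CartierDivisor.pullback_apply (toricMap h) (s := s) (y := z) rfl (f := 1)
    (by rw [hs _ (toricMap_mem_torus h hz), map_one])
  rwa [map_one, map_one] at h1

/-- The Weil divisor of a Cartier divisor that is trivial on the torus does not change in a small
resolution. -/
theorem hasWeilDivisor_pullback_toricMap {n : ℕ} {G F : Fan n} (h : Refines G F)
    (hG : ∀ τ : G.cones, G.RayGenerated τ) {e : F.rays ≃ G.rays} (he : ∀ ρ, (e ρ).1 = ρ.1)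
    {s : CartierDivisor F.toricVariety} (hs : ∀ z ∈ F.torus, s.1 z = 1) {a : F.rays →₀ ℤ}
    (ha : HasWeilDivisor s (F.divisor a)) :
    HasWeilDivisor (CartierDivisor.pullback (toricMap h) s)
      (G.divisor (Finsupp.equivFunOnFinite.symm fun ρ => a (e.symm ρ))) := by
  rw [hasWeilDivisor_iff_of_eq]
  intro z hz
  obtain ⟨τ, p, rfl⟩ := G.exists_chart z
  rcases G.mem_torus_or_eq_orbitPoint (hG τ) hz with hT | ⟨ρ, -, hρ⟩
  · refine ⟨1, ?_, ?_⟩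
    · rw [pullback_eq_one_of_mem_torus h hs hT, map_one]
    · rw [G.divisor_of_mem_torus _ hT, Units.val_one, ord_one]
  · rw [hρ]
    obtain ⟨ρ, rfl⟩ := e.surjective ρ
    obtain ⟨g, hg⟩ := cartierGerm_surjective _ (s.1 (F.orbitPoint (F.rayCone ρ)))
    refine ⟨_, CartierDivisor.pullback_apply (toricMap h) (toricMap_orbitPoint h (he ρ)) hg.symm, ?_⟩
    refine (ord_pullback h (he ρ) g).trans ?_
    rw [ha _ (F.coheight_orbitPoint_rayCone ρ) g hg.symm, divisor_orbitPoint, divisor_orbitPoint]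
    exact (congrArg a (e.symm_apply_apply ρ)).symm

variable {G F : Fan 3}

/-- The cones of a nodal toric threefold are regular cones or quadrangles, and both are generated by
rays. -/
theorem rayGenerated_of_isNodal (hF : IsNodal F.toricVariety) (σ : F.cones) :
    F.RayGenerated σ := by
  rcases hF (F.orbitPoint σ) with h | h
  · exact rayGenerated_of_regular σ
  · obtain ⟨_, _, _, _, A, B, C, D, -, hq⟩ := F.exists_isQuadrangle h
    exact hq.rayGenerated

theorem IsQuadrangle.isOrdinaryDoublePoint (hF : IsNodal F.toricVariety) {σ : F.cones}
    {A B C D : F.rays} (hq : IsQuadrangle σ A B C D) :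
    IsOrdinaryDoublePoint (F.toricVariety.presheaf.stalk (F.orbitPoint σ)) :=
  (hF _).resolve_left hq.not_regular

theorem IsSmallResolution.rayGenerated {n : ℕ} {G F : Fan n} (h : IsSmallResolution G F)
    (τ : G.cones) : G.RayGenerated τ := by
  have := h.regular (G.orbitPoint τ)
  exact rayGenerated_of_regular τ

/-- Every torus-invariant divisor on a small resolution is Cartier, since the cones are regular. -/
theorem IsSmallResolution.exists_hasWeilDivisor {n : ℕ} {G F : Fan n} (h : IsSmallResolution G F)
    (a : G.rays →₀ ℤ) : ∃ s : CartierDivisor G.toricVariety, HasWeilDivisor s (G.divisor a) := by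
  have hm : ∀ τ : G.cones, ∃ m : Fin n → ℤ, ∀ ρ : G.rays, toReal ρ.1 ∈ τ.1 → m ⬝ᵥ ρ.1 = a ρ :=
    fun τ => by
      have := h.regular (G.orbitPoint τ)
      exact exists_dot_eq_of_regular τ a
  choose m hm using hm
  obtain ⟨s, hs⟩ := G.exists_cartierDivisor_of_character h.rayGenerated m a hm
  exact ⟨s, G.hasWeilDivisor_of_character h.rayGenerated hs hm⟩

/-- Every divisor class has a torus-invariant representative. -/
theorem exists_hasWeilDivisor_divisorClass_eq {n : ℕ} {G : Fan n}
    (hG : ∀ τ : G.cones, G.RayGenerated τ) (L : Pic G.toricVariety) :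
    ∃ (a : G.rays →₀ ℤ) (s : CartierDivisor G.toricVariety),
      (∀ z ∈ G.torus, s.1 z = 1) ∧ HasWeilDivisor s (G.divisor a) ∧
        divisorClass G.toricVariety s = L := by
  obtain ⟨s, rfl⟩ := divisorClass_surjective L
  obtain ⟨f, hf⟩ := G.exists_div_principal_eq_one s
  obtain ⟨a, ha⟩ := exists_hasWeilDivisor hG hf
  exact ⟨a, _, hf, ha, divisorClass_div_principal s f⟩

/-- The pullback of divisor classes to a small resolution is injective. -/
theorem pullback_toricMap_injective {n : ℕ} {G F : Fan n} (h : Refines G F)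
    (hG : ∀ τ : G.cones, G.RayGenerated τ) (hF : ∀ σ : F.cones, F.RayGenerated σ)
    {e : F.rays ≃ G.rays} (he : ∀ ρ, (e ρ).1 = ρ.1) :
    Function.Injective (Pic.pullback (toricMap h)) := by
  rw [injective_iff_map_eq_one]
  intro L hL
  obtain ⟨a, s, hs, ha, rfl⟩ := exists_hasWeilDivisor_divisorClass_eq hF L
  obtain ⟨f', hf'⟩ := divisorClass_eq_one_iff.1
    (show divisorClass G.toricVariety (CartierDivisor.pullback (toricMap h) s) = 1 from hL)
  obtain ⟨f₀, hf₀⟩ := pullbackFunction_toricMap_surjective h (f' : G.toricVariety.functionField)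
  have hf₀' : f₀ ≠ 0 := by
    rintro rfl
    rw [map_zero] at hf₀
    exact f'.ne_zero hf₀.symm
  let f : (F.toricVariety.functionField)ˣ := Units.mk0 f₀ hf₀'
  have hf : Units.map (pullbackFunction (toricMap h)).toMonoidHom f = f' := Units.ext hf₀
  -- `f` is an equation of the divisor below: it is a unit on the torus, and its orders along the rays
  -- are the same as those of its pullback
  have hT : ∀ z ∈ F.torus, f ∈ stalkUnits F.toricVariety z := by
    rintro _ ⟨p, rfl⟩
    refine mem_stalkUnits_of_pullback h p ?_
    rw [hf, ← cartierGerm_eq_one_iff,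
      ← pullback_eq_one_of_mem_torus h hs (z := G.chart G.torusCone p) ⟨p, rfl⟩,
      ← hf']
    rfl
  have ha' := hasWeilDivisor_pullback_toricMap h hG he hs ha
  have hdiv : HasWeilDivisor (principal F.toricVariety f) (F.divisor a) := by
    rw [hasWeilDivisor_iff_of_eq]
    intro z hz
    refine ⟨f, rfl, ?_⟩
    obtain ⟨σ, p, rfl⟩ := F.exists_chart z
    rcases F.mem_torus_or_eq_orbitPoint (hF σ) hz with h1 | ⟨ρ, -, h1⟩
    · rw [F.divisor_of_mem_torus a h1]
      exact ord_eq_zero_of_mem_stalkUnits (hT _ h1)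
    · rw [h1, ← ord_pullback h (he ρ) f, divisor_orbitPoint]
      have h2 := ha' _ (G.coheight_orbitPoint_rayCone (e ρ)) f' (by rw [← hf']; rfl)
      rw [divisor_orbitPoint] at h2
      refine (congrArg (fun g => G.toricVariety.ord g _) hf₀).trans (h2.trans ?_)
      exact congrArg a (e.symm_apply_apply ρ)
  have h1 := ha.div hdiv
  rw [sub_self] at h1
  rw [div_eq_one.1 (F.eq_one_of_hasWeilDivisor_zero hF h1)]
  exact divisorClass_principal f

/-- The torus-invariant divisors that satisfy the relations of the quadrangles come from the nodal
threefold. -/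
theorem mem_range_pullback (hF : IsNodal F.toricVariety) (h : IsSmallResolution G F)
    {A B C D : F.quadrangles → F.rays}
    (hq : ∀ q : F.quadrangles, IsQuadrangle q.1 (A q) (B q) (C q) (D q)) {a : G.rays →₀ ℤ}
    {s : CartierDivisor G.toricVariety} (hs : HasWeilDivisor s (G.divisor a))
    (ha : ∀ q, a (h.rayEquiv (A q)) + a (h.rayEquiv (C q)) =
      a (h.rayEquiv (B q)) + a (h.rayEquiv (D q))) :
    ∃ t, Pic.pullback (toricMap h.refines) (divisorClass F.toricVariety t) =
      divisorClass G.toricVariety s := by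
  let a₀ : F.rays →₀ ℤ := Finsupp.equivFunOnFinite.symm fun ρ => a (h.rayEquiv ρ)
  have hm : ∀ σ : F.cones, ∃ m : Fin 3 → ℤ, ∀ ρ : F.rays, toReal ρ.1 ∈ σ.1 →
      m ⬝ᵥ ρ.1 = a₀ ρ := by
    intro σ
    rcases hF (F.orbitPoint σ) with hreg | hnode
    · exact exists_dot_eq_of_regular σ a₀
    · obtain ⟨_, _, _, _, P, Q, R, S, -, hPQRS⟩ := F.exists_isQuadrangle hnode
      let q : F.quadrangles := ⟨σ, P, Q, R, S, hPQRS⟩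
      obtain ⟨m, h1, h2, h3, h4⟩ := ((hq q).relations hnode).2 _ _ _ _ (ha q)
      refine ⟨m, fun ρ hρ => ?_⟩
      rcases (hq q).mem_of_toReal_mem hρ with rfl | rfl | rfl | rfl <;> assumption
  choose m hm using hm
  obtain ⟨t, ht⟩ := F.exists_cartierDivisor_of_character (rayGenerated_of_isNodal hF) m a₀ hm
  refine ⟨t, ?_⟩
  have h1 : ∀ (τ : G.cones) (p : PrimeSpectrum (coordRing τ.1)),
      (CartierDivisor.pullback (toricMap h.refines) t).1 (G.chart τ p) =
        cartierGerm G.toricVariety _ (G.character (m (h.refines.cone τ))) := by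
    intro τ p
    rw [CartierDivisor.pullback_apply (toricMap h.refines)
      (toricMap_chart h.refines τ (h.refines.cone τ) (h.refines.le_cone τ) p) (ht _ _)]
    congr 1
    exact Units.ext (pullbackFunction_toricMap h.refines _)
  have h2 := G.hasWeilDivisor_of_character h.rayGenerated h1 (a := a) fun τ ρ hρ => by
    have h3 := hm (h.refines.cone τ) (h.rayEquiv.symm ρ) (h.refines.le_cone τ hρ)
    exact h3.trans (congrArg a (h.rayEquiv.apply_symm_apply ρ))
  have h3 := hs.div h2
  rw [sub_self] at h3
  rw [div_eq_one.1 (G.eq_one_of_hasWeilDivisor_zero h.rayGenerated h3)]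
  rfl

instance (F : Fan 3) : Finite F.cones := F.finite.to_subtype

/-- The homomorphism from the torus-invariant divisors to the sum over all quadrangles. -/
noncomputable def quadrangleHom (h : IsSmallResolution G F) (A B C D : F.quadrangles → F.rays) :
    (G.rays →₀ ℤ) →+ (F.quadrangles →₀ ℤ) where
  toFun a :=
    Finsupp.equivFunOnFinite.symm fun q => a (h.rayEquiv (A q)) - a (h.rayEquiv (B q)) +
      a (h.rayEquiv (C q)) - a (h.rayEquiv (D q))
  map_zero' := by
    ext q
    simp
  map_add' a a' := by
    ext q
    simp
    ring

theorem quadrangleHom_apply (h : IsSmallResolution G F) (A B C D : F.quadrangles → F.rays)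
    (a : G.rays →₀ ℤ) (q : F.quadrangles) : quadrangleHom h A B C D a q =
      a (h.rayEquiv (A q)) - a (h.rayEquiv (B q)) + a (h.rayEquiv (C q)) - a (h.rayEquiv (D q)) :=
  rfl

/-- The homomorphism from the Picard group of a small resolution of a nodal toric threefold to the
sum over all quadrangles. -/
theorem exists_quadrangleHom (hF : IsNodal F.toricVariety) (h : IsSmallResolution G F)
    {A B C D : F.quadrangles → F.rays}
    (hq : ∀ q : F.quadrangles, IsQuadrangle q.1 (A q) (B q) (C q) (D q)) :
    ∃ φ : Additive (Pic G.toricVariety) →+ (F.quadrangles →₀ ℤ),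
      ∀ (a : G.rays →₀ ℤ) (s : CartierDivisor G.toricVariety), HasWeilDivisor s (G.divisor a) →
        φ (Additive.ofMul (divisorClass G.toricVariety s)) = quadrangleHom h A B C D a := by
  obtain ⟨φ, hφ⟩ := exists_hom_of_representatives
    (r := fun (a : G.rays →₀ ℤ) (L : Pic G.toricVariety) =>
      ∃ s, HasWeilDivisor s (G.divisor a) ∧ divisorClass G.toricVariety s = L)
    (fun L => by
      obtain ⟨a, s, -, hs, hL⟩ := exists_hasWeilDivisor_divisorClass_eq h.rayGenerated L
      exact ⟨a, s, hs, hL⟩)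
    (by
      rintro a a' _ _ ⟨s, hs, rfl⟩ ⟨s', hs', rfl⟩
      exact ⟨s / s', by rw [divisor_sub]; exact hs.div hs', map_div _ s s'⟩)
    (quadrangleHom h A B C D) (by
      rintro a ⟨s, hs, hs1⟩
      obtain ⟨f, rfl⟩ := divisorClass_eq_one_iff.1 hs1
      ext q
      have h1 := ((hq q).relations ((hq q).isOrdinaryDoublePoint hF)).1
      have h2 := G.ord_add_eq_of_relation hs (A := h.rayEquiv (A q)) (B := h.rayEquiv (B q))
        (C := h.rayEquiv (C q)) (D := h.rayEquiv (D q)) h1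
      rw [quadrangleHom_apply, Finsupp.zero_apply]
      omega)
  exact ⟨φ, fun a s hs => hφ a _ ⟨s, hs, rfl⟩⟩

/-- The exactness of the sequence of Picard groups in the middle. -/
theorem exact_pullback_toricMap (hF : IsNodal F.toricVariety) (h : IsSmallResolution G F)
    {A B C D : F.quadrangles → F.rays}
    (hq : ∀ q : F.quadrangles, IsQuadrangle q.1 (A q) (B q) (C q) (D q))
    {φ : Additive (Pic G.toricVariety) →+ (F.quadrangles →₀ ℤ)}
    (hφ : ∀ (a : G.rays →₀ ℤ) (s : CartierDivisor G.toricVariety),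
      HasWeilDivisor s (G.divisor a) →
        φ (Additive.ofMul (divisorClass G.toricVariety s)) = quadrangleHom h A B C D a) :
    Function.Exact (Pic.pullback (toricMap h.refines)).toAdditive φ := by
  intro L
  obtain ⟨L, rfl⟩ := Additive.ofMul.surjective L
  constructor
  · intro hL
    obtain ⟨a, s, -, hs, rfl⟩ := exists_hasWeilDivisor_divisorClass_eq h.rayGenerated L
    rw [hφ a s hs] at hL
    obtain ⟨t, ht⟩ := mem_range_pullback hF h hq hs fun q => by
      have h1 := DFunLike.congr_fun hL q
      rw [quadrangleHom_apply, Finsupp.zero_apply] at h1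
      omega
    exact ⟨Additive.ofMul (divisorClass F.toricVariety t), congrArg Additive.ofMul ht⟩
  · rintro ⟨K, hK⟩
    obtain ⟨K, rfl⟩ := Additive.ofMul.surjective K
    obtain ⟨a, s, hs, ha, rfl⟩ :=
      exists_hasWeilDivisor_divisorClass_eq (rayGenerated_of_isNodal hF) K
    have h1 := hφ _ _ (hasWeilDivisor_pullback_toricMap h.refines h.rayGenerated
      (e := h.rayEquiv) (fun _ => rfl) hs ha)
    rw [← hK]
    refine Eq.trans h1 ?_
    ext q
    have h2 := ((hq q).isPrincipalAt_iff ((hq q).isOrdinaryDoublePoint hF) a).1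
      (ha.isPrincipalAt _)
    rw [quadrangleHom_apply, Finsupp.zero_apply]
    simp only [Finsupp.equivFunOnFinite_symm_apply_apply, Equiv.symm_apply_apply]
    omega

end Fan

end PicardGroup

end Toric

theorem mainTheorem9 :
    -- the local condition at an ordinary double point of a toric threefold
    (∀ (F : Toric.Fan 3) (σ : F.cones),
      Toric.IsOrdinaryDoublePoint (F.toricVariety.presheaf.stalk (F.orbitPoint σ)) →
        (∃ A B C D : F.rays, Toric.Fan.IsQuadrangle σ A B C D) ∧
        ∀ A B C D : F.rays, Toric.Fan.IsQuadrangle σ A B C D → ∀ a : F.rays →₀ ℤ,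
          (Toric.IsPrincipalAt (F.divisor a) (F.orbitPoint σ) ↔ a A + a C = a B + a D)) ∧
    -- the exact sequence for a nodal toric Fano threefold
    (∀ F : Toric.Fan 3, F.IsFano → Toric.IsNodal F.toricVariety →
      ∀ (G : Toric.Fan 3) (h : Toric.Fan.IsSmallResolution G F)
        (A B C D : F.quadrangles → F.rays),
        (∀ q : F.quadrangles, Toric.Fan.IsQuadrangle q.1 (A q) (B q) (C q) (D q)) →
        (∀ a : G.rays →₀ ℤ, ∃ s : Toric.CartierDivisor G.toricVariety,
          Toric.HasWeilDivisor s (G.divisor a)) ∧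
        (∀ L : Toric.Pic G.toricVariety, ∃ (a : G.rays →₀ ℤ)
          (s : Toric.CartierDivisor G.toricVariety),
          Toric.HasWeilDivisor s (G.divisor a) ∧ Toric.divisorClass G.toricVariety s = L) ∧
        ∃ φ : Additive (Toric.Pic G.toricVariety) →+ (F.quadrangles →₀ ℤ),
          (∀ (a : G.rays →₀ ℤ) (s : Toric.CartierDivisor G.toricVariety),
            Toric.HasWeilDivisor s (G.divisor a) → ∀ q : F.quadrangles,
              φ (Additive.ofMul (Toric.divisorClass G.toricVariety s)) q =
                a (h.rayEquiv (A q)) - a (h.rayEquiv (B q)) +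
                  a (h.rayEquiv (C q)) - a (h.rayEquiv (D q))) ∧
          Function.Injective (Toric.Pic.pullback (Toric.Fan.toricMap h.refines)) ∧
          Function.Exact (Toric.Pic.pullback (Toric.Fan.toricMap h.refines)).toAdditive φ) := by
  refine ⟨fun F σ h => ⟨?_, fun A B C D hq a => hq.isPrincipalAt_iff h a⟩, ?_⟩
  · obtain ⟨_, _, _, _, A, B, C, D, -, hq⟩ := F.exists_isQuadrangle h
    exact ⟨A, B, C, D, hq⟩
  · intro F _ hF G h A B C D hq
    refine ⟨h.exists_hasWeilDivisor, fun L => ?_, ?_⟩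
    · obtain ⟨a, s, -, hs, hL⟩ :=
        Toric.Fan.exists_hasWeilDivisor_divisorClass_eq h.rayGenerated L
      exact ⟨a, s, hs, hL⟩
    · obtain ⟨φ, hφ⟩ := Toric.Fan.exists_quadrangleHom hF h hq
      exact ⟨φ, fun a s hs q => by rw [hφ a s hs]; rfl,
        Toric.Fan.pullback_toricMap_injective h.refines h.rayGenerated
          (Toric.Fan.rayGenerated_of_isNodal hF) (e := h.rayEquiv) fun _ => rfl,
        Toric.Fan.exact_pullback_toricMap hF h hq hφ⟩
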